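/- **Setting.** Fix $W\in\mathbb N$, a key type $K$ with a hash function $\mathrm{hashcode}:K\to\mathbb N$ (not assumed injective), a type of values, and a set of threads. The *chunk* of $k$ at level $l$ is $m(l,k)=\lfloor \mathrm{hashcode}(k)/2^{l}\rfloor \bmod 2^W$. The shared memory has a reference $root$ and a heap of nodes identified by address: an *inode* has one mutable field $main$; a *cnode* has immutable fields $bmp$ (a bitmap) and $array$ (a list of references); an *snode* $(k,v,tomb)$ is immutable, and is *tombed* (written $sn\dagger$) if $tomb$ is true. Allocation always yields a fresh address. An inode with $main=null$ is a *null-inode*, one with $main=sn\dagger$ a *tomb-inode*; a *singleton* is an snode or a tomb-inode. The flag of index $r$ is $2^r$, and $pos(r)$ is the number of set bits of $bmp$ below $r$. The branch $cn.br(r)$ of a cnode is $array(pos(r))$ if bit $r$ of $bmp$ is set, and $null$ otherwise. **Algorithm.** $\mathrm{READ}(x)$ and $\mathrm{CAS}(x,old,new)$ ($x$ is $root$ or a field $i.main$; references are compared by address) are atomic; every other inspection of a $main$ field is also one atomic read. A failed pattern match stops the thread. At a cnode $cn$ at level $l$, put $r=m(l,k)$. * $insert(k,v)$: read $r_0=root$.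 If $r_0$ is $null$ or a null-inode, try $\mathrm{CAS}(root,r_0,nr)$, where $nr$ is a new inode holding a cnode whose only branch, of index $m(0,k)$, is a new snode $(k,v,\bot)$; if this fails, start again. Otherwise run $iinsert(r_0,k,v,0,null)$ and start again if it returns $\bot$. * $lookup(k)$ / $remove(k)$: read $r_0=root$. If $r_0=null$, return NOTFOUND. If $r_0$ is a null-inode, do $\mathrm{CAS}(root,r_0,null)$ and start again. Otherwise run $ilookup(r_0,k,0,null)$ / $iremove(r_0,k,0,null)$, start again if it returns RESTART, and otherwise return its result. * $ilookup$, $iinsert$, $iremove$ on $(i,k,l,parent)$ read $i.main$. If it is $null$ or tombed, they call $clean(parent)$ if $parent\neq null$ and return RESTART (for $iinsert$: $\bot$). Let it be a cnode $cn$. If bit $r$ of $cn.bmp$ is unset, $ilookup$ and $iremove$ return NOTFOUND, and $iinsert$ returns the outcome of $\mathrm{CAS}(i.main,cn,cn')$, $cn'$ being $cn$ with a new snode $(k,v,\bot)$ added as branch $r$. If branch $r$ is an inode $j$, they recurse on $(j,k,l+W,i)$. If it is an untombed snode $sn$ with key $k$: $ilookup$ returns its value; $iinsert$ returns the outcome of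 the CAS of $i.main$ from $cn$ to $cn$ with branch $r$ replaced by a new snode $(k,v,\bot)$; $iremove$ does $\mathrm{CAS}(i.main,cn,cn')$, where $cn'$ is $cn$ without branch $r$ ($null$ if $cn.array$ has length 1), with result the value of $sn$ on success and RESTART on failure. If the key of $sn$ is not $k$: $ilookup$ and $iremove$ have result NOTFOUND; $iinsert$ returns the outcome of the CAS of $i.main$ from $cn$ to $cn$ with branch $r$ replaced by a new inode holding $pair(sn,nsn,l+W)$, $nsn$ a new snode $(k,v,\bot)$. Here $pair(x,y,l)$ is a new cnode with the two branches $x,y$ if their chunks at $l$ differ, and otherwise a new cnode whose only branch, at the common chunk, is a new inode holding $pair(x,y,l+W)$ (so it does not return if the hashcodes are equal). Whenever $iremove$ on $(i,k,l,parent)$, directly or by its recursive call, has obtained a value, and $parent\ne null$, it runs $tombCompress(i)$, then, if that returned $\top$, $contractParent(parent,i,k,l-W)$, and then returns the value. * $clean(i)$: read $i.main$; if it is a cnode $cn$, do $\mathrm{CAS}(i.main,cn,C)$, $C=toCompressed(cn)$. If $cn.bmp$ has one set bit and $cn.array(0)$ is a tomb-inode, $C$ is the $main$ of that inode; otherwise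 the branches of $cn$ are scanned once, null-inodes are dropped, then the remaining tomb-inodes are replaced by untombed copies of their snodes, and $C$ is a new cnode with the resulting branches, or $null$ if none remain. * $tombCompress(i)$: read $i.main$; if it is not a cnode return $\bot$. Otherwise let $cn$ be it and scan its branches once, keeping those that are not null-inodes. If more than one is kept, return $\bot$. Otherwise let $T=null$ if none is kept, $T$ a new tombed copy of the snode if the kept one is a singleton, and else $T$ a new cnode with that one branch. If $\mathrm{CAS}(i.main,cn,T)$ fails, start again; otherwise return $\top$ iff $T$ is $null$ or a tombed snode. * $contractParent(parent,i,k,l)$: read $m=i.main$, then $parent.main$. If the latter is a cnode $cn$ with $cn.br(m(l,k))=i$, then: if $m=null$, try to CAS $parent.main$ from $cn$ to $cn$ without that branch; if $m$ is an snode, to $cn$ with that branch replaced by an untombed copy of $m$; if the CAS fails, start again. In all other cases return. An *execution* starts with $root=null$, an empty heap and all threads idle, and is any finite interleaving of atomic steps of the threads, where an idle thread may invoke any operation $insert(k,v)$, $lookup(k)$, $remove(k)$ and becomes idle again when it responds. Time $n$ is the moment before step $n$. **Validity.** A reachable node has prefix $p=r_0r_1\cdots r_{d-1}$ and level $l=Wd$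 if it is reached from $root$ by following the branches with these indices. The state is *valid* if $root$ is $null$ or an inode and, for all reachable nodes, INV1: for every inode, $main$ is $null$, a cnode or a tombed snode; INV2: for every cnode, $array$ has as many entries as $bmp$ has set bits; INV3: bit $r$ of a cnode's $bmp$ is set iff $r<2^W$ and the branch with index $r$ is an inode or an untombed snode; INV4: if branch $r$ of a cnode with prefix $p$ is an snode $sn$, then $p\cdot r$ is a prefix of the chunk sequence $m(0,k)\,m(W,k)\,m(2W,k)\cdots$ of $k=sn.k$; INV5: if $main$ of an inode with prefix $p$ is an snode $sn$, then $p$ is a prefix of the chunk sequence of $sn.k$. **Consistency.** For a cnode $cn$ at level $l$, $hasKey(cn,k)$ holds iff $cn.br(m(l,k))$ is an snode with key $k$, or an inode $j$ (at level $l+W$) with $hasKey(j,k)$; $hasKey(i,k)$ holds for an inode iff $i.main$ is an snode with key $k$, or a cnode $cn$ with $hasKey(cn,k)$. The state is *consistent* with $\mathbb A\subseteq K$ if for all $k$: $k\in\mathbb A$ iff $root\ne null$ and $hasKey(root,k)$. The abstract operations are $insert(k,\mathbb A)=\mathbb A\cup\{k\}$, $remove(k,\mathbb A)=\mathbb A\setminus\{k\}$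 and $lookup(k,\mathbb A)=\mathbb A$. **Theorem (Safety).** In every execution, at all times $n$ the state is valid and consistent with some abstract set $\mathbb A_n$, and the operations are consistent with the abstract set semantics: 1. if step $n$ changes the abstract set ($\mathbb A_{n+1}\ne\mathbb A_n$), then it is a step of a thread running some operation $op$, and $\mathbb A_{n+1}=op(\mathbb A_n)$; 2. each operation, completed or not, changes the abstract set in at most one of its steps; 3. each completed operation $op$ has a step $n$, between its invocation and its response, with $\mathbb A_{n+1}=op(\mathbb A_n)$, while none of its other steps changes the abstract set; and a $lookup(k)$ or $remove(k)$ returns a value rather than NOTFOUND if and only if $k\in\mathbb A_n$ for this step $n$. -/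

import Mathlib

namespace Ctrie

/-! ### Memory

References are addresses of heap cells, `none : Option Addr` is the null reference.  The `main` field
of an inode and the `root` reference are the only mutable locations.  Allocation always returns a
never used address and nothing is reclaimed, which is what a program can observe in the presence of
a garbage collector. -/

abbrev Addr := ℕ

/-- The three kinds of nodes.  `tomb = true` marks a tombed snode. -/
inductive Node (K V : Type) where
  | inode (main : Option Addr)
  | cnode (bmp : ℕ) (array : List Addr)
  | snode (k : K) (v : V) (tomb : Bool)

/-- The shared memory: the `root` reference, the heap, and the first address never allocated. -/
structure Mem (K V : Type) where
  root : Option Addr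
  heap : Addr → Option (Node K V)
  next : Addr

/-- The empty Ctrie. -/
def Mem.init (K V : Type) : Mem K V where
  root := none
  heap := fun _ => none
  next := 0

/-! ### Bitmaps and hashcode chunks -/

/-- The number of bits that are set. -/
def bitcount (b : ℕ) : ℕ := b.bitIndices.length

/-- The hashcode chunk `(h >> lev) mod 2^W`: the branch index at level `lev`. -/
def chunk (W lev h : ℕ) : ℕ := (h >>> lev) % 2 ^ W

/-- The flag of the branch index `r`. -/
def flag (r : ℕ) : ℕ := 1 <<< r

/-- The position in the array of the branch with index `r`. -/
def pos (bmp r : ℕ) : ℕ := bitcount ((flag r - 1) &&& bmp)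

/-- The flag of branch index `r` is set in the bitmap. -/
abbrev Flagged (bmp r : ℕ) : Prop := bmp &&& flag r ≠ 0

/-- The branch with index `r` of a cnode, or null if the flag of `r` is not set. -/
def branch (bmp : ℕ) (array : List Addr) (r : ℕ) : Option Addr :=
  if Flagged bmp r then array[pos bmp r]? else none

/-! ### Programs

A program is a tree of atomic instructions.  `call` invokes a procedure by name, so that the mutually
recursive procedures below need not terminate. -/

/-- Results of the recursive procedures `ilookup` and `iremove`. -/
inductive Res (V : Type) where
  | found (v : V)
  | notFound
  | restart

/-- Procedure calls. -/
inductive Call (K V : Type) where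
  | insert (k : K) (v : V)
  | remove (k : K)
  | lookup (k : K)
  | iinsert (i : Addr) (k : K) (v : V) (lev : ℕ) (parent : Option Addr)
  | iremove (i : Addr) (k : K) (lev : ℕ) (parent : Option Addr)
  | ilookup (i : Addr) (k : K) (lev : ℕ) (parent : Option Addr)
  | newPair (x : Addr) (kx : K) (y : Addr) (ky : K) (lev : ℕ)
  | clean (i : Addr)
  | tombCompress (i : Addr)
  | contractParent (parent i : Addr) (k : K) (lev : ℕ)

/-- The result type of a procedure. -/
@[reducible] def Call.Ret {K V : Type} : Call K V → Type
  | .insert _ _ => Unit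
  | .remove _ => Option V
  | .lookup _ => Option V
  | .iinsert _ _ _ _ _ => Bool
  | .iremove _ _ _ _ => Res V
  | .ilookup _ _ _ _ => Res V
  | .newPair _ _ _ _ _ => Addr
  | .clean _ => Unit
  | .tombCompress _ => Bool
  | .contractParent _ _ _ _ => Unit

inductive Prog (K V : Type) (α : Type) where
  /-- return from the procedure -/
  | ret (a : α)
  /-- a failed pattern match or an array index out of bounds: no further step -/
  | crash
  /-- `READ(root)` -/
  | readRoot (f : Option Addr → Prog K V α)
  /-- `CAS(root, old, new)` -/
  | casRoot (old new : Option Addr) (f : Bool → Prog K V α)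
  /-- `READ(i.main)` -/
  | read (i : Addr) (f : Option Addr → Prog K V α)
  /-- `CAS(i.main, old, new)` -/
  | cas (i : Addr) (old new : Option Addr) (f : Bool → Prog K V α)
  /-- inspect the type and the immutable fields of a node -/
  | load (a : Addr) (f : Node K V → Prog K V α)
  /-- allocate a new node -/
  | alloc (n : Node K V) (f : Addr → Prog K V α)
  /-- call a procedure -/
  | call (c : Call K V) (f : c.Ret → Prog K V α)

namespace Prog

variable {K V α β : Type}

def bind : Prog K V α → (α → Prog K V β) → Prog K V β
  | ret a, g => g a
  | crash, _ => crash
  | readRoot f, g => readRoot fun x => (f x).bind g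
  | casRoot o n f, g => casRoot o n fun x => (f x).bind g
  | read i f, g => read i fun x => (f x).bind g
  | cas i o n f, g => cas i o n fun x => (f x).bind g
  | load a f, g => load a fun x => (f x).bind g
  | alloc n f, g => alloc n fun x => (f x).bind g
  | call c f, g => call c fun x => (f x).bind g

instance : Monad (Prog K V) where
  pure := ret
  bind := bind

end Prog

variable {K V : Type}

def rdRoot : Prog K V (Option Addr) := .readRoot .ret
def casRoot (old new : Option Addr) : Prog K V Bool := .casRoot old new .ret
def rd (i : Addr) : Prog K V (Option Addr) := .read i .ret
def cas (i : Addr) (old new : Option Addr) : Prog K V Bool := .cas i old new .ret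
def load (a : Addr) : Prog K V (Node K V) := .load a .ret
def alloc (n : Node K V) : Prog K V Addr := .alloc n .ret
def call (c : Call K V) : Prog K V c.Ret := .call c .ret

/-- Array access. -/
def fetch (array : List Addr) (n : ℕ) : Prog K V Addr :=
  match array[n]? with
  | some a => pure a
  | none => .crash

/-! ### The compression procedures -/

/-- Is the reference null or a null-inode? -/
def isNullInode (r : Option Addr) : Prog K V Bool :=
  match r with
  | none => pure true
  | some a => do return (← rd a).isNone

/-- Is the node a tomb-inode, that is, an inode whose `main` is a tombed snode? -/
def isTombInode (a : Addr) : Prog K V Bool := do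
  match ← load a with
  | .inode _ =>
    match ← rd a with
    | none => return false
    | some m =>
      match ← load m with
      | .snode _ _ true => return true
      | _ => return false
  | _ => return false

/-- Is the node an snode or a tomb-inode? -/
def isSingleton (a : Addr) : Prog K V Bool := do
  match ← load a with
  | .snode _ _ _ => return true
  | _ => isTombInode a

/-- A tombed copy of a singleton. -/
def tombed (a : Addr) : Prog K V Addr := do
  match ← load a with
  | .snode k v _ => alloc (.snode k v true)
  | .inode _ =>
    match ← rd a with
    | none => .crash
    | some m =>
      match ← load m with
      | .snode k v _ => alloc (.snode k v true)
      | _ => .crash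
  | _ => .crash

/-- Replace a tomb-inode by an untombed copy of its snode, leave any other node unchanged. -/
def resurrect (a : Addr) : Prog K V Addr := do
  match ← load a with
  | .inode _ =>
    match ← rd a with
    | none => return a
    | some m =>
      match ← load m with
      | .snode k v true => alloc (.snode k v false)
      | _ => return a
  | _ => return a

/-- Is the array entry something else than a null-inode? -/
def notNullInode (a : Addr) : Prog K V Bool := do
  match ← load a with
  | .inode _ => return (← rd a).isSome
  | _ => return true

/-- Scan the given branches (index, reference) once, in order, and keep those that are not null-inodes
when they are looked at. -/
def filtered : List (ℕ × Addr) → Prog K V (List (ℕ × Addr))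
  | [] => pure []
  | (r, a) :: l => do
    let b ← notNullInode a
    let l' ← filtered l
    return if b then (r, a) :: l' else l'

/-- Apply `resurrect` to all entries in order. -/
def resurrectAll : List Addr → Prog K V (List Addr)
  | [] => pure []
  | a :: l => do
    let a' ← resurrect a
    let l' ← resurrectAll l
    return a' :: l'

/-- The bitmap with the flags of the given branches set. -/
def bitmapOf (l : List (ℕ × Addr)) : ℕ := (l.map fun x => flag x.1).sum

/-- `toCompressed` of the cnode with the given fields. -/
def toCompressed (bmp : ℕ) (array : List Addr) : Prog K V (Option Addr) := do
  let num := bitcount bmp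
  let lone ← if num = 1 then do isTombInode (← fetch array 0) else pure false
  if lone then
    rd (← fetch array 0)
  else
    let kept ← filtered (bmp.bitIndices.zip array)
    let nbmp := bitmapOf kept
    let rarr ← resurrectAll (kept.map Prod.snd)
    if bitcount nbmp > 0 then
      return some (← alloc (.cnode nbmp rarr))
    else
      return none

/-- `toWeakTombed` of the cnode at address `cn` with the given fields. -/
def toWeakTombed (cn : Addr) (bmp : ℕ) (array : List Addr) : Prog K V (Option Addr) := do
  let kept ← filtered (bmp.bitIndices.zip array)
  let farr := kept.map Prod.snd
  let nbmp := bitmapOf kept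
  if farr.length > 1 then
    return some cn
  else if farr.length = 1 then
    let a ← fetch farr 0
    if ← isSingleton a then
      return some (← tombed a)
    else
      return some (← alloc (.cnode nbmp farr))
  else
    return none

/-- Call `clean` on the parent unless it is null. -/
def cleanParent (parent : Option Addr) : Prog K V Unit :=
  match parent with
  | none => pure ()
  | some p => call (.clean p)

/-! ### The procedures -/

section

variable [DecidableEq K] (W : ℕ) (hash : K → ℕ)

def insertBody (k : K) (v : V) : Prog K V Unit := do
  let r ← rdRoot
  if ← isNullInode r then
    let sn ← alloc (.snode k v false)
    let scn ← alloc (.cnode (flag (chunk W 0 (hash k))) [sn])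
    let nr ← alloc (.inode (some scn))
    if ← casRoot r (some nr) then return ()
    else call (.insert k v)
  else
    match r with
    | none => .crash
    | some i =>
      if ← call (.iinsert i k v 0 none) then return ()
      else call (.insert k v)

def removeBody (k : K) : Prog K V (Option V) := do
  match ← rdRoot with
  | none => return none
  | some i =>
    if ← isNullInode (some i) then
      let _ ← casRoot (some i) none
      call (.remove k)
    else
      match ← call (.iremove i k 0 none) with
      | .found v => return some v
      | .notFound => return none
      | .restart => call (.remove k)

def lookupBody (k : K) : Prog K V (Option V) := do
  match ← rdRoot with
  | none => return none
  | some i =>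
    if ← isNullInode (some i) then
      let _ ← casRoot (some i) none
      call (.lookup k)
    else
      match ← call (.ilookup i k 0 none) with
      | .found v => return some v
      | .notFound => return none
      | .restart => call (.lookup k)

def ilookupBody (i : Addr) (k : K) (lev : ℕ) (parent : Option Addr) : Prog K V (Res V) := do
  match ← rd i with
  | none =>
    cleanParent parent
    return .restart
  | some m =>
    match ← load m with
    | .cnode bmp array =>
      let r := chunk W lev (hash k)
      if bmp &&& flag r = 0 then
        return .notFound
      else
        let a ← fetch array (pos bmp r)
        match ← load a with
        | .inode _ => call (.ilookup a k (lev + W) (some i))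
        | .snode k' v' false => if k' = k then return .found v' else return .notFound
        | _ => .crash
    | .snode _ _ true =>
      cleanParent parent
      return .restart
    | _ => .crash

def iinsertBody (i : Addr) (k : K) (v : V) (lev : ℕ) (parent : Option Addr) : Prog K V Bool := do
  match ← rd i with
  | none =>
    cleanParent parent
    return false
  | some m =>
    match ← load m with
    | .cnode bmp array =>
      let r := chunk W lev (hash k)
      if bmp &&& flag r = 0 then
        let nsn ← alloc (.snode k v false)
        let ncn ← alloc (.cnode (bmp ||| flag r) (array.insertIdx (pos bmp r) nsn))
        cas i (some m) (some ncn)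
      else
        let a ← fetch array (pos bmp r)
        match ← load a with
        | .inode _ => call (.iinsert a k v (lev + W) (some i))
        | .snode k' _ false =>
          let nsn ← alloc (.snode k v false)
          if k' = k then
            let ncn ← alloc (.cnode bmp (array.set (pos bmp r) nsn))
            cas i (some m) (some ncn)
          else
            let c ← call (.newPair a k' nsn k (lev + W))
            let nin ← alloc (.inode (some c))
            let ncn ← alloc (.cnode bmp (array.set (pos bmp r) nin))
            cas i (some m) (some ncn)
        | _ => .crash
    | .snode _ _ true =>
      cleanParent parent
      return false
    | _ => .crash

/-- The constructor of a cnode at level `lev` from two snodes.  If their keys have the same hashcode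
chunk at `lev`, the two snodes go below a single new inode. -/
def newPairBody (x : Addr) (kx : K) (y : Addr) (ky : K) (lev : ℕ) : Prog K V Addr := do
  let rx := chunk W lev (hash kx)
  let ry := chunk W lev (hash ky)
  if rx = ry then
    let c ← call (.newPair x kx y ky (lev + W))
    let i ← alloc (.inode (some c))
    alloc (.cnode (flag rx) [i])
  else
    alloc (.cnode (flag rx ||| flag ry) (if rx < ry then [x, y] else [y, x]))

/-- The result of the inner match is bound to `res`; after a successful removal the enclosing calls
contract the trie on the way back to the root. -/
def iremoveBody (i : Addr) (k : K) (lev : ℕ) (parent : Option Addr) : Prog K V (Res V) := do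
  match ← rd i with
  | none =>
    cleanParent parent
    return .restart
  | some m =>
    match ← load m with
    | .cnode bmp array =>
      let r := chunk W lev (hash k)
      if bmp &&& flag r = 0 then
        return .notFound
      else
        let a ← fetch array (pos bmp r)
        let res : Res V ← (do
          match ← load a with
          | .inode _ => call (.iremove a k (lev + W) (some i))
          | .snode k' v' false =>
            if k' = k then
              let ncn : Option Addr ← (do
                if array.length = 1 then
                  return none
                else
                  return some (← alloc (.cnode (bmp ^^^ flag r) (array.eraseIdx (pos bmp r)))))
              if ← cas i (some m) ncn then return .found v' else return .restart
            else
              return .notFound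
          | _ => .crash)
        match res, parent with
        | .found v', some p =>
          if ← call (.tombCompress i) then
            call (.contractParent p i k (lev - W))
          return .found v'
        | _, _ => return res
    | .snode _ _ true =>
      cleanParent parent
      return .restart
    | _ => .crash

def cleanBody (i : Addr) : Prog K V Unit := do
  match ← rd i with
  | none => return ()
  | some m =>
    match ← load m with
    | .cnode bmp array =>
      let mc ← toCompressed bmp array
      let _ ← cas i (some m) mc
      return ()
    | _ => return ()

def tombCompressBody (i : Addr) : Prog K V Bool := do
  match ← rd i with
  | none => return false
  | some m =>
    match ← load m with
    | .cnode bmp array =>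
      let mwt ← toWeakTombed m bmp array
      if some m = mwt then
        return false
      else if ← cas i (some m) mwt then
        match mwt with
        | none => return true
        | some w =>
          match ← load w with
          | .snode _ _ true => return true
          | _ => return false
      else
        call (.tombCompress i)
    | _ => return false

def contractParentBody (parent i : Addr) (k : K) (lev : ℕ) : Prog K V Unit := do
  let m ← rd i
  match ← rd parent with
  | none => return ()
  | some cn =>
    match ← load cn with
    | .cnode bmp array =>
      let r := chunk W lev (hash k)
      if bmp &&& flag r = 0 then
        return ()
      else
        let sub ← fetch array (pos bmp r)
        if sub ≠ i then
          return ()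
        else
          match m with
          | none =>
            let ncn ← alloc (.cnode (bmp ^^^ flag r) (array.eraseIdx (pos bmp r)))
            if ← cas parent (some cn) (some ncn) then return ()
            else call (.contractParent parent i k lev)
          | some s =>
            match ← load s with
            | .snode k' v' _ =>
              let usn ← alloc (.snode k' v' false)
              let ncn ← alloc (.cnode bmp (array.set (pos bmp r) usn))
              if ← cas parent (some cn) (some ncn) then return ()
              else call (.contractParent parent i k lev)
            | _ => return ()
    | _ => return ()

/-- The body of each procedure. -/
def body : (c : Call K V) → Prog K V c.Ret
  | .insert k v => insertBody W hash k v
  | .remove k => removeBody k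
  | .lookup k => lookupBody k
  | .iinsert i k v lev parent => iinsertBody W hash i k v lev parent
  | .iremove i k lev parent => iremoveBody W hash i k lev parent
  | .ilookup i k lev parent => ilookupBody W hash i k lev parent
  | .newPair x kx y ky lev => newPairBody W hash x kx y ky lev
  | .clean i => cleanBody i
  | .tombCompress i => tombCompressBody i
  | .contractParent parent i k lev => contractParentBody W hash parent i k lev

/-! ### Concurrent executions -/

/-- One atomic step of a program; `none` if the program has returned or crashed. -/
def Prog.step {α : Type} (σ : Mem K V) : Prog K V α → Option (Mem K V × Prog K V α)
  | .ret _ => none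
  | .crash => none
  | .readRoot f => some (σ, f σ.root)
  | .casRoot old new f =>
    if σ.root = old then some ({ σ with root := new }, f true) else some (σ, f false)
  | .read i f =>
    match σ.heap i with
    | some (.inode m) => some (σ, f m)
    | _ => none
  | .cas i old new f =>
    match σ.heap i with
    | some (.inode m) =>
      if m = old then
        some ({ σ with heap := Function.update σ.heap i (some (.inode new)) }, f true)
      else some (σ, f false)
    | _ => none
  | .load a f =>
    match σ.heap a with
    | some n => some (σ, f n)
    | none => none
  | .alloc n f =>
    some ({ σ with heap := Function.update σ.heap σ.next (some n), next := σ.next + 1 }, f σ.next)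
  | .call c f => some (σ, (body W hash c).bind f)

end

/-- The operations that threads invoke on the Ctrie. -/
inductive Op (K V : Type) where
  | insert (k : K) (v : V)
  | remove (k : K)
  | lookup (k : K)

/-- The program that an operation runs.  Its result is `none` if nothing is returned (`insert`, and
`NOTFOUND` for `remove` and `lookup`). -/
def Op.code : Op K V → Prog K V (Option V)
  | .insert k v => .call (.insert k v) fun _ => .ret none
  | .remove k => .call (.remove k) .ret
  | .lookup k => .call (.lookup k) .ret

inductive ThreadState (K V : Type) where
  | idle
  | running (p : Prog K V (Option V))

/-- A configuration: the shared memory and the state of every thread. -/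
structure Config (K V T : Type) where
  mem : Mem K V
  thr : T → ThreadState K V

def Config.init (K V T : Type) : Config K V T where
  mem := Mem.init K V
  thr := fun _ => .idle

inductive Event (K V : Type) where
  | invoke (op : Op K V)
  | internal
  | response (r : Option V)

/-- `Step W hash c t e c'`: thread `t` makes the step `e` from `c` to `c'`. -/
inductive Step {T : Type} [DecidableEq K] [DecidableEq T] (W : ℕ) (hash : K → ℕ) :
    Config K V T → T → Event K V → Config K V T → Prop
  | invoke (c : Config K V T) (t : T) (op : Op K V) (h : c.thr t = .idle) :
      Step W hash c t (.invoke op) ⟨c.mem, Function.update c.thr t (.running op.code)⟩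
  | internal (c : Config K V T) (t : T) (p p' : Prog K V (Option V)) (σ' : Mem K V)
      (h : c.thr t = .running p) (hs : p.step W hash c.mem = some (σ', p')) :
      Step W hash c t .internal ⟨σ', Function.update c.thr t (.running p')⟩
  | response (c : Config K V T) (t : T) (r : Option V) (h : c.thr t = .running (.ret r)) :
      Step W hash c t (.response r) ⟨c.mem, Function.update c.thr t .idle⟩

/-- An execution of `N` steps from the empty Ctrie, with any interleaving of the threads: at time `n`
the configuration is `c n`, and the step from time `n` to `n + 1` is the event `e n` of thread
`t n`. -/
structure IsExecution {T : Type} [DecidableEq K] [DecidableEq T] (W : ℕ) (hash : K → ℕ) (N : ℕ)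
    (c : ℕ → Config K V T) (t : ℕ → T) (e : ℕ → Event K V) : Prop where
  init : c 0 = Config.init K V T
  step : ∀ n < N, Step W hash (c n) (t n) (e n) (c (n + 1))

/-- Thread `th` invokes `op` in step `i`, and all its later steps before step `j` belong to this
invocation. -/
def Runs {T : Type} (t : ℕ → T) (e : ℕ → Event K V) (th : T) (op : Op K V) (i j : ℕ) : Prop :=
  i < j ∧ t i = th ∧ e i = .invoke op ∧ ∀ m, i < m → m < j → t m = th → e m = .internal

/-! ### Validity and consistency -/

/-- `NodeAt σ p a`: the node at address `a` is reachable from the root, and `p` is the sequence of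
branch indices followed on the way (its hashcode prefix).  Its level is `W * p.length`. -/
inductive NodeAt (σ : Mem K V) : List ℕ → Addr → Prop
  | root (a : Addr) (h : σ.root = some a) : NodeAt σ [] a
  | main (p : List ℕ) (a b : Addr) (hp : NodeAt σ p a) (h : σ.heap a = some (.inode (some b))) :
      NodeAt σ p b
  | branch (p : List ℕ) (a b : Addr) (bmp : ℕ) (array : List Addr) (r : ℕ) (hp : NodeAt σ p a)
      (h : σ.heap a = some (.cnode bmp array)) (hb : branch bmp array r = some b) :
      NodeAt σ (p ++ [r]) b

/-- `p` is a prefix of the sequence of chunks of the hashcode `h`. -/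
def IsHashPrefix (W h : ℕ) (p : List ℕ) : Prop :=
  p = (List.range p.length).map fun j => chunk W (W * j) h

/-- The root is null or an inode, and the `main` field of an inode is null, a cnode or a tombed
snode. -/
def Inv1 (σ : Mem K V) : Prop :=
  (∀ a, σ.root = some a → ∃ m, σ.heap a = some (.inode m)) ∧
  ∀ p a b, NodeAt σ p a → σ.heap a = some (.inode (some b)) →
    (∃ bmp array, σ.heap b = some (.cnode bmp array)) ∨ ∃ k v, σ.heap b = some (.snode k v true)

/-- The length of the array of a cnode is the bitcount of its bitmap. -/
def Inv2 (σ : Mem K V) : Prop :=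
  ∀ p a bmp array, NodeAt σ p a → σ.heap a = some (.cnode bmp array) →
    bitcount bmp = array.length

/-- A flag is set if and only if it is one of the `2 ^ W` flags and the branch is an inode or a
(non-tombed) snode. -/
def Inv3 (W : ℕ) (σ : Mem K V) : Prop :=
  ∀ p a bmp array r, NodeAt σ p a → σ.heap a = some (.cnode bmp array) →
    (Flagged bmp r ↔ r < 2 ^ W ∧ ∃ b, branch bmp array r = some b ∧
      ((∃ m, σ.heap b = some (.inode m)) ∨ ∃ k v, σ.heap b = some (.snode k v false)))

/-- If branch `r` of a cnode with prefix `p` is an snode, the hashcode of its key starts with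
`p · r`. -/
def Inv4 (W : ℕ) (hash : K → ℕ) (σ : Mem K V) : Prop :=
  ∀ p a bmp array r b k v tomb, NodeAt σ p a → σ.heap a = some (.cnode bmp array) →
    branch bmp array r = some b → σ.heap b = some (.snode k v tomb) →
    IsHashPrefix W (hash k) (p ++ [r])

/-- If an inode with prefix `p` holds an snode, the hashcode of its key starts with `p`. -/
def Inv5 (W : ℕ) (hash : K → ℕ) (σ : Mem K V) : Prop :=
  ∀ p a b k v tomb, NodeAt σ p a → σ.heap a = some (.inode (some b)) →
    σ.heap b = some (.snode k v tomb) → IsHashPrefix W (hash k) p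

structure Valid (W : ℕ) (hash : K → ℕ) (σ : Mem K V) : Prop where
  inv1 : Inv1 σ
  inv2 : Inv2 σ
  inv3 : Inv3 W σ
  inv4 : Inv4 W hash σ
  inv5 : Inv5 W hash σ

/-- `HasKey W hash σ k l a`: the key `k` is found below the inode or cnode at address `a`, which is
at level `l`, by following the branches given by the chunks of the hashcode of `k`. -/
inductive HasKey (W : ℕ) (hash : K → ℕ) (σ : Mem K V) (k : K) : ℕ → Addr → Prop
  | inodeHolds (l : ℕ) (a s : Addr) (v : V) (tomb : Bool) (h : σ.heap a = some (.inode (some s)))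
      (hs : σ.heap s = some (.snode k v tomb)) : HasKey W hash σ k l a
  | inodeMain (l : ℕ) (a c bmp : ℕ) (array : List Addr) (h : σ.heap a = some (.inode (some c)))
      (hc : σ.heap c = some (.cnode bmp array)) (hk : HasKey W hash σ k l c) :
      HasKey W hash σ k l a
  | cnodeHolds (l : ℕ) (a s bmp : ℕ) (array : List Addr) (v : V) (tomb : Bool)
      (h : σ.heap a = some (.cnode bmp array))
      (hb : branch bmp array (chunk W l (hash k)) = some s)
      (hs : σ.heap s = some (.snode k v tomb)) : HasKey W hash σ k l a
  | cnodeSub (l : ℕ) (a i bmp : ℕ) (array : List Addr) (m : Option Addr)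
      (h : σ.heap a = some (.cnode bmp array))
      (hb : branch bmp array (chunk W l (hash k)) = some i)
      (hi : σ.heap i = some (.inode m)) (hk : HasKey W hash σ k (l + W) i) :
      HasKey W hash σ k l a

/-- The state is consistent with the abstract set `A`: the keys in `A` are exactly those that the
Ctrie has. -/
def Consistent (W : ℕ) (hash : K → ℕ) (σ : Mem K V) (A : Set K) : Prop :=
  ∀ k, k ∈ A ↔ ∃ a, σ.root = some a ∧ HasKey W hash σ k 0 a

/-- The abstract set after an abstract operation. -/
def Op.apply : Op K V → Set K → Set K
  | .insert k _, A => A ∪ {k}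
  | .remove k, A => A \ {k}
  | .lookup _, A => A

/-- The result `r` is right for the operation on the abstract set `A`: `lookup` and `remove` find the
key if and only if it is in `A`. -/
def Op.ResultOk : Op K V → Set K → Option V → Prop
  | .insert _ _, _, _ => True
  | .remove k, A, r => r.isSome ↔ k ∈ A
  | .lookup k, A, r => r.isSome ↔ k ∈ A

/-- The behaviour of an execution of `N` steps follows the abstract set semantics, where `A n` is the
abstract set at time `n`. -/
structure FollowsSetSemantics {T : Type} (N : ℕ) (t : ℕ → T) (e : ℕ → Event K V)
    (A : ℕ → Set K) : Prop where
  /-- Each change of the abstract set is the effect of the operation run by the acting thread. -/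
  change : ∀ n < N, A (n + 1) ≠ A n → ∃ op i, i < n ∧ Runs t e (t n) op i (n + 1) ∧
    A (n + 1) = op.apply (A n)
  /-- An operation, completed or not, changes the abstract set at most once. -/
  once : ∀ th op i j, j ≤ N → Runs t e th op i j → ∀ m n, i < m → m < j → i < n → n < j →
    t m = th → t n = th → A (m + 1) ≠ A m → A (n + 1) ≠ A n → m = n
  /-- A completed operation has one step, between its invocation and its response, that acts on the
  abstract set as the abstract operation does and agrees with the returned result; its other steps
  do not change the abstract set. -/
  complete : ∀ th op i j r, j < N → Runs t e th op i j → t j = th → e j = .response r →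
    ∃ n, i < n ∧ n < j ∧ t n = th ∧ A (n + 1) = op.apply (A n) ∧ op.ResultOk (A n) r ∧
      ∀ m, i < m → m < j → t m = th → m ≠ n → A (m + 1) = A m

end Ctrie

/-!
The abstract set of a state is `Ctrie.absSet`, the set of the keys that are found from the root, so
that consistency is immediate. Validity and the set semantics follow from an invariant and a
rely/guarantee argument.

*Invariant.* Each inode and each cnode is given a prefix when it is allocated, and the validity
conditions are required of every allocated node with respect to this prefix, so that no
reachability has to be tracked for them (`WellFormed`). In addition, the ghost state of `World`
records which nodes have ever been reachable ("published") and which thread allocated a node. The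
main clause of `Inv` is that a published inode that holds a cnode is reachable, under its own
prefix. Therefore the `main` of such an inode decides whether the keys on its path are in the
abstract set (`Inv.hasMain_iff_mem`), even if the thread that reads it has arrived there by an
outdated path.

*Updates.* Cnodes, snodes, null-inodes and inodes that hold an snode never change (`Ext`), so the
only changes of reachable memory are a CAS that replaces a cnode in an inode, and a CAS that
replaces a root that is null or a null-inode. The first preserves the invariant if the new `main`
keeps all branches that are inodes holding a cnode (`CanSet.inv`). It then changes the membership
of exactly those keys whose status below the inode it changes (`CanSet.mem_absSet_iff`,
`CanSet.mem_absSet_of_prefix`).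

*Compression.* `clean`, `tombCompress` and `contractParent` scan the branches of a cnode while
other threads proceed, but they only act on null-inodes and tomb-inodes, which are immutable, and
on the cnode itself, which the CAS compares. So what was computed is still correct when the CAS
succeeds, and the keys below the inode remain the same (`Compression.hasMain_iff`).

*Linearization.* `insert` takes effect in its successful CAS, and so does a `remove` that finds its
key. All other operations take effect when they read the `main` of the last inode, or a null root.
Since the cnode that was read is immutable, it is determined at the moment of this read whether it
is the last one and what the result will be. The predicate `Safe` states that the steps of a
program keep the invariant, are harmless to the other threads, and take effect at most once,
whatever the others do. `safe_code` proves it for all operations, and `good_succ` carries it along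
an execution.
-/

namespace Ctrie

variable {K V T : Type}

/-! ### Bitmaps -/

theorem flagged_iff {b r : ℕ} : Flagged b r ↔ b.testBit r = true := by
  rw [Flagged, flag, Nat.one_shiftLeft, Nat.and_two_pow]
  cases b.testBit r <;> simp

theorem bitcount_eq_card {b : ℕ} (s : Finset ℕ) (h : ∀ j, j ∈ s ↔ b.testBit j = true) :
    bitcount b = s.card := by
  rw [bitcount, ← List.toFinset_card_of_nodup Nat.bitIndices_nodup]
  congr 1
  ext j
  simp [h]

theorem pos_eq_card (b r : ℕ) : pos b r = ((Finset.range r).filter fun j => b.testBit j).card := by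
  refine bitcount_eq_card _ fun j => ?_
  simp [flag, Nat.one_shiftLeft, Nat.testBit_two_pow_sub_one]

theorem pos_lt_bitcount {b r : ℕ} (h : Flagged b r) : pos b r < bitcount b := by
  rw [pos_eq_card, bitcount_eq_card b.bitIndices.toFinset (by simp)]
  apply Finset.card_lt_card
  rw [Finset.ssubset_iff_of_subset (fun j => by simp)]
  exact ⟨r, by simpa using flagged_iff.1 h, by simp⟩

theorem pos_lt_pos {b r r' : ℕ} (h : Flagged b r) (hr : r < r') : pos b r < pos b r' := by
  rw [pos_eq_card, pos_eq_card]
  apply Finset.card_lt_card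
  rw [Finset.ssubset_iff_of_subset (fun j => by
    simp only [Finset.mem_filter, Finset.mem_range]; exact fun h => ⟨by omega, h.2⟩)]
  exact ⟨r, by simpa using ⟨hr, flagged_iff.1 h⟩, by simp⟩

theorem flagged_of_branch {b r a : ℕ} {arr : List Addr} (h : branch b arr r = some a) :
    Flagged b r := by
  unfold branch at h
  split_ifs at h with hf
  exact hf

theorem branch_of_flagged {b r : ℕ} {arr : List Addr} (h : Flagged b r) :
    branch b arr r = arr[pos b r]? := if_pos h

theorem branch_of_not_flagged {b r : ℕ} {arr : List Addr} (h : ¬ Flagged b r) :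
    branch b arr r = none := if_neg h

theorem exists_branch {b r : ℕ} {arr : List Addr} (hl : bitcount b = arr.length)
    (h : Flagged b r) : ∃ a, branch b arr r = some a := by
  rw [branch_of_flagged h]
  exact ⟨_, List.getElem?_eq_getElem (hl ▸ pos_lt_bitcount h)⟩

theorem testBit_flag (r j : ℕ) : (flag r).testBit j = decide (r = j) := by
  rw [flag, Nat.one_shiftLeft, Nat.testBit_two_pow]

theorem flagged_or_flag {b r j : ℕ} : Flagged (b ||| flag r) j ↔ j = r ∨ Flagged b j := by
  simp only [flagged_iff, Nat.testBit_or, testBit_flag, Bool.or_eq_true, decide_eq_true_eq]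
  tauto

theorem flagged_xor_flag {b r j : ℕ} (h : Flagged b r) :
    Flagged (b ^^^ flag r) j ↔ j ≠ r ∧ Flagged b j := by
  simp only [flagged_iff, Nat.testBit_xor, testBit_flag] at h ⊢
  by_cases hj : r = j
  · subst hj; simp [h]
  · simp [hj, Ne.symm hj]

theorem flagged_flag {r j : ℕ} : Flagged (flag r) j ↔ j = r := by
  simp [flagged_iff, testBit_flag, eq_comm]

theorem bitcount_flag (r : ℕ) : bitcount (flag r) = 1 := by
  rw [bitcount_eq_card {r} (fun j => by simp [testBit_flag, eq_comm]), Finset.card_singleton]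

theorem bitcount_or_flag {b r : ℕ} (h : ¬ Flagged b r) :
    bitcount (b ||| flag r) = bitcount b + 1 := by
  have hr : r ∉ b.bitIndices.toFinset := by simpa [flagged_iff] using h
  rw [bitcount_eq_card (insert r b.bitIndices.toFinset), Finset.card_insert_of_notMem hr,
    bitcount_eq_card b.bitIndices.toFinset (by simp)]
  intro j
  rw [← flagged_iff, flagged_or_flag]
  simp [flagged_iff]

theorem bitcount_xor_flag {b r : ℕ} (h : Flagged b r) :
    bitcount (b ^^^ flag r) = bitcount b - 1 := by
  have hr : r ∈ b.bitIndices.toFinset := by simpa [flagged_iff] using h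
  rw [bitcount_eq_card (b.bitIndices.toFinset.erase r), Finset.card_erase_of_mem hr,
    bitcount_eq_card b.bitIndices.toFinset (by simp)]
  intro j
  rw [← flagged_iff, flagged_xor_flag h]
  simp [flagged_iff]

theorem pos_or_flag {b r j : ℕ} (h : ¬ Flagged b r) :
    pos (b ||| flag r) j = if r < j then pos b j + 1 else pos b j := by
  simp only [pos_eq_card]
  split_ifs with hj
  · rw [← Finset.card_insert_of_notMem (a := r) (by simpa [flagged_iff] using fun _ => h)]
    congr 1
    ext x
    have := @flagged_or_flag b r x
    simp only [flagged_iff] at this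
    simp only [Finset.mem_filter, Finset.mem_range, this, Finset.mem_insert]
    constructor
    · tauto
    · rintro (rfl | h) <;> tauto
  · congr 1
    ext x
    have := @flagged_or_flag b r x
    simp only [flagged_iff] at this
    simp only [Finset.mem_filter, Finset.mem_range, this]
    constructor
    · rintro ⟨h1, rfl | h2⟩
      · exact absurd h1 hj
      · exact ⟨h1, h2⟩
    · tauto

theorem pos_xor_flag {b r j : ℕ} (h : Flagged b r) :
    pos (b ^^^ flag r) j = if r < j then pos b j - 1 else pos b j := by
  have h' : ¬ Flagged (b ^^^ flag r) r := by simp [flagged_xor_flag h]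
  have := @pos_or_flag _ _ j h'
  have e : b ^^^ flag r ||| flag r = b := by
    apply Nat.eq_of_testBit_eq
    intro x
    rw [Bool.eq_iff_iff, ← flagged_iff, ← flagged_iff, flagged_or_flag, flagged_xor_flag h]
    by_cases hx : x = r
    · subst hx; simpa using h
    · simp [hx]
  rw [e] at this
  split_ifs at this ⊢ <;> omega

/-- Adding a branch with a new index. -/
theorem branch_insertIdx {b r : ℕ} {arr : List Addr} (hl : bitcount b = arr.length)
    (h : ¬ Flagged b r) (x : Addr) (j : ℕ) :
    branch (b ||| flag r) (arr.insertIdx (pos b r) x) j =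
      if j = r then some x else branch b arr j := by
  have hle : pos b r ≤ arr.length := by
    rw [← hl, pos_eq_card, bitcount_eq_card b.bitIndices.toFinset (by simp)]
    exact Finset.card_le_card fun j => by simp
  by_cases hj : j = r
  · subst hj
    rw [if_pos rfl, branch_of_flagged (flagged_or_flag.2 (.inl rfl)), pos_or_flag h,
      if_neg (lt_irrefl _), List.getElem?_insertIdx_self, if_pos hle]
  · rw [if_neg hj]
    by_cases hf : Flagged b j
    · rw [branch_of_flagged (flagged_or_flag.2 (.inr hf)), branch_of_flagged hf, pos_or_flag h]
      split_ifs with hr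
      · have : pos b r ≤ pos b j := by
          rw [pos_eq_card, pos_eq_card]
          exact Finset.card_le_card fun x => by
            simp only [Finset.mem_filter, Finset.mem_range]
            exact fun h => ⟨by omega, h.2⟩
        rw [List.getElem?_insertIdx_of_gt (by omega)]
        simp
      · rw [List.getElem?_insertIdx_of_lt (pos_lt_pos hf (by omega))]
    · rw [branch_of_not_flagged hf, branch_of_not_flagged]
      rw [flagged_or_flag]; tauto

/-- Replacing a branch. -/
theorem branch_set {b r : ℕ} {arr : List Addr} (hl : bitcount b = arr.length)
    (h : Flagged b r) (x : Addr) (j : ℕ) :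
    branch b (arr.set (pos b r) x) j = if j = r then some x else branch b arr j := by
  by_cases hj : j = r
  · subst hj
    rw [if_pos rfl, branch_of_flagged h, List.getElem?_set_self (hl ▸ pos_lt_bitcount h)]
  · rw [if_neg hj]
    by_cases hf : Flagged b j
    · rw [branch_of_flagged hf, branch_of_flagged hf, List.getElem?_set_ne]
      rcases Nat.lt_or_gt_of_ne hj with h' | h'
      · exact (pos_lt_pos hf h').ne'
      · exact (pos_lt_pos h h').ne
    · rw [branch_of_not_flagged hf, branch_of_not_flagged hf]

/-- Removing a branch. -/
theorem branch_eraseIdx {b r : ℕ} {arr : List Addr} (h : Flagged b r) (j : ℕ) :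
    branch (b ^^^ flag r) (arr.eraseIdx (pos b r)) j =
      if j = r then none else branch b arr j := by
  by_cases hj : j = r
  · subst hj
    rw [if_pos rfl, branch_of_not_flagged]
    simp [flagged_xor_flag h]
  · rw [if_neg hj]
    by_cases hf : Flagged b j
    · rw [branch_of_flagged ((flagged_xor_flag h).2 ⟨hj, hf⟩), branch_of_flagged hf,
        pos_xor_flag h]
      split_ifs with hr
      · have := pos_lt_pos h hr
        rw [List.getElem?_eraseIdx_of_ge (by omega), Nat.sub_add_cancel (by omega)]
      · rw [List.getElem?_eraseIdx_of_lt (pos_lt_pos hf (by omega))]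
    · rw [branch_of_not_flagged hf, branch_of_not_flagged]
      rw [flagged_xor_flag h]; tauto

theorem branch_flag (r x j : ℕ) : branch (flag r) [x] j = if j = r then some x else none := by
  by_cases hj : j = r
  · subst hj
    have := pos_lt_bitcount (flagged_flag.2 (rfl : j = j))
    rw [bitcount_flag] at this
    rw [if_pos rfl, branch_of_flagged (flagged_flag.2 rfl), Nat.lt_one_iff.1 this]
    rfl
  · rw [if_neg hj, branch_of_not_flagged (mt flagged_flag.1 hj)]

theorem pos_flag (r j : ℕ) : pos (flag r) j = if r < j then 1 else 0 := by
  rw [pos_eq_card]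
  split_ifs with h
  · rw [Finset.card_eq_one]
    exact ⟨r, by ext x; simp [testBit_flag]; constructor <;> rintro h' <;> omega⟩
  · rw [Finset.card_eq_zero]
    ext x; simp [testBit_flag]; omega

theorem pair_eq_insertIdx {rx ry : ℕ} (x y : Addr) :
    (if rx < ry then [x, y] else [y, x]) = [x].insertIdx (pos (flag rx) ry) y := by
  rw [pos_flag]
  split_ifs <;> rfl

/-- The branches of a cnode made from two branches of different indices. -/
theorem branch_pair {rx ry : ℕ} (x y : Addr) (h : rx ≠ ry) (j : ℕ) :
    branch (flag rx ||| flag ry) (if rx < ry then [x, y] else [y, x]) j =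
      if j = ry then some y else if j = rx then some x else none := by
  rw [pair_eq_insertIdx x y, branch_insertIdx (by simp [bitcount_flag])
    (mt flagged_flag.1 h.symm), branch_flag]

theorem bitmapOf_eq_sum (L : List (ℕ × Addr)) :
    bitmapOf L = ((L.map Prod.fst).map fun i => 2 ^ i).sum := by
  simp [bitmapOf, flag, Nat.one_shiftLeft, Function.comp_def]

theorem flagged_bitmapOf {L : List (ℕ × Addr)} (hs : (L.map Prod.fst).SortedLT) (r : ℕ) :
    Flagged (bitmapOf L) r ↔ r ∈ L.map Prod.fst := by
  rw [flagged_iff, ← Nat.mem_bitIndices, bitmapOf_eq_sum, Nat.bitIndices_sum_map_two_pow hs]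

theorem bitcount_bitmapOf {L : List (ℕ × Addr)} (hs : (L.map Prod.fst).SortedLT) :
    bitcount (bitmapOf L) = L.length := by
  rw [bitcount, bitmapOf_eq_sum, Nat.bitIndices_sum_map_two_pow hs, List.length_map]

theorem pos_bitmapOf {L : List (ℕ × Addr)} (hs : (L.map Prod.fst).SortedLT) {n : ℕ}
    (hn : n < L.length) : pos (bitmapOf L) (L[n]).1 = n := by
  have hlt : n < (L.map Prod.fst).length := by simpa using hn
  have key : (L.map Prod.fst)[n] = (L[n]).1 := by simp
  rw [pos_eq_card, ← key]
  set l := L.map Prod.fst with hl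
  have : ((Finset.range l[n]).filter fun j => (bitmapOf L).testBit j) = (l.take n).toFinset := by
    ext j
    have hf := flagged_bitmapOf hs j
    rw [flagged_iff] at hf
    simp only [Finset.mem_filter, Finset.mem_range, List.mem_toFinset, hf]
    constructor
    · rintro ⟨h1, h2⟩
      obtain ⟨i, hi, rfl⟩ := List.getElem_of_mem h2
      have : i < n := by
        by_contra hc
        have := hs.strictMono_get.monotone (a := ⟨n, hlt⟩) (b := ⟨i, hi⟩) (by simpa using hc)
        simp only [List.get_eq_getElem] at this
        exact absurd h1 (not_lt.2 this)
      rw [List.mem_take_iff_getElem]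
      exact ⟨i, by omega, rfl⟩
    · intro h
      rw [List.mem_take_iff_getElem] at h
      obtain ⟨i, hi, rfl⟩ := h
      exact ⟨hs.strictMono_get (a := ⟨i, by omega⟩) (b := ⟨n, hlt⟩)
        (by simp only [Fin.mk_lt_mk]; omega), List.getElem_mem _⟩
  rw [this, List.toFinset_card_of_nodup, List.length_take]
  · omega
  · exact (hs.nodup).sublist (List.take_sublist _ _)

/-- A cnode built from a list of branches that is sorted by index has exactly these branches. -/
theorem branch_bitmapOf {L : List (ℕ × Addr)} (hs : (L.map Prod.fst).SortedLT) (r : ℕ)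
    (a : Addr) : branch (bitmapOf L) (L.map Prod.snd) r = some a ↔ (r, a) ∈ L := by
  constructor
  · intro h
    have hf := (flagged_bitmapOf hs r).1 (flagged_of_branch h)
    obtain ⟨n, hn, rfl⟩ := List.getElem_of_mem hf
    simp only [List.getElem_map] at h
    rw [branch_of_flagged (flagged_of_branch h), pos_bitmapOf hs (by simpa using hn)] at h
    simp only [List.length_map] at hn
    simp only [List.getElem?_map, List.getElem?_eq_getElem hn, Option.map_some,
      Option.some.injEq] at h
    simp only [List.getElem_map, ← h]
    exact List.getElem_mem _
  · intro h
    have hf := (flagged_bitmapOf hs r).2 (List.mem_map_of_mem h)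
    obtain ⟨n, hn, e⟩ := List.getElem_of_mem h
    rw [branch_of_flagged hf]
    have := pos_bitmapOf hs hn
    rw [e] at this
    rw [this]
    simp [hn, e]

theorem map_fst_zip_bitIndices {b : ℕ} {arr : List Addr} (hl : bitcount b = arr.length) :
    (b.bitIndices.zip arr).map Prod.fst = b.bitIndices :=
  List.map_fst_zip (le_of_eq hl)

theorem map_snd_zip_bitIndices {b : ℕ} {arr : List Addr} (hl : bitcount b = arr.length) :
    (b.bitIndices.zip arr).map Prod.snd = arr :=
  List.map_snd_zip (le_of_eq hl.symm)

theorem sorted_zip_bitIndices {b : ℕ} {arr : List Addr} (hl : bitcount b = arr.length) :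
    ((b.bitIndices.zip arr).map Prod.fst).SortedLT := by
  rw [map_fst_zip_bitIndices hl]
  exact Nat.bitIndices_sorted

theorem branch_iff_mem_zip {b : ℕ} {arr : List Addr} (hl : bitcount b = arr.length)
    (r : ℕ) (a : Addr) : branch b arr r = some a ↔ (r, a) ∈ b.bitIndices.zip arr := by
  have hb : bitmapOf (b.bitIndices.zip arr) = b := by
    rw [bitmapOf_eq_sum, map_fst_zip_bitIndices hl, Nat.sum_map_two_pow_bitIndices]
  have := branch_bitmapOf (sorted_zip_bitIndices hl) r a
  rwa [hb, map_snd_zip_bitIndices hl] at this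

/-- A cnode built with the bitmap of a sorted list of branches, but from an array whose entries are
related to these branches one by one, has branches with the same indices, each related to the old
one. -/
theorem branch_bitmapOf_forall₂ {L : List (ℕ × Addr)} (hs : (L.map Prod.fst).SortedLT)
    {R : Addr → Addr → Prop} {l : List Addr} (hR : List.Forall₂ R (L.map Prod.snd) l) :
    bitcount (bitmapOf L) = l.length ∧
      (∀ r b, branch (bitmapOf L) l r = some b → ∃ a, (r, a) ∈ L ∧ R a b) ∧
      ∀ r a, (r, a) ∈ L → ∃ b, branch (bitmapOf L) l r = some b := by
  have hlen : L.length = l.length := by simpa using hR.length_eq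
  have h1 : ((L.map Prod.fst).zip l).map Prod.fst = L.map Prod.fst :=
    List.map_fst_zip (by simp [hlen])
  have h2 : ((L.map Prod.fst).zip l).map Prod.snd = l := List.map_snd_zip (by simp [hlen])
  have hb : bitmapOf ((L.map Prod.fst).zip l) = bitmapOf L := by
    rw [bitmapOf_eq_sum, h1, ← bitmapOf_eq_sum]
  have hbr := branch_bitmapOf (h1.symm ▸ hs)
  rw [hb, h2] at hbr
  refine ⟨(bitcount_bitmapOf hs).trans hlen, fun r b h => ?_, fun r a h => ?_⟩
  · rw [hbr] at h
    obtain ⟨n, hn, e⟩ := List.getElem_of_mem h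
    simp only [List.length_zip, List.length_map] at hn
    simp only [List.getElem_zip, List.getElem_map, Prod.mk.injEq] at e
    refine ⟨(L[n]'(by omega)).2, ?_, ?_⟩
    · rw [← e.1]; exact List.getElem_mem _
    · have := hR.get (i := n) (by simp; omega) (by omega)
      simpa [e.2] using this
  · exact exists_branch ((bitcount_bitmapOf hs).trans hlen)
      ((flagged_bitmapOf hs r).2 (List.mem_map_of_mem h))

/-! ### Hashcode prefixes and keys -/

theorem isHashPrefix_nil (W h : ℕ) : IsHashPrefix W h [] := rfl

theorem isHashPrefix_append {W h : ℕ} {p : List ℕ} {r : ℕ} :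
    IsHashPrefix W h (p ++ [r]) ↔ IsHashPrefix W h p ∧ r = chunk W (W * p.length) h := by
  unfold IsHashPrefix
  rw [List.length_append, List.length_singleton, List.range_succ, List.map_append,
    List.map_singleton]
  constructor
  · intro e
    obtain ⟨h1, h2⟩ := List.append_inj' e rfl
    exact ⟨h1, by simpa using h2⟩
  · rintro ⟨h1, h2⟩
    rw [← h1, ← h2]

theorem chunk_lt (W l h : ℕ) : chunk W l h < 2 ^ W := Nat.mod_lt _ (by positivity)

/-- The key `k` is found in the branch `b` of a cnode, where `l` is the level of the branch. -/
def HasBelow (W : ℕ) (hash : K → ℕ) (σ : Mem K V) (k : K) (l : ℕ) (b : Addr) : Prop :=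
  (∃ v tomb, σ.heap b = some (.snode k v tomb)) ∨
    (∃ m, σ.heap b = some (.inode m)) ∧ HasKey W hash σ k l b

/-- The key `k` is found in an inode at level `l` whose `main` is `m`. -/
def HasMain (W : ℕ) (hash : K → ℕ) (σ : Mem K V) (k : K) (l : ℕ) (m : Option Addr) : Prop :=
  ∃ c, m = some c ∧ ((∃ v tomb, σ.heap c = some (.snode k v tomb)) ∨
    (∃ bmp arr, σ.heap c = some (.cnode bmp arr)) ∧ HasKey W hash σ k l c)

section

variable {W : ℕ} {hash : K → ℕ} {σ : Mem K V} {k : K} {l : ℕ} {a : Addr}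

theorem hasKey_inode {m : Option Addr} (h : σ.heap a = some (.inode m)) :
    HasKey W hash σ k l a ↔ HasMain W hash σ k l m := by
  constructor
  · rintro (⟨_, _, s, v, tomb, h', hs⟩ | ⟨_, _, c, bmp, arr, h', hc, hk⟩ |
      ⟨_, _, _, _, _, _, _, h'⟩ | ⟨_, _, _, _, _, _, h'⟩)
    · rw [h] at h'; cases h'; exact ⟨s, rfl, .inl ⟨v, tomb, hs⟩⟩
    · rw [h] at h'; cases h'; exact ⟨c, rfl, .inr ⟨⟨_, _, hc⟩, hk⟩⟩
    · rw [h] at h'; cases h'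
    · rw [h] at h'; cases h'
  · rintro ⟨c, rfl, ⟨v, tomb, hs⟩ | ⟨⟨bmp, arr, hc⟩, hk⟩⟩
    · exact .inodeHolds _ _ _ _ _ h hs
    · exact .inodeMain _ _ _ _ _ h hc hk

theorem hasKey_cnode {bmp : ℕ} {arr : List Addr} (h : σ.heap a = some (.cnode bmp arr)) :
    HasKey W hash σ k l a ↔ ∃ b, branch bmp arr (chunk W l (hash k)) = some b ∧
      HasBelow W hash σ k (l + W) b := by
  constructor
  · rintro (⟨_, _, _, _, _, h'⟩ | ⟨_, _, _, _, _, h'⟩ | ⟨_, _, s, _, _, v, tomb, h', hb, hs⟩ |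
      ⟨_, _, i, _, _, m, h', hb, hi, hk⟩)
    · rw [h] at h'; cases h'
    · rw [h] at h'; cases h'
    · rw [h] at h'; cases h'; exact ⟨s, hb, .inl ⟨v, tomb, hs⟩⟩
    · rw [h] at h'; cases h'; exact ⟨i, hb, .inr ⟨⟨m, hi⟩, hk⟩⟩
  · rintro ⟨b, hb, ⟨v, tomb, hs⟩ | ⟨⟨m, hi⟩, hk⟩⟩
    · exact .cnodeHolds _ _ _ _ _ _ _ h hb hs
    · exact .cnodeSub _ _ _ _ _ _ h hb hi hk

theorem hasBelow_inode {m : Option Addr} (h : σ.heap a = some (.inode m)) :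
    HasBelow W hash σ k l a ↔ HasMain W hash σ k l m := by
  rw [HasBelow, hasKey_inode h]
  simp [h]

theorem hasBelow_snode {k' : K} {v : V} {tomb : Bool} (h : σ.heap a = some (.snode k' v tomb)) :
    HasBelow W hash σ k l a ↔ k' = k := by
  constructor
  · rintro (⟨v', tb, h'⟩ | ⟨⟨m, h'⟩, -⟩)
    · rw [h] at h'; cases h'; rfl
    · rw [h] at h'; cases h'
  · rintro rfl; exact .inl ⟨v, tomb, h⟩

theorem hasMain_none : ¬ HasMain W hash σ k l none := by
  rintro ⟨_, h, _⟩; cases h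

theorem hasMain_snode {k' : K} {v : V} {tomb : Bool} (h : σ.heap a = some (.snode k' v tomb)) :
    HasMain W hash σ k l (some a) ↔ k' = k := by
  constructor
  · rintro ⟨_, e, ⟨v', tb, h'⟩ | ⟨⟨_, _, h'⟩, -⟩⟩ <;> cases e
    · rw [h] at h'; cases h'; rfl
    · rw [h] at h'; cases h'
  · rintro rfl; exact ⟨a, rfl, .inl ⟨v, tomb, h⟩⟩

theorem hasMain_cnode {bmp : ℕ} {arr : List Addr} (h : σ.heap a = some (.cnode bmp arr)) :
    HasMain W hash σ k l (some a) ↔ ∃ b, branch bmp arr (chunk W l (hash k)) = some b ∧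
      HasBelow W hash σ k (l + W) b := by
  rw [← hasKey_cnode h]
  simp [HasMain, h]

end

/-- The abstract set of a state. -/
def absSet (W : ℕ) (hash : K → ℕ) (σ : Mem K V) : Set K :=
  {k | ∃ a, σ.root = some a ∧ HasKey W hash σ k 0 a}

/-! ### Well-formed memories -/

/-- A node that may be a branch with prefix `q` of a cnode. -/
def BranchOk (W : ℕ) (hash : K → ℕ) (σ : Mem K V) (pre : Addr → List ℕ) (q : List ℕ) (b : Addr) :
    Prop :=
  (∃ m, σ.heap b = some (.inode m) ∧ pre b = q) ∨
    ∃ k v, σ.heap b = some (.snode k v false) ∧ IsHashPrefix W (hash k) q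

/-- The local conditions on a node with prefix `q`, where `pre` gives the prefixes of the inodes and
the cnodes in the heap. -/
def NodeOk (W : ℕ) (hash : K → ℕ) (σ : Mem K V) (pre : Addr → List ℕ) (q : List ℕ) :
    Node K V → Prop
  | .inode m => ∀ b, m = some b →
      (∃ bmp arr, σ.heap b = some (.cnode bmp arr) ∧ pre b = q) ∨
      ∃ k v, σ.heap b = some (.snode k v true) ∧ IsHashPrefix W (hash k) q
  | .cnode bmp arr => (∀ r, Flagged bmp r → r < 2 ^ W) ∧ bitcount bmp = arr.length ∧
      ∀ r b, branch bmp arr r = some b → BranchOk W hash σ pre (q ++ [r]) b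
  | .snode _ _ _ => True

/-- A memory in which every node, reachable or not, has a fixed prefix, and satisfies the local
conditions. -/
structure WellFormed (W : ℕ) (hash : K → ℕ) (σ : Mem K V) (pre : Addr → List ℕ) : Prop where
  fresh : ∀ a, σ.next ≤ a → σ.heap a = none
  root : ∀ a, σ.root = some a → pre a = [] ∧ ∃ m, σ.heap a = some (.inode m)
  node : ∀ a n, σ.heap a = some n → NodeOk W hash σ pre (pre a) n

/-- Is the node an inode or a cnode? -/
def Node.IsInner : Node K V → Prop
  | .snode _ _ _ => False
  | _ => True

/-- The references in a node. -/
def Node.Child : Node K V → Addr → Prop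
  | .inode m, b => m = some b
  | .cnode bmp arr, b => ∃ r, branch bmp arr r = some b
  | .snode _ _ _, _ => False

theorem NodeAt.child {σ : Mem K V} {p : List ℕ} {a b : Addr} {n : Node K V} (h : NodeAt σ p a)
    (hn : σ.heap a = some n) (hb : n.Child b) : ∃ q, NodeAt σ q b := by
  cases n with
  | inode m => cases hb; exact ⟨p, .main _ _ _ h hn⟩
  | cnode bmp arr => obtain ⟨r, hr⟩ := hb; exact ⟨_, .branch _ _ _ _ _ _ h hn hr⟩
  | snode => exact hb.elim

section

variable {W : ℕ} {hash : K → ℕ} {σ : Mem K V} {pre : Addr → List ℕ}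

theorem NodeOk.main_cases {q : List ℕ} {b : Addr}
    (h : NodeOk W hash σ pre q (.inode (some b))) :
    (∃ bmp arr, σ.heap b = some (.cnode bmp arr) ∧ pre b = q) ∨
      ∃ k v, σ.heap b = some (.snode k v true) ∧ IsHashPrefix W (hash k) q := h b rfl

/-- The prefix under which an inner node is reached is its fixed prefix. -/
theorem WellFormed.pre_eq (hw : WellFormed W hash σ pre) {p : List ℕ} {a : Addr} {n : Node K V}
    (h : NodeAt σ p a) (hn : σ.heap a = some n) (hi : n.IsInner) : pre a = p := by
  induction h generalizing n with
  | root a h => exact (hw.root a h).1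
  | main p a b hp h ih =>
    rcases (hw.node a _ h).main_cases with ⟨bmp, arr, hb, e⟩ | ⟨k, v, hb, -⟩
    · rw [e]; exact ih h trivial
    · rw [hb] at hn; cases hn; exact hi.elim
  | branch p a b bmp arr r hp h hb ih =>
    rcases (hw.node a _ h).2.2 r b hb with ⟨m, hm, e⟩ | ⟨k, v, hb, -⟩
    · rw [e, ih h trivial]
    · rw [hb] at hn; cases hn; exact hi.elim

/-- At a reachable inner node on the path of `k`, the key `k` is found iff it is found from the
root. -/
theorem WellFormed.hasKey_iff_mem (hw : WellFormed W hash σ pre) {p : List ℕ} {a : Addr} {k : K}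
    {n : Node K V} (h : NodeAt σ p a) (hn : σ.heap a = some n) (hi : n.IsInner)
    (hk : IsHashPrefix W (hash k) p) :
    HasKey W hash σ k (W * p.length) a ↔ k ∈ absSet W hash σ := by
  induction h generalizing n with
  | root a h => simp [absSet, h]
  | main p a b hp h ih =>
    rcases (hw.node a _ h).main_cases with ⟨bmp, arr, hb, e⟩ | ⟨k', v, hb, -⟩
    · rw [← ih h trivial hk, hasKey_inode h, hasMain_cnode hb, hasKey_cnode hb]
    · rw [hb] at hn; cases hn; exact hi.elim
  | branch p a b bmp arr r hp h hb ih =>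
    rw [isHashPrefix_append] at hk
    rcases (hw.node a _ h).2.2 r b hb with ⟨m, hm, e⟩ | ⟨k', v, hb, -⟩
    · rw [← ih h trivial hk.1, hasKey_cnode h, ← hk.2]
      simp only [hb, Option.some.injEq, exists_eq_left', hasBelow_inode hm, hasKey_inode hm]
      simp [Nat.mul_add]
    · rw [hb] at hn; cases hn; exact hi.elim

/-- If two memories differ in the inode `i` only, and a key is not lost below `i`, then it is not
lost below any other node. -/
theorem HasKey.frame (hw : WellFormed W hash σ pre) {σ' : Mem K V} {i : Addr} {m m' : Option Addr}
    (hi : σ.heap i = some (.inode m)) (hi' : σ'.heap i = some (.inode m'))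
    (hag : ∀ a, a ≠ i → σ'.heap a = σ.heap a) {k : K} {l : ℕ} {a : Addr}
    (H : HasKey W hash σ k (W * (pre i).length) i → HasKey W hash σ' k (W * (pre i).length) i)
    (h : HasKey W hash σ k l a) (hl : l = W * (pre a).length) : HasKey W hash σ' k l a := by
  have cn {c bmp arr} (h : σ.heap c = some (.cnode bmp arr)) :
      σ'.heap c = some (.cnode bmp arr) := by
    rw [hag, h]; rintro rfl; rw [hi] at h; cases h
  have sn {c k v tb} (h : σ.heap c = some (.snode k v tb)) :
      σ'.heap c = some (.snode k v tb) := by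
    rw [hag, h]; rintro rfl; rw [hi] at h; cases h
  induction h with
  | inodeHolds l a s v tomb h hs =>
    by_cases e : a = i
    · subst e; subst hl; exact H (.inodeHolds _ _ _ _ _ h hs)
    · exact .inodeHolds _ _ _ _ _ ((hag a e).trans h) (sn hs)
  | inodeMain l a c bmp arr h hc hk ih =>
    by_cases e : a = i
    · subst e; subst hl; exact H (.inodeMain _ _ _ _ _ h hc hk)
    · refine .inodeMain _ _ _ _ _ ((hag a e).trans h) (cn hc) (ih ?_)
      rcases (hw.node a _ h).main_cases with ⟨_, _, _, e⟩ | ⟨_, _, hb, -⟩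
      · rw [e, hl]
      · rw [hc] at hb; cases hb
  | cnodeHolds l a s bmp arr v tomb h hb hs => exact .cnodeHolds _ _ _ _ _ _ _ (cn h) hb (sn hs)
  | cnodeSub l a j bmp arr mj h hb hj hk ih =>
    have : ∃ mj', σ'.heap j = some (.inode mj') := by
      by_cases e : j = i
      · exact ⟨_, e ▸ hi'⟩
      · exact ⟨_, (hag j e).trans hj⟩
    obtain ⟨mj', hj'⟩ := this
    refine .cnodeSub _ _ _ _ _ _ (cn h) hb hj' (ih ?_)
    rcases (hw.node a _ h).2.2 _ _ hb with ⟨_, _, e⟩ | ⟨_, _, hb, -⟩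
    · rw [e, hl]; simp [Nat.mul_add]
    · rw [hj] at hb; cases hb

/-- If two memories differ in the inode `i` only, then a key found strictly below the prefix of `i`
is found in both. -/
theorem HasKey.frame_below (hw : WellFormed W hash σ pre) {σ' : Mem K V} {i : Addr}
    {m : Option Addr} (hi : σ.heap i = some (.inode m))
    (hag : ∀ a, a ≠ i → σ'.heap a = σ.heap a) {k : K} {l : ℕ} {a : Addr}
    (h : HasKey W hash σ k l a)
    (hl : (pre i).length < (pre a).length ∨ (pre i).length ≤ (pre a).length ∧
      ∃ bmp arr, σ.heap a = some (.cnode bmp arr)) : HasKey W hash σ' k l a := by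
  have cn {c bmp arr} (h : σ.heap c = some (.cnode bmp arr)) :
      σ'.heap c = some (.cnode bmp arr) := by
    rw [hag, h]; rintro rfl; rw [hi] at h; cases h
  have sn {c k v tb} (h : σ.heap c = some (.snode k v tb)) :
      σ'.heap c = some (.snode k v tb) := by
    rw [hag, h]; rintro rfl; rw [hi] at h; cases h
  have lt {a mm} (hl : (pre i).length < (pre a).length ∨ (pre i).length ≤ (pre a).length ∧
      ∃ bmp arr, σ.heap a = some (.cnode bmp arr)) (h : σ.heap a = some (.inode mm)) :
      (pre i).length < (pre a).length := by
    rcases hl with hl | ⟨_, _, _, hl⟩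
    · exact hl
    · rw [h] at hl; cases hl
  have ne {a mm} (hl : (pre i).length < (pre a).length ∨ (pre i).length ≤ (pre a).length ∧
      ∃ bmp arr, σ.heap a = some (.cnode bmp arr)) (h : σ.heap a = some (.inode mm)) : a ≠ i := by
    rintro rfl
    exact lt_irrefl _ (lt hl h)
  induction h with
  | inodeHolds l a s v tomb h hs =>
    exact .inodeHolds _ _ _ _ _ ((hag a (ne hl h)).trans h) (sn hs)
  | inodeMain l a c bmp arr h hc hk ih =>
    refine .inodeMain _ _ _ _ _ ((hag a (ne hl h)).trans h) (cn hc) (ih (.inl ?_))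
    rcases (hw.node a _ h).main_cases with ⟨_, _, _, e⟩ | ⟨_, _, hb, -⟩
    · rw [e]; exact lt hl h
    · rw [hc] at hb; cases hb
  | cnodeHolds l a s bmp arr v tomb h hb hs => exact .cnodeHolds _ _ _ _ _ _ _ (cn h) hb (sn hs)
  | cnodeSub l a j bmp arr mj h hb hj hk ih =>
    have hlt : (pre i).length < (pre j).length := by
      rcases (hw.node a _ h).2.2 _ _ hb with ⟨_, _, e⟩ | ⟨_, _, hb, -⟩
      · rw [e, List.length_append, List.length_singleton]
        rcases hl with hl | ⟨hl, -⟩ <;> omega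
      · rw [hj] at hb; cases hb
    exact .cnodeSub _ _ _ _ _ _ (cn h) hb ((hag j (ne (.inl hlt) hj)).trans hj) (ih (.inl hlt))

theorem HasMain.frame_below (hw : WellFormed W hash σ pre) {σ' : Mem K V} {i : Addr}
    {m m' : Option Addr} (hi : σ.heap i = some (.inode m))
    (hag : ∀ a, a ≠ i → σ'.heap a = σ.heap a) {k : K} {l : ℕ}
    (hm' : NodeOk W hash σ pre (pre i) (.inode m'))
    (h : HasMain W hash σ k l m') : HasMain W hash σ' k l m' := by
  obtain ⟨c, rfl, h⟩ := h
  refine ⟨c, rfl, ?_⟩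
  have ne {n} (hn : σ.heap c = some n) (h : ∀ m, n ≠ .inode m) : c ≠ i := by
    rintro rfl; rw [hi] at hn; cases hn; exact h _ rfl
  rcases h with ⟨v, tb, h⟩ | ⟨⟨bmp, arr, h⟩, hk⟩
  · exact .inl ⟨v, tb, by rw [hag c (ne h (by simp)), h]⟩
  · refine .inr ⟨⟨bmp, arr, by rw [hag c (ne h (by simp)), h]⟩, hk.frame_below hw hi hag (.inr ?_)⟩
    rcases hm'.main_cases with ⟨_, _, _, e⟩ | ⟨_, _, hb, -⟩
    · exact ⟨by rw [e], _, _, h⟩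
    · rw [h] at hb; cases hb

end

/-! ### Ghost state -/

/-- The shared memory with ghost state: the fixed prefix of each inode and cnode, the set of the
nodes that are, or once were, reachable from the root, and the thread that allocated each node. -/
structure World (K V T : Type) where
  mem : Mem K V
  pre : Addr → List ℕ
  pub : Set Addr
  own : Addr → Option T

/-- Thread `t` may know the node: it has been published, or `t` has allocated it. -/
def World.Knows (w : World K V T) (t : T) (a : Addr) : Prop := a ∈ w.pub ∨ w.own a = some t

/-- The global invariant. Nodes that have not been published are referenced by nodes of the same
thread only.  A published inode that holds a cnode is reachable, under its fixed prefix. -/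
structure Inv (W : ℕ) (hash : K → ℕ) (w : World K V T) : Prop where
  wf : WellFormed W hash w.mem w.pre
  pub_alloc : ∀ a ∈ w.pub, ∃ n, w.mem.heap a = some n
  root_pub : ∀ a, w.mem.root = some a → a ∈ w.pub
  child_pub : ∀ a n b, w.mem.heap a = some n → n.Child b → a ∈ w.pub → b ∈ w.pub
  child_own : ∀ a n b, w.mem.heap a = some n → n.Child b → b ∈ w.pub ∨ w.own b = w.own a
  live : ∀ a b bmp arr, a ∈ w.pub → w.mem.heap a = some (.inode (some b)) →
    w.mem.heap b = some (.cnode bmp arr) → NodeAt w.mem (w.pre a) a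

/-- What is preserved by all steps: cnodes and snodes are immutable, and so are null-inodes and
inodes that hold an snode. -/
structure Ext (w w' : World K V T) : Prop where
  cnode : ∀ {a bmp arr}, w.mem.heap a = some (.cnode bmp arr) →
    w'.mem.heap a = some (.cnode bmp arr)
  snode : ∀ {a k v tb}, w.mem.heap a = some (.snode k v tb) →
    w'.mem.heap a = some (.snode k v tb)
  inode : ∀ {a}, (∃ m, w.mem.heap a = some (.inode m)) → ∃ m, w'.mem.heap a = some (.inode m)
  null : ∀ {a}, w.mem.heap a = some (.inode none) → w'.mem.heap a = some (.inode none)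
  holds : ∀ {a s k v tb}, w.mem.heap a = some (.inode (some s)) →
    w.mem.heap s = some (.snode k v tb) → w'.mem.heap a = some (.inode (some s))
  pre : ∀ {a n}, w.mem.heap a = some n → w'.pre a = w.pre a
  own : ∀ {a n}, w.mem.heap a = some n → w'.own a = w.own a
  pub : w.pub ⊆ w'.pub

/-- What thread `t` may rely on while the other threads make steps: in addition, its unpublished
nodes remain as they are. -/
structure Rely (t : T) (w w' : World K V T) : Prop extends Ext w w' where
  priv : ∀ a n, a ∉ w.pub → w.own a = some t → w.mem.heap a = some n →
    a ∉ w'.pub ∧ w'.mem.heap a = some n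

theorem Ext.refl (w : World K V T) : Ext w w :=
  ⟨id, id, id, id, fun h _ => h, fun _ => rfl, fun _ => rfl, subset_rfl⟩

theorem Ext.isSome {w w' : World K V T} (h : Ext w w') {a : Addr} {n : Node K V}
    (hn : w.mem.heap a = some n) : ∃ n', w'.mem.heap a = some n' := by
  cases n with
  | inode m => obtain ⟨m', h'⟩ := h.inode ⟨m, hn⟩; exact ⟨_, h'⟩
  | cnode => exact ⟨_, h.cnode hn⟩
  | snode => exact ⟨_, h.snode hn⟩

theorem Ext.trans {w w' w'' : World K V T} (h : Ext w w') (h' : Ext w' w'') : Ext w w'' where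
  cnode e := h'.cnode (h.cnode e)
  snode e := h'.snode (h.snode e)
  inode e := h'.inode (h.inode e)
  null e := h'.null (h.null e)
  holds e e' := h'.holds (h.holds e e') (h.snode e')
  pre e := (h'.pre (h.isSome e).choose_spec).trans (h.pre e)
  own e := (h'.own (h.isSome e).choose_spec).trans (h.own e)
  pub := h.pub.trans h'.pub

theorem Rely.refl (t : T) (w : World K V T) : Rely t w w :=
  ⟨Ext.refl w, fun _ _ h _ h' => ⟨h, h'⟩⟩

theorem Rely.trans {t : T} {w w' w'' : World K V T} (h : Rely t w w') (h' : Rely t w' w'') :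
    Rely t w w'' where
  toExt := h.toExt.trans h'.toExt
  priv a n hp ho hn :=
    h'.priv a n (h.priv a n hp ho hn).1 ((h.own hn).trans ho) (h.priv a n hp ho hn).2

theorem Ext.knows {w w' : World K V T} (h : Ext w w') {t : T} {a : Addr} {n : Node K V}
    (hn : w.mem.heap a = some n) (hk : w.Knows t a) : w'.Knows t a :=
  hk.imp (fun hp => h.pub hp) fun ho => (h.own hn).trans ho

theorem BranchOk.ext {W : ℕ} {hash : K → ℕ} {w w' : World K V T} (h : Ext w w') {q : List ℕ}
    {b : Addr} (hb : BranchOk W hash w.mem w.pre q b) : BranchOk W hash w'.mem w'.pre q b := by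
  rcases hb with ⟨m, hm, e⟩ | ⟨k, v, hk, e⟩
  · obtain ⟨m', hm'⟩ := h.inode ⟨m, hm⟩
    exact .inl ⟨m', hm', (h.pre hm).trans e⟩
  · exact .inr ⟨k, v, h.snode hk, e⟩

theorem NodeOk.ext {W : ℕ} {hash : K → ℕ} {w w' : World K V T} (h : Ext w w') {q : List ℕ}
    {n : Node K V} (hn : NodeOk W hash w.mem w.pre q n) : NodeOk W hash w'.mem w'.pre q n := by
  cases n with
  | inode m =>
    intro b hb
    rcases hn b hb with ⟨bmp, arr, hc, e⟩ | ⟨k, v, hk, e⟩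
    · exact .inl ⟨bmp, arr, h.cnode hc, (h.pre hc).trans e⟩
    · exact .inr ⟨k, v, h.snode hk, e⟩
  | cnode bmp arr => exact ⟨hn.1, hn.2.1, fun r b hb => (hn.2.2 r b hb).ext h⟩
  | snode => trivial

section

variable {W : ℕ} {hash : K → ℕ} {w : World K V T}

/-- References are not dangling. -/
theorem NodeOk.child_alloc {q : List ℕ} {n : Node K V}
    (hn : NodeOk W hash w.mem w.pre q n) {b : Addr} (hb : n.Child b) :
    ∃ n', w.mem.heap b = some n' := by
  cases n with
  | inode m => rcases hn b hb with ⟨_, _, h, _⟩ | ⟨_, _, h, _⟩ <;> exact ⟨_, h⟩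
  | cnode bmp arr =>
    obtain ⟨r, hr⟩ := hb
    rcases hn.2.2 r b hr with ⟨_, h, _⟩ | ⟨_, _, h, _⟩ <;> exact ⟨_, h⟩
  | snode => exact hb.elim

theorem Inv.child_alloc (hw : Inv W hash w) {a b : Addr} {n : Node K V}
    (hn : w.mem.heap a = some n) (hb : n.Child b) : ∃ n', w.mem.heap b = some n' :=
  (hw.wf.node a n hn).child_alloc hb

theorem Inv.knows_child (hw : Inv W hash w) {t : T} {a b : Addr} {n : Node K V}
    (hn : w.mem.heap a = some n) (hb : n.Child b) (ha : w.Knows t a) : w.Knows t b := by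
  rcases ha with ha | ha
  · exact .inl (hw.child_pub a n b hn hb ha)
  · exact (hw.child_own a n b hn hb).imp_right fun e => e.trans ha

/-- The local conditions refer to fixed prefixes, which are the actual ones for reachable nodes. -/
theorem valid_of_inv (hw : Inv W hash w) : Valid W hash w.mem where
  inv1 := by
    refine ⟨fun a h => (hw.wf.root a h).2, fun p a b _ h => ?_⟩
    rcases (hw.wf.node a _ h).main_cases with ⟨_, _, h, _⟩ | ⟨_, _, h, _⟩
    · exact .inl ⟨_, _, h⟩
    · exact .inr ⟨_, _, h⟩
  inv2 p a bmp arr _ h := (hw.wf.node a _ h).2.1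
  inv3 p a bmp arr r _ h := by
    obtain ⟨h1, h2, h3⟩ := hw.wf.node a _ h
    constructor
    · intro hf
      obtain ⟨b, hb⟩ := exists_branch h2 hf
      refine ⟨h1 r hf, b, hb, ?_⟩
      rcases h3 r b hb with ⟨m, h, _⟩ | ⟨k, v, h, _⟩
      · exact .inl ⟨m, h⟩
      · exact .inr ⟨k, v, h⟩
    · rintro ⟨-, b, hb, -⟩
      exact flagged_of_branch hb
  inv4 p a bmp arr r b k v tb hp h hb hs := by
    rcases (hw.wf.node a _ h).2.2 r b hb with ⟨m, h', _⟩ | ⟨k', v', h', hk⟩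
    · rw [hs] at h'; cases h'
    · rw [hs] at h'; cases h'
      rwa [← hw.wf.pre_eq hp h trivial]
  inv5 p a b k v tb hp h hs := by
    rcases (hw.wf.node a _ h).main_cases with ⟨_, _, h', _⟩ | ⟨_, _, h', hk⟩
    · rw [hs] at h'; cases h'
    · rw [hs] at h'; cases h'
      rwa [← hw.wf.pre_eq hp h trivial]

/-- A published inode that holds a cnode decides the membership of the keys on its path. -/
theorem Inv.hasMain_iff_mem (hw : Inv W hash w) {i c bmp : ℕ} {arr : List Addr} {k : K}
    (hi : i ∈ w.pub) (hm : w.mem.heap i = some (.inode (some c)))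
    (hc : w.mem.heap c = some (.cnode bmp arr)) (hk : IsHashPrefix W (hash k) (w.pre i)) :
    HasMain W hash w.mem k (W * (w.pre i).length) (some c) ↔ k ∈ absSet W hash w.mem := by
  rw [← hasKey_inode hm]
  exact hw.wf.hasKey_iff_mem (hw.live i c bmp arr hi hm hc) hm trivial hk

/-! ### Allocation -/

/-- Thread `t` allocates the node `n`, which is to have the prefix `q`. -/
def World.alloc (w : World K V T) (t : T) (q : List ℕ) (n : Node K V) :
    World K V T where
  mem := { w.mem with
    heap := Function.update w.mem.heap w.mem.next (some n), next := w.mem.next + 1 }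
  pre := Function.update w.pre w.mem.next q
  pub := w.pub
  own := Function.update w.own w.mem.next (some t)

end

section

variable {W : ℕ} {hash : K → ℕ} {w : World K V T} {t : T} {q : List ℕ}
  {n : Node K V}

theorem World.alloc_heap (w : World K V T) (t : T) (q : List ℕ) (n : Node K V) {a : Addr}
    (h : a ≠ w.mem.next) : (w.alloc t q n).mem.heap a = w.mem.heap a :=
  Function.update_of_ne h _ _

theorem World.alloc_heap_self (w : World K V T) (t : T) (q : List ℕ) (n : Node K V) :
    (w.alloc t q n).mem.heap w.mem.next = some n :=
  Function.update_self _ _ _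

theorem Inv.ne_next (hw : Inv W hash w) {a : Addr} {n' : Node K V}
    (h : w.mem.heap a = some n') : a ≠ w.mem.next := by
  rintro rfl
  rw [hw.wf.fresh _ le_rfl] at h
  cases h

theorem Inv.alloc_heap_of (hw : Inv W hash w) {a : Addr} {n' : Node K V}
    (h : w.mem.heap a = some n') : (w.alloc t q n).mem.heap a = some n' := by
  rw [World.alloc_heap _ _ _ _ (hw.ne_next h), h]

/-- Allocation is harmless to all threads, the allocating one included. -/
theorem Inv.rely_alloc (hw : Inv W hash w) (s : T) : Rely s w (w.alloc t q n) where
  cnode h := hw.alloc_heap_of h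
  snode h := hw.alloc_heap_of h
  inode h := ⟨_, hw.alloc_heap_of h.choose_spec⟩
  null h := hw.alloc_heap_of h
  holds h _ := hw.alloc_heap_of h
  pre h := Function.update_of_ne (hw.ne_next h) _ _
  own h := Function.update_of_ne (hw.ne_next h) _ _
  pub := subset_rfl
  priv _ _ hp _ hn := ⟨hp, hw.alloc_heap_of hn⟩

theorem Inv.nodeAt_alloc (hw : Inv W hash w) {p : List ℕ} {a : Addr} (h : NodeAt w.mem p a) :
    NodeAt (w.alloc t q n).mem p a := by
  induction h with
  | root a h => exact .root _ h
  | main p a b hp h ih => exact .main _ _ _ ih (hw.alloc_heap_of h)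
  | branch p a b bmp arr r hp h hb ih => exact .branch _ _ _ _ _ _ ih (hw.alloc_heap_of h) hb

theorem Inv.alloc (hw : Inv W hash w) (hn : NodeOk W hash w.mem w.pre q n)
    (hk : ∀ b, n.Child b → w.Knows t b) : Inv W hash (w.alloc t q n) := by
  have hx : Ext w (w.alloc t q n) := (hw.rely_alloc t).toExt
  have hnew {a : Addr} {n' : Node K V} (h : (w.alloc t q n).mem.heap a = some n') :
      (a = w.mem.next ∧ n' = n) ∨ a ≠ w.mem.next ∧ w.mem.heap a = some n' := by
    by_cases e : a = w.mem.next
    · subst e; rw [World.alloc_heap_self] at h; cases h; exact .inl ⟨rfl, rfl⟩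
    · rw [World.alloc_heap _ _ _ _ e] at h; exact .inr ⟨e, h⟩
  have hnp : w.mem.next ∉ w.pub := fun h => by
    obtain ⟨n', h'⟩ := hw.pub_alloc _ h
    exact hw.ne_next h' rfl
  refine ⟨⟨?_, ?_, ?_⟩, ?_, hw.root_pub, ?_, ?_, ?_⟩
  · intro a ha
    have ha : w.mem.next + 1 ≤ a := ha
    rw [World.alloc_heap _ _ _ _ (Nat.ne_of_gt ha), hw.wf.fresh a (Nat.le_of_succ_le ha)]
  · intro a ha
    obtain ⟨h1, m, h2⟩ := hw.wf.root a ha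
    exact ⟨(hx.pre h2).trans h1, m, hw.alloc_heap_of h2⟩
  · intro a n' h
    rcases hnew h with ⟨rfl, rfl⟩ | ⟨e, h⟩
    · have : (w.alloc t q n').pre w.mem.next = q := Function.update_self _ _ _
      rw [this]; exact hn.ext hx
    · rw [hx.pre h]; exact (hw.wf.node a n' h).ext hx
  · intro a ha
    obtain ⟨n', h⟩ := hw.pub_alloc a ha
    exact hx.isSome h
  · intro a n' b h hb ha
    rcases hnew h with ⟨rfl, rfl⟩ | ⟨e, h⟩
    · exact absurd ha hnp
    · exact hw.child_pub a n' b h hb ha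
  · intro a n' b h hb
    rcases hnew h with ⟨rfl, rfl⟩ | ⟨e, h⟩
    · obtain ⟨nb, hnb⟩ := hn.child_alloc hb
      have : (w.alloc t q n').own w.mem.next = some t := Function.update_self _ _ _
      rw [this, hx.own hnb]
      exact hk b hb
    · obtain ⟨nb, hnb⟩ := hw.child_alloc h hb
      rw [hx.own h, hx.own hnb]
      exact hw.child_own a n' b h hb
  · intro a b bmp arr ha h hb
    rcases hnew h with ⟨rfl, -⟩ | ⟨e, h⟩
    · exact absurd ha hnp
    · obtain ⟨nb, hnb⟩ := hw.child_alloc h rfl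
      rw [hw.alloc_heap_of hnb] at hb
      cases hb
      rw [hx.pre h]
      exact hw.nodeAt_alloc (hw.live a b bmp arr ha h hnb)

theorem Inv.hasKey_alloc (hw : Inv W hash w) {k : K} {l : ℕ} {a : Addr} {n' : Node K V}
    (ha : w.mem.heap a = some n') :
    HasKey W hash (w.alloc t q n).mem k l a ↔ HasKey W hash w.mem k l a := by
  constructor
  · intro h
    induction h generalizing n' with
    | inodeHolds l a s v tb h hs =>
      rw [hw.alloc_heap_of ha] at h; cases h
      obtain ⟨nb, hnb⟩ := hw.child_alloc ha rfl
      rw [hw.alloc_heap_of hnb] at hs; cases hs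
      exact .inodeHolds _ _ _ _ _ ha hnb
    | inodeMain l a c bmp arr h hc hk ih =>
      rw [hw.alloc_heap_of ha] at h; cases h
      obtain ⟨nb, hnb⟩ := hw.child_alloc ha rfl
      rw [hw.alloc_heap_of hnb] at hc; cases hc
      exact .inodeMain _ _ _ _ _ ha hnb (ih hnb)
    | cnodeHolds l a s bmp arr v tb h hb hs =>
      rw [hw.alloc_heap_of ha] at h; cases h
      obtain ⟨nb, hnb⟩ := hw.child_alloc ha ⟨_, hb⟩
      rw [hw.alloc_heap_of hnb] at hs; cases hs
      exact .cnodeHolds _ _ _ _ _ _ _ ha hb hnb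
    | cnodeSub l a i bmp arr m h hb hi hk ih =>
      rw [hw.alloc_heap_of ha] at h; cases h
      obtain ⟨nb, hnb⟩ := hw.child_alloc ha ⟨_, hb⟩
      rw [hw.alloc_heap_of hnb] at hi; cases hi
      exact .cnodeSub _ _ _ _ _ _ ha hb hnb (ih hnb)
  · intro h
    clear ha
    induction h with
    | inodeHolds l a s v tb h hs =>
      exact .inodeHolds _ _ _ _ _ (hw.alloc_heap_of h) (hw.alloc_heap_of hs)
    | inodeMain l a c bmp arr h hc hk ih =>
      exact .inodeMain _ _ _ _ _ (hw.alloc_heap_of h) (hw.alloc_heap_of hc) ih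
    | cnodeHolds l a s bmp arr v tb h hb hs =>
      exact .cnodeHolds _ _ _ _ _ _ _ (hw.alloc_heap_of h) hb (hw.alloc_heap_of hs)
    | cnodeSub l a i bmp arr m h hb hi hk ih =>
      exact .cnodeSub _ _ _ _ _ _ (hw.alloc_heap_of h) hb (hw.alloc_heap_of hi) ih

theorem Inv.absSet_alloc (hw : Inv W hash w) :
    absSet W hash (w.alloc t q n).mem = absSet W hash w.mem := by
  ext k
  refine exists_congr fun a => and_congr_right fun (h : w.mem.root = some a) => ?_
  obtain ⟨n', h'⟩ := hw.pub_alloc a (hw.root_pub a h)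
  exact hw.hasKey_alloc h'

end

/-! ### Publication -/

section

variable {W : ℕ} {hash : K → ℕ} {w : World K V T} {t : T}

/-- The world after the memory has changed to `σ` by a successful CAS: all that is now reachable has
been published. -/
def World.publish (w : World K V T) (σ : Mem K V) : World K V T where
  mem := σ
  pre := w.pre
  pub := w.pub ∪ {a | ∃ p, NodeAt σ p a}
  own := w.own

/-- A CAS at an inode. -/
def Mem.setMain (σ : Mem K V) (i : Addr) (m : Option Addr) : Mem K V :=
  { σ with heap := Function.update σ.heap i (some (.inode m)) }

theorem Mem.setMain_heap (σ : Mem K V) {i a : Addr} (m : Option Addr) (h : a ≠ i) :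
    (σ.setMain i m).heap a = σ.heap a := Function.update_of_ne h _ _

theorem Mem.setMain_heap_self (σ : Mem K V) (i : Addr) (m : Option Addr) :
    (σ.setMain i m).heap i = some (.inode m) := Function.update_self _ _ _

/-- The new `main` is a cnode that keeps those branches of the old cnode that are inodes which hold
a cnode themselves. If there is no such branch, the new `main` is arbitrary. -/
def KeepsLive (w : World K V T) (bmp : ℕ) (arr : List Addr) (m' : Option Addr) : Prop :=
  ∀ r j d bmp' arr', branch bmp arr r = some j → w.mem.heap j = some (.inode (some d)) →
    w.mem.heap d = some (.cnode bmp' arr') →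
    ∃ b bmp₂ arr₂, m' = some b ∧ w.mem.heap b = some (.cnode bmp₂ arr₂) ∧
      branch bmp₂ arr₂ r = some j

/-- The conditions under which thread `t` may replace the `main` of the published inode `i`, which
is the cnode `c`, by `m'`. -/
structure CanSet (W : ℕ) (hash : K → ℕ) (w : World K V T) (t : T) (i c bmp : ℕ) (arr : List Addr)
    (m' : Option Addr) : Prop where
  pub : i ∈ w.pub
  main : w.mem.heap i = some (.inode (some c))
  cnode : w.mem.heap c = some (.cnode bmp arr)
  ok : NodeOk W hash w.mem w.pre (w.pre i) (.inode m')
  knows : ∀ b, m' = some b → w.Knows t b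
  keeps : KeepsLive w bmp arr m'

section

variable {i c bmp : ℕ} {arr : List Addr} {m' : Option Addr}

theorem CanSet.ext (h : CanSet W hash w t i c bmp arr m') :
    Ext w (w.publish (w.mem.setMain i m')) := by
  have hi := h.main
  have hag := fun a => w.mem.setMain_heap (i := i) (a := a) m'
  refine ⟨?_, ?_, ?_, ?_, ?_, fun _ => rfl, fun _ => rfl, Set.subset_union_left⟩
  · intro a bmp arr ha
    refine (hag a ?_).trans ha
    rintro rfl; rw [hi] at ha; cases ha
  · intro a k v tb ha
    refine (hag a ?_).trans ha
    rintro rfl; rw [hi] at ha; cases ha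
  · rintro a ⟨m, ha⟩
    by_cases e : a = i
    · subst e; exact ⟨_, w.mem.setMain_heap_self _ _⟩
    · exact ⟨m, (hag a e).trans ha⟩
  · intro a ha
    refine (hag a ?_).trans ha
    rintro rfl; rw [hi] at ha; cases ha
  · intro a s k v tb ha hs
    refine (hag a ?_).trans ha
    rintro rfl; rw [hi] at ha; cases ha
    rw [h.cnode] at hs; cases hs

theorem CanSet.wellFormed (h : CanSet W hash w t i c bmp arr m') (hw : Inv W hash w) :
    WellFormed W hash (w.mem.setMain i m') w.pre where
  fresh a ha := by
    rw [w.mem.setMain_heap]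
    · exact hw.wf.fresh a ha
    · rintro rfl
      have := hw.wf.fresh a ha
      rw [h.main] at this
      cases this
  root a ha := ⟨(hw.wf.root a ha).1, h.ext.inode (hw.wf.root a ha).2⟩
  node a n ha := by
    have hx := h.ext
    by_cases e : a = i
    · subst e; rw [w.mem.setMain_heap_self] at ha; cases ha; exact h.ok.ext hx
    · rw [w.mem.setMain_heap _ e] at ha; exact (hw.wf.node a n ha).ext hx

/-- Inodes that hold a cnode remain reachable, under the same prefix.  A reachable cnode may be the
one that is replaced; for cnodes the induction shows that an inode which held them is reachable. -/
theorem CanSet.nodeAt (h : CanSet W hash w t i c bmp arr m') (hw : Inv W hash w) {p : List ℕ}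
    {a : Addr} (ha : NodeAt w.mem p a) :
    (∀ d bmp' arr', w.mem.heap a = some (.inode (some d)) →
      w.mem.heap d = some (.cnode bmp' arr') → NodeAt (w.mem.setMain i m') p a) ∧
    (∀ bmp' arr', w.mem.heap a = some (.cnode bmp' arr') →
      ∃ a₀, w.mem.heap a₀ = some (.inode (some a)) ∧ NodeAt (w.mem.setMain i m') p a₀) := by
  induction ha with
  | root a ha =>
    refine ⟨fun _ _ _ _ _ => .root _ ha, fun bmp' arr' e => ?_⟩
    obtain ⟨-, m, hm⟩ := hw.wf.root a ha
    rw [hm] at e; cases e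
  | main p a b hp ha ih =>
    constructor
    · intro d bmp' arr' hb _
      rcases (hw.wf.node a _ ha).main_cases with ⟨_, _, e, _⟩ | ⟨_, _, e, _⟩ <;>
        (rw [e] at hb; cases hb)
    · intro bmp' arr' hb
      exact ⟨a, ha, ih.1 b bmp' arr' ha hb⟩
  | branch p a b bmp₁ arr₁ r hp ha hb ih =>
    constructor
    · intro d bmp' arr' hbd hd
      obtain ⟨a₀, ha₀, hp₀⟩ := ih.2 _ _ ha
      by_cases e : a₀ = i
      · subst e
        rw [h.main] at ha₀; cases ha₀
        rw [h.cnode] at ha; cases ha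
        obtain ⟨b', bmp₂, arr₂, rfl, hb', hbr⟩ := h.keeps r b d bmp' arr' hb hbd hd
        exact .branch _ _ _ _ _ _ (.main _ _ _ hp₀ (w.mem.setMain_heap_self _ _))
          (h.ext.cnode hb') hbr
      · exact .branch _ _ _ _ _ _ (.main _ _ _ hp₀ ((w.mem.setMain_heap _ e).trans ha₀))
          (h.ext.cnode ha) hb
    · intro bmp' arr' hb'
      rcases (hw.wf.node a _ ha).2.2 r b hb with ⟨_, e, _⟩ | ⟨_, _, e, _⟩ <;>
        (rw [e] at hb'; cases hb')

theorem CanSet.nodeAt_self (h : CanSet W hash w t i c bmp arr m') (hw : Inv W hash w) :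
    NodeAt (w.mem.setMain i m') (w.pre i) i :=
  (h.nodeAt hw (hw.live i c bmp arr h.pub h.main h.cnode)).1 c bmp arr h.main h.cnode

/-- A thread publishes only its own nodes. -/
theorem CanSet.knows_of_nodeAt (h : CanSet W hash w t i c bmp arr m') (hw : Inv W hash w)
    {p : List ℕ} {a : Addr} (ha : NodeAt (w.mem.setMain i m') p a) : w.Knows t a := by
  induction ha with
  | root a ha => exact .inl (hw.root_pub a ha)
  | main p a b hp ha ih =>
    by_cases e : a = i
    · subst e; rw [w.mem.setMain_heap_self] at ha; cases ha; exact h.knows b rfl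
    · rw [w.mem.setMain_heap _ e] at ha; exact hw.knows_child ha rfl ih
  | branch p a b bmp' arr' r hp ha hb ih =>
    rw [w.mem.setMain_heap] at ha
    · exact hw.knows_child ha ⟨r, hb⟩ ih
    · rintro rfl; rw [w.mem.setMain_heap_self] at ha; cases ha

theorem CanSet.rely (h : CanSet W hash w t i c bmp arr m') (hw : Inv W hash w) {s : T}
    (hs : s ≠ t) : Rely s w (w.publish (w.mem.setMain i m')) where
  toExt := h.ext
  priv a n hp ho hn := by
    have : a ≠ i := by rintro rfl; exact hp h.pub
    refine ⟨?_, (w.mem.setMain_heap _ this).trans hn⟩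
    rintro (h' | ⟨p, h'⟩)
    · exact hp h'
    · rcases h.knows_of_nodeAt hw h' with h' | h'
      · exact hp h'
      · rw [ho] at h'; cases h'; exact hs rfl

theorem CanSet.inv (h : CanSet W hash w t i c bmp arr m') (hw : Inv W hash w) :
    Inv W hash (w.publish (w.mem.setMain i m')) where
  wf := h.wellFormed hw
  pub_alloc := by
    rintro a (ha | ⟨p, ha⟩)
    · obtain ⟨n, hn⟩ := hw.pub_alloc a ha; exact h.ext.isSome hn
    · induction ha with
      | root a ha => exact ⟨_, ((h.wellFormed hw).root a ha).2.choose_spec⟩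
      | main p a b hp ha ih =>
        rcases ((h.wellFormed hw).node a _ ha).main_cases with ⟨_, _, e, _⟩ | ⟨_, _, e, _⟩ <;>
          exact ⟨_, e⟩
      | branch p a b bmp' arr' r hp ha hb ih =>
        rcases ((h.wellFormed hw).node a _ ha).2.2 r b hb with ⟨_, e, _⟩ | ⟨_, _, e, _⟩ <;>
          exact ⟨_, e⟩
  root_pub a ha := .inl (hw.root_pub a ha)
  child_pub a n b hn hb ha := by
    rcases ha with ha | ⟨p, ha⟩
    · by_cases e : a = i
      · subst e; exact .inr ((h.nodeAt_self hw).child hn hb)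
      · exact .inl (hw.child_pub a n b ((w.mem.setMain_heap _ e).symm.trans hn) hb ha)
    · exact .inr (ha.child hn hb)
  child_own a n b hn hb := by
    by_cases e : a = i
    · subst e; exact .inl (.inr ((h.nodeAt_self hw).child hn hb))
    · exact (hw.child_own a n b ((w.mem.setMain_heap _ e).symm.trans hn) hb).imp_left .inl
  live a b bmp' arr' ha hn hb := by
    rcases ha with ha | ⟨p, ha⟩
    · by_cases e : a = i
      · subst e; exact h.nodeAt_self hw
      · have hn' : w.mem.heap a = some (.inode (some b)) :=
          (w.mem.setMain_heap _ e).symm.trans hn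
        have hb' : w.mem.heap b = some (.cnode bmp' arr') := by
          refine (w.mem.setMain_heap m' ?_).symm.trans hb
          rintro rfl
          have hb : (w.mem.setMain b m').heap b = some (.cnode bmp' arr') := hb
          rw [w.mem.setMain_heap_self] at hb; cases hb
        exact (h.nodeAt hw (hw.live a b _ _ ha hn' hb')).1 _ _ _ hn' hb'
    · have : w.pre a = p := (h.wellFormed hw).pre_eq ha hn trivial
      show NodeAt (w.mem.setMain i m') (w.pre a) a
      rwa [this]

/-- After the CAS the keys below the inode are those of its new `main`. -/
theorem CanSet.hasKey_self (h : CanSet W hash w t i c bmp arr m') (hw : Inv W hash w) {k : K}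
    {l : ℕ} : HasKey W hash (w.mem.setMain i m') k l i ↔ HasMain W hash w.mem k l m' := by
  rw [hasKey_inode (w.mem.setMain_heap_self _ _)]
  have hag := fun a => w.mem.setMain_heap (i := i) (a := a) m'
  exact ⟨fun hk => hk.frame_below (h.wellFormed hw) (w.mem.setMain_heap_self _ _)
      (fun a ha => (hag a ha).symm) (h.ok.ext h.ext),
    fun hk => hk.frame_below hw.wf h.main hag h.ok⟩

/-- A key whose status below the inode is not changed by the CAS stays in or out of the abstract
set. -/
theorem CanSet.mem_absSet_iff (h : CanSet W hash w t i c bmp arr m') (hw : Inv W hash w) {k : K}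
    (hk : HasMain W hash w.mem k (W * (w.pre i).length) (some c) ↔
      HasMain W hash w.mem k (W * (w.pre i).length) m') :
    k ∈ absSet W hash (w.mem.setMain i m') ↔ k ∈ absSet W hash w.mem := by
  have hag := fun a => w.mem.setMain_heap (i := i) (a := a) m'
  rw [← hasKey_inode h.main, ← h.hasKey_self hw] at hk
  refine exists_congr fun a => and_congr_right fun (ha : w.mem.root = some a) => ?_
  have hl : 0 = W * (w.pre a).length := by rw [(hw.wf.root a ha).1]; rfl
  exact ⟨fun hr => hr.frame (h.wellFormed hw) (w.mem.setMain_heap_self _ _) h.main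
      (fun a ha => (hag a ha).symm) hk.2 hl,
    fun hr => hr.frame hw.wf h.main (w.mem.setMain_heap_self _ _) hag hk.1 hl⟩

theorem CanSet.absSet_eq (h : CanSet W hash w t i c bmp arr m') (hw : Inv W hash w)
    (hk : ∀ k, HasMain W hash w.mem k (W * (w.pre i).length) (some c) ↔
      HasMain W hash w.mem k (W * (w.pre i).length) m') :
    absSet W hash (w.mem.setMain i m') = absSet W hash w.mem := by
  ext k; exact h.mem_absSet_iff hw (hk k)

/-- For a key on the path of the inode, the new `main` decides about its membership. -/
theorem CanSet.mem_absSet_of_prefix (h : CanSet W hash w t i c bmp arr m') (hw : Inv W hash w)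
    {k : K} (hk : IsHashPrefix W (hash k) (w.pre i)) :
    k ∈ absSet W hash (w.mem.setMain i m') ↔
      HasMain W hash w.mem k (W * (w.pre i).length) m' := by
  rw [← h.hasKey_self hw, (h.wellFormed hw).hasKey_iff_mem (h.nodeAt_self hw)
    (w.mem.setMain_heap_self _ _) trivial hk]

end

/-- The conditions under which thread `t` may replace the root, which is null or a null-inode, by
`b`. -/
structure CanSetRoot (w : World K V T) (t : T) (b : Option Addr) : Prop where
  dead : ∀ a, w.mem.root = some a → w.mem.heap a = some (.inode none)
  knows : ∀ a, b = some a → w.Knows t a ∧ w.pre a = [] ∧ ∃ m, w.mem.heap a = some (.inode m)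

/-- A CAS at the root. -/
def Mem.setRoot (σ : Mem K V) (b : Option Addr) : Mem K V := { σ with root := b }

section

variable {b : Option Addr}

/-- A null root or a null-inode at the root holds no keys. -/
theorem absSet_of_dead {σ : Mem K V}
    (h : ∀ a, σ.root = some a → σ.heap a = some (.inode none)) : absSet W hash σ = ∅ := by
  ext k
  simp only [absSet, Set.mem_ofPred_eq, Set.mem_empty_iff_false, iff_false, not_exists, not_and]
  intro a ha
  rw [hasKey_inode (h a ha)]
  exact hasMain_none

theorem CanSetRoot.ext : Ext w (w.publish (w.mem.setRoot b)) :=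
  ⟨id, id, id, id, fun h _ => h, fun _ => rfl, fun _ => rfl, Set.subset_union_left⟩

theorem CanSetRoot.wellFormed (h : CanSetRoot w t b) (hw : Inv W hash w) :
    WellFormed W hash (w.mem.setRoot b) w.pre where
  fresh := hw.wf.fresh
  root a ha := (h.knows a ha).2
  node a n hn := (hw.wf.node a n hn).ext (CanSetRoot.ext (b := b))

/-- Nothing is reachable below a root that is null or a null-inode. -/
theorem CanSetRoot.not_live (h : CanSetRoot w t b) {p : List ℕ} {a : Addr}
    (ha : NodeAt w.mem p a) : w.mem.root = some a := by
  induction ha with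
  | root a ha => exact ha
  | main p a b hp ha ih => rw [h.dead a ih] at ha; cases ha
  | branch p a b bmp' arr' r hp ha hb ih => rw [h.dead a ih] at ha; cases ha

/-- A thread publishes only its own nodes. -/
theorem CanSetRoot.knows_of_nodeAt (h : CanSetRoot w t b) (hw : Inv W hash w)
    {p : List ℕ} {a : Addr} (ha : NodeAt (w.mem.setRoot b) p a) : w.Knows t a := by
  induction ha with
  | root a ha => exact (h.knows a ha).1
  | main p a b hp ha ih => exact hw.knows_child ha rfl ih
  | branch p a b bmp' arr' r hp ha hb ih => exact hw.knows_child ha ⟨r, hb⟩ ih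

theorem CanSetRoot.rely (h : CanSetRoot w t b) (hw : Inv W hash w) {s : T}
    (hs : s ≠ t) : Rely s w (w.publish (w.mem.setRoot b)) where
  toExt := CanSetRoot.ext
  priv a n hp ho hn := by
    refine ⟨?_, hn⟩
    rintro (h' | ⟨p, h'⟩)
    · exact hp h'
    · rcases h.knows_of_nodeAt hw h' with h' | h'
      · exact hp h'
      · rw [ho] at h'; cases h'; exact hs rfl

theorem CanSetRoot.inv (h : CanSetRoot w t b) (hw : Inv W hash w) :
    Inv W hash (w.publish (w.mem.setRoot b)) where
  wf := h.wellFormed hw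
  pub_alloc := by
    rintro a (ha | ⟨p, ha⟩)
    · exact hw.pub_alloc a ha
    · induction ha with
      | root a ha => exact ⟨_, (h.knows a ha).2.2.choose_spec⟩
      | main p a b hp ha ih => exact hw.child_alloc (a := a) ha rfl
      | branch p a b bmp' arr' r hp ha hb ih => exact hw.child_alloc (a := a) ha ⟨r, hb⟩
  root_pub a ha := .inr ⟨[], .root a ha⟩
  child_pub a n b hn hb ha := by
    rcases ha with ha | ⟨p, ha⟩
    · exact .inl (hw.child_pub a n b hn hb ha)
    · exact .inr (ha.child hn hb)
  child_own a n b hn hb := (hw.child_own a n b hn hb).imp_left .inl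
  live a c bmp' arr' ha hn hb := by
    rcases ha with ha | ⟨p, ha⟩
    · have h1 := h.dead a (h.not_live (hw.live a c bmp' arr' ha hn hb))
      have h2 : w.mem.heap a = some (.inode (some c)) := hn
      rw [h1] at h2; cases h2
    · have : w.pre a = p := (h.wellFormed hw).pre_eq ha hn trivial
      show NodeAt (w.mem.setRoot b) (w.pre a) a
      rwa [this]

theorem hasKey_setRoot {σ : Mem K V} {k : K} {l : ℕ} {a : Addr} :
    HasKey W hash (σ.setRoot b) k l a ↔ HasKey W hash σ k l a := by
  constructor <;> intro h
  all_goals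
    induction h with
    | inodeHolds l a s v tb h hs => exact .inodeHolds _ _ _ _ _ h hs
    | inodeMain l a c bmp arr h hc hk ih => exact .inodeMain _ _ _ _ _ h hc ih
    | cnodeHolds l a s bmp arr v tb h hb hs => exact .cnodeHolds _ _ _ _ _ _ _ h hb hs
    | cnodeSub l a i bmp arr m h hb hi hk ih => exact .cnodeSub _ _ _ _ _ _ h hb hi ih

end

end

/-! ### Safety of programs -/

theorem bind_eq {α β : Type} (p : Prog K V α) (f : α → Prog K V β) : p >>= f = p.bind f := rfl

theorem pure_eq {α : Type} (a : α) : (pure a : Prog K V α) = .ret a := rfl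

theorem Prog.bind_assoc {α β γ : Type} (p : Prog K V α) (f : α → Prog K V β) (g : β → Prog K V γ) :
    (p.bind f).bind g = p.bind fun x => (f x).bind g := by
  induction p with
  | ret => rfl
  | crash => rfl
  | _ => simp only [Prog.bind, *]

/-- The key of an operation. -/
def Op.key : Op K V → K
  | .insert k _ => k
  | .remove k => k
  | .lookup k => k

/-- The effect of one step of a thread that runs `op` on the abstract set. The status `ph` is
`none` before the operation has taken effect, and then `some b`, where `b` tells whether the key
was in the abstract set when the operation took effect. A step either leaves the status and the
abstract set unchanged, or is the one in which the operation takes effect. -/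
def Effect (op : Op K V) (ph : Option Bool) (A A' : Set K) (ph' : Option Bool) : Prop :=
  (ph' = ph ∧ A' = A) ∨
    ph = none ∧ ∃ b : Bool, ph' = some b ∧ A' = op.apply A ∧ (b = true ↔ op.key ∈ A)

section

variable [DecidableEq K]

/-- Safety of a program `p` of thread `t`, for its next `n` steps, within the operation `op` of
status `ph`: however the other threads change the world `w` before each step, the step keeps the
invariant, is harmless to the other threads, and has an admissible effect on the abstract set, and
if `p` returns, then `Q` holds for the result, the status and the world.  The bound `n` makes the
definition recursive although programs need not terminate, and recursive procedures are handled by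
induction on it.  A program that crashes is safe. -/
def Safe (W : ℕ) (hash : K → ℕ) (t : T) (op : Op K V) {α : Type} : ℕ → Prog K V α → Option Bool →
    World K V T → (α → Option Bool → World K V T → Prop) → Prop
  | 0, _, _, _, _ => True
  | n + 1, p, ph, w, Q => ∀ w', Rely t w w' → Inv W hash w' →
      (∀ a, p = .ret a → Q a ph w') ∧
      ∀ σ p', p.step W hash w'.mem = some (σ, p') →
        ∃ w'' ph', w''.mem = σ ∧ Inv W hash w'' ∧ Ext w' w'' ∧ (∀ s ≠ t, Rely s w' w'') ∧
          Effect op ph (absSet W hash w'.mem) (absSet W hash σ) ph' ∧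
          Safe W hash t op n p' ph' w'' Q

variable {W : ℕ} {hash : K → ℕ} {t : T} {op : Op K V} {α β : Type} {n : ℕ} {p : Prog K V α}
  {ph : Option Bool} {w : World K V T} {Q Q' : α → Option Bool → World K V T → Prop}

theorem Safe.rely {w' : World K V T} (h : Safe W hash t op n p ph w Q) (hr : Rely t w w') :
    Safe W hash t op n p ph w' Q := by
  cases n with
  | zero => trivial
  | succ n => exact fun w'' hr' hi => h w'' (hr.trans hr') hi

theorem Safe.pred (h : Safe W hash t op (n + 1) p ph w Q) : Safe W hash t op n p ph w Q := by
  induction n generalizing p ph w with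
  | zero => trivial
  | succ n ih =>
    intro w' hr hi
    refine ⟨(h w' hr hi).1, fun σ p' hs => ?_⟩
    obtain ⟨w'', ph', h1, h2, h3, h4, h5, h6⟩ := (h w' hr hi).2 σ p' hs
    exact ⟨w'', ph', h1, h2, h3, h4, h5, ih h6⟩

theorem Safe.mono {m : ℕ} (h : Safe W hash t op n p ph w Q) (hm : m ≤ n) :
    Safe W hash t op m p ph w Q := by
  induction n, hm using Nat.le_induction with
  | base => exact h
  | succ n _ ih => exact ih h.pred

theorem Safe.conseq (h : Safe W hash t op n p ph w Q)
    (H : ∀ a ph' w', Ext w w' → Inv W hash w' → Q a ph' w' → Q' a ph' w') :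
    Safe W hash t op n p ph w Q' := by
  induction n generalizing p ph w with
  | zero => trivial
  | succ n ih =>
    intro w' hr hi
    refine ⟨fun a e => H _ _ _ hr.toExt hi ((h w' hr hi).1 a e), fun σ p' hs => ?_⟩
    obtain ⟨w'', ph', h1, h2, h3, h4, h5, h6⟩ := (h w' hr hi).2 σ p' hs
    exact ⟨w'', ph', h1, h2, h3, h4, h5,
      ih h6 fun a ph₂ w₂ hx hi hq => H a ph₂ w₂ ((hr.toExt.trans h3).trans hx) hi hq⟩

theorem Prog.step_bind {p : Prog K V α} {f : α → Prog K V β} {σ σ' : Mem K V} {p' : Prog K V β}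
    (h : (p.bind f).step W hash σ = some (σ', p')) :
    (∃ a, p = .ret a) ∨ ∃ p₁, p.step W hash σ = some (σ', p₁) ∧ p' = p₁.bind f := by
  cases p with
  | ret a => exact .inl ⟨a, rfl⟩
  | crash => cases h
  | readRoot g => cases h; exact .inr ⟨_, rfl, rfl⟩
  | casRoot o nw g =>
    simp only [Prog.bind, Prog.step] at h ⊢
    right
    split_ifs at h ⊢ <;> cases h <;> exact ⟨_, rfl, rfl⟩
  | read i g =>
    simp only [Prog.bind, Prog.step] at h ⊢
    right
    split at h
    · cases h; exact ⟨_, rfl, rfl⟩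
    · cases h
  | cas i o nw g =>
    simp only [Prog.bind, Prog.step] at h ⊢
    right
    split at h
    · split_ifs at h ⊢ <;> cases h <;> exact ⟨_, rfl, rfl⟩
    · cases h
  | load a g =>
    simp only [Prog.bind, Prog.step] at h ⊢
    right
    split at h
    · cases h; exact ⟨_, rfl, rfl⟩
    · cases h
  | alloc nd g => cases h; exact .inr ⟨_, rfl, rfl⟩
  | call c g =>
    cases h
    exact .inr ⟨_, rfl, (Prog.bind_assoc _ _ _).symm⟩

/-- Here the postcondition of `p` is the safety of the continuation, for any number of steps that is
at least that of `p`. -/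
theorem Safe.bind' {f : α → Prog K V β} {Q : β → Option Bool → World K V T → Prop} {m : ℕ}
    (hm : m ≤ n)
    (h : Safe W hash t op m p ph w fun a ph' w' => Safe W hash t op n (f a) ph' w' Q) :
    Safe W hash t op m (p.bind f) ph w Q := by
  induction m generalizing p ph w with
  | zero => trivial
  | succ m ih =>
    intro w' hr hi
    by_cases hp : ∃ a, p = .ret a
    · obtain ⟨a, rfl⟩ := hp
      exact (((h w' hr hi).1 a rfl).mono hm) w' (Rely.refl _ _) hi
    · refine ⟨fun b e => ?_, fun σ p' hs => ?_⟩
      · cases p with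
        | ret a => exact absurd ⟨a, rfl⟩ hp
        | _ => cases e
      · obtain hp' | ⟨p₁, hs₁, rfl⟩ := Prog.step_bind hs
        · exact absurd hp' hp
        · obtain ⟨w'', ph', h1, h2, h3, h4, h5, h6⟩ := (h w' hr hi).2 σ p₁ hs₁
          exact ⟨w'', ph', h1, h2, h3, h4, h5, ih (by omega) h6⟩

theorem Safe.bind {f : α → Prog K V β} {Q : β → Option Bool → World K V T → Prop}
    {Q₁ : α → Option Bool → World K V T → Prop} (h : Safe W hash t op n p ph w Q₁)
    (H : ∀ a ph' w', Ext w w' → Inv W hash w' → Q₁ a ph' w' →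
      Safe W hash t op n (f a) ph' w' Q) :
    Safe W hash t op n (p.bind f) ph w Q :=
  Safe.bind' le_rfl (h.conseq H)

theorem Safe.ret {a : α} (h : ∀ w', Rely t w w' → Inv W hash w' → Q a ph w') :
    Safe W hash t op n (.ret a) ph w Q := by
  cases n with
  | zero => trivial
  | succ n =>
    refine fun w' hr hi => ⟨fun b e => ?_, fun σ p' hs => by cases hs⟩
    cases e
    exact h w' hr hi

theorem Safe.crash : Safe W hash t op n .crash ph w Q := by
  cases n with
  | zero => trivial
  | succ n => exact fun w' hr hi => ⟨fun b e => (by cases e), fun σ p' hs => by cases hs⟩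

/-- A step that does not change the memory. -/
theorem Safe.of_silent (hret : ∀ a, p ≠ .ret a)
    (h : ∀ w' σ p', Rely t w w' → Inv W hash w' → p.step W hash w'.mem = some (σ, p') →
      σ = w'.mem ∧ ∃ ph', Effect op ph (absSet W hash w'.mem) (absSet W hash w'.mem) ph' ∧
        Safe W hash t op n p' ph' w' Q) :
    Safe W hash t op n p ph w Q := by
  cases n with
  | zero => trivial
  | succ n =>
    refine fun w' hr hi => ⟨fun a e => absurd e (hret a), fun σ p' hs => ?_⟩
    obtain ⟨rfl, ph', h1, h2⟩ := h w' σ p' hr hi hs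
    exact ⟨w', ph', rfl, hi, Ext.refl _, fun s _ => Rely.refl _ _, h1, h2.pred⟩

theorem Safe.readRoot {f : Option Addr → Prog K V α}
    (h : ∀ w', Rely t w w' → Inv W hash w' →
      ∃ ph', Effect op ph (absSet W hash w'.mem) (absSet W hash w'.mem) ph' ∧
        Safe W hash t op n (f w'.mem.root) ph' w' Q) :
    Safe W hash t op n (.readRoot f) ph w Q := by
  refine .of_silent (by simp) fun w' σ p' hr hi hs => ?_
  cases hs
  exact ⟨rfl, h w' hr hi⟩

/-- Reading the `main` of an inode, as a step in which the operation may take effect. -/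
theorem Safe.read_effect {i : Addr} {f : Option Addr → Prog K V α}
    (h : ∀ w' m, Rely t w w' → Inv W hash w' → w'.mem.heap i = some (.inode m) →
      ∃ ph', Effect op ph (absSet W hash w'.mem) (absSet W hash w'.mem) ph' ∧
        Safe W hash t op n (f m) ph' w' Q) :
    Safe W hash t op n (.read i f) ph w Q := by
  refine .of_silent (by simp) fun w' σ p' hr hi hs => ?_
  simp only [Prog.step] at hs
  split at hs
  · rename_i m hm
    cases hs
    exact ⟨rfl, h w' m hr hi hm⟩
  · cases hs

theorem Safe.read {i : Addr} {f : Option Addr → Prog K V α}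
    (h : ∀ w' m, Rely t w w' → Inv W hash w' → w'.mem.heap i = some (.inode m) →
      Safe W hash t op n (f m) ph w' Q) :
    Safe W hash t op n (.read i f) ph w Q :=
  .read_effect fun w' m hr hi hm => ⟨ph, .inl ⟨rfl, rfl⟩, h w' m hr hi hm⟩

theorem Safe.load {a : Addr} {f : Node K V → Prog K V α}
    (h : ∀ w' nd, Rely t w w' → Inv W hash w' → w'.mem.heap a = some nd →
      Safe W hash t op n (f nd) ph w' Q) :
    Safe W hash t op n (.load a f) ph w Q := by
  refine .of_silent (by simp) fun w' σ p' hr hi hs => ?_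
  simp only [Prog.step] at hs
  split at hs
  · rename_i nd hm
    cases hs
    exact ⟨rfl, ph, .inl ⟨rfl, rfl⟩, h w' nd hr hi hm⟩
  · cases hs

theorem Safe.load_cnode {a : Addr} {f : Node K V → Prog K V α} {bmp : ℕ} {arr : List Addr}
    (ha : w.mem.heap a = some (.cnode bmp arr))
    (h : Safe W hash t op n (f (.cnode bmp arr)) ph w Q) :
    Safe W hash t op n (.load a f) ph w Q := by
  refine .load fun w' nd hr hi hm => ?_
  rw [hr.cnode ha] at hm; cases hm
  exact h.rely hr

theorem Safe.load_snode {a : Addr} {f : Node K V → Prog K V α} {k : K} {v : V} {tb : Bool}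
    (ha : w.mem.heap a = some (.snode k v tb))
    (h : Safe W hash t op n (f (.snode k v tb)) ph w Q) :
    Safe W hash t op n (.load a f) ph w Q := by
  refine .load fun w' nd hr hi hm => ?_
  rw [hr.snode ha] at hm; cases hm
  exact h.rely hr

theorem Safe.load_inode {a : Addr} {f : Node K V → Prog K V α}
    (ha : ∃ m, w.mem.heap a = some (.inode m))
    (h : ∀ m, Safe W hash t op n (f (.inode m)) ph w Q) :
    Safe W hash t op n (.load a f) ph w Q := by
  refine .load fun w' nd hr hi hm => ?_
  obtain ⟨m, hm'⟩ := hr.inode ha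
  rw [hm'] at hm; cases hm
  exact (h m).rely hr

/-- The allocated node is given the prefix `q`; the prefix of an snode is irrelevant. -/
theorem Safe.alloc {nd : Node K V} {f : Addr → Prog K V α} (q : List ℕ)
    (hn : NodeOk W hash w.mem w.pre q nd) (hk : ∀ b, nd.Child b → w.Knows t b)
    (h : ∀ w' a, Rely t w w' → Inv W hash w' → w'.mem.heap a = some nd → w'.pre a = q →
      w'.own a = some t → a ∉ w'.pub → Safe W hash t op n (f a) ph w' Q) :
    Safe W hash t op n (.alloc nd f) ph w Q := by
  cases n with
  | zero => trivial
  | succ n =>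
    refine fun w' hr hi => ⟨fun a e => (by cases e), fun σ p' hs => ?_⟩
    cases hs
    have hk' : ∀ b, nd.Child b → w'.Knows t b := by
      intro b hb
      obtain ⟨n', hn'⟩ := hn.child_alloc hb
      exact hr.knows hn' (hk b hb)
    have hi' := hi.alloc (t := t) (hn.ext hr.toExt) hk'
    have hr' := hi.rely_alloc (q := q) (n := nd) (t := t)
    refine ⟨w'.alloc t q nd, ph, rfl, hi', (hr' t).toExt, fun s _ => hr' s,
      .inl ⟨rfl, hi.absSet_alloc (t := t) (q := q)⟩, Safe.pred (h _ _ (hr.trans (hr' t)) hi'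
        (w'.alloc_heap_self t q nd) (Function.update_self _ _ _) (Function.update_self _ _ _) ?_)⟩
    intro hp
    obtain ⟨n', h'⟩ := hi.pub_alloc _ hp
    exact hi.ne_next h' rfl

/-- A CAS at an inode, where `c` is the expected cnode. The conditions need only hold in the world
in which the CAS succeeds, where `c` still is the `main` of the inode. -/
theorem Safe.cas {i c bmp : ℕ} {arr : List Addr} {m' : Option Addr} {f : Bool → Prog K V α}
    (h : ∀ w', Rely t w w' → Inv W hash w' → w'.mem.heap i = some (.inode (some c)) →
      CanSet W hash w' t i c bmp arr m' ∧
      ∃ ph', Effect op ph (absSet W hash w'.mem) (absSet W hash (w'.mem.setMain i m')) ph' ∧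
        ∀ w'', Ext w' w'' → Inv W hash w'' → Safe W hash t op n (f true) ph' w'' Q)
    (hf : Safe W hash t op n (f false) ph w Q) :
    Safe W hash t op n (.cas i (some c) m' f) ph w Q := by
  cases n with
  | zero => trivial
  | succ n =>
    refine fun w' hr hi => ⟨fun a e => (by cases e), fun σ p' hs => ?_⟩
    simp only [Prog.step] at hs
    split at hs
    · rename_i m hm
      split_ifs at hs with e
      · cases hs
        subst e
        obtain ⟨hc, ph', he, hs⟩ := h w' hr hi hm
        exact ⟨_, ph', rfl, hc.inv hi, hc.ext, fun s => hc.rely hi, he,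
          (hs _ hc.ext (hc.inv hi)).pred⟩
      · cases hs
        exact ⟨w', ph, rfl, hi, Ext.refl _, fun s _ => Rely.refl _ _, .inl ⟨rfl, rfl⟩,
          (hf.rely hr).pred⟩
    · cases hs

theorem Safe.casRoot {o b : Option Addr} {f : Bool → Prog K V α}
    (h : ∀ w', Rely t w w' → Inv W hash w' → w'.mem.root = o →
      CanSetRoot w' t b ∧
      ∃ ph', Effect op ph (absSet W hash w'.mem) (absSet W hash (w'.mem.setRoot b)) ph' ∧
        ∀ w'', Ext w' w'' → Inv W hash w'' → Safe W hash t op n (f true) ph' w'' Q)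
    (hf : Safe W hash t op n (f false) ph w Q) :
    Safe W hash t op n (.casRoot o b f) ph w Q := by
  cases n with
  | zero => trivial
  | succ n =>
    refine fun w' hr hi => ⟨fun a e => (by cases e), fun σ p' hs => ?_⟩
    simp only [Prog.step] at hs
    split_ifs at hs with e
    · cases hs
      obtain ⟨hc, ph', he, hs⟩ := h w' hr hi e
      exact ⟨_, ph', rfl, hc.inv hi, CanSetRoot.ext, fun s => hc.rely hi, he,
        (hs _ CanSetRoot.ext (hc.inv hi)).pred⟩
    · cases hs
      exact ⟨w', ph, rfl, hi, Ext.refl _, fun s _ => Rely.refl _ _, .inl ⟨rfl, rfl⟩,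
        (hf.rely hr).pred⟩

/-- Since the call is a step of its own, the body need only be safe for fewer steps, which is what
induction provides for recursive calls. -/
theorem Safe.call {c : Call K V} {f : c.Ret → Prog K V α}
    {Q₁ : c.Ret → Option Bool → World K V T → Prop}
    (h : ∀ m < n, ∀ w', Rely t w w' → Inv W hash w' → Safe W hash t op m (body W hash c) ph w' Q₁)
    (H : ∀ a ph' w', Ext w w' → Inv W hash w' → Q₁ a ph' w' →
      Safe W hash t op n (f a) ph' w' Q) :
    Safe W hash t op n (.call c f) ph w Q := by
  cases n with
  | zero => trivial
  | succ n =>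
    refine fun w' hr hi => ⟨fun a e => (by cases e), fun σ p' hs => ?_⟩
    cases hs
    exact ⟨w', ph, rfl, hi, Ext.refl _, fun s _ => Rely.refl _ _, .inl ⟨rfl, rfl⟩,
      (h n (by omega) w' hr hi).bind fun a ph' w'' hx hi hq =>
        (H a ph' w'' (hr.toExt.trans hx) hi hq).pred⟩

end

/-! ### Compression -/

/-- The node at `a` is an snode, or an inode that holds an snode, of key `k`. -/
def Single (w : World K V T) (a : Addr) (k : K) : Prop :=
  (∃ v tb, w.mem.heap a = some (.snode k v tb)) ∨
    ∃ s v tb, w.mem.heap a = some (.inode (some s)) ∧ w.mem.heap s = some (.snode k v tb)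

/-- Thread `t` may know the node `a`, which is allocated. -/
def World.Ref (w : World K V T) (t : T) (a : Addr) : Prop :=
  w.Knows t a ∧ ∃ nd, w.mem.heap a = some nd

/-- The branch `a'` is `a`, or an untombed copy of the snode in the inode `a`. -/
def Resurrected (w : World K V T) (a a' : Addr) : Prop :=
  a' = a ∨ ∃ s k v tb, w.mem.heap a = some (.inode (some s)) ∧
    w.mem.heap s = some (.snode k v tb) ∧ w.mem.heap a' = some (.snode k v false)

/-- The branches `g` are the branches `f` after some null-inodes have been dropped and some inodes
that hold an snode have been replaced by untombed copies of the snode. -/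
def Compresses (w : World K V T) (f g : ℕ → Option Addr) : Prop :=
  ∀ r, (∃ a a', f r = some a ∧ g r = some a' ∧ Resurrected w a a') ∨
    g r = none ∧ ∀ a, f r = some a → w.mem.heap a = some (.inode none)

/-- `m'` is an admissible compression, made by thread `t`, of a cnode with the prefix `q` and the
given fields: it is null, all branches being null-inodes, or a compressed cnode, or an snode with
the key of a branch, all other branches being null-inodes. All this is stable: what the thread has
seen of null-inodes and tomb-inodes remains true. -/
def Compression (W : ℕ) (hash : K → ℕ) (w : World K V T) (t : T) (q : List ℕ) (bmp : ℕ)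
    (arr : List Addr) (m' : Option Addr) : Prop :=
  (∀ b, m' = some b → w.Knows t b) ∧ NodeOk W hash w.mem w.pre q (.inode m') ∧
  (m' = none ∧ (∀ r a, branch bmp arr r = some a → w.mem.heap a = some (.inode none)) ∨
  (∃ b bmp' arr', m' = some b ∧ w.mem.heap b = some (.cnode bmp' arr') ∧
    Compresses w (branch bmp arr) (branch bmp' arr')) ∨
  ∃ b k v tb r a, m' = some b ∧ w.mem.heap b = some (.snode k v tb) ∧
    branch bmp arr r = some a ∧ r = chunk W (W * q.length) (hash k) ∧ Single w a k ∧
    ∀ r' a', branch bmp arr r' = some a' → r' ≠ r → w.mem.heap a' = some (.inode none))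

section

variable {w w' : World K V T}

theorem Single.ext (h : Ext w w') {a : Addr} {k : K} (ha : Single w a k) : Single w' a k := by
  rcases ha with ⟨v, tb, ha⟩ | ⟨s, v, tb, ha, hs⟩
  · exact .inl ⟨v, tb, h.snode ha⟩
  · exact .inr ⟨s, v, tb, h.holds ha hs, h.snode hs⟩

theorem World.Ref.ext (h : Ext w w') {t : T} {a : Addr} (ha : w.Ref t a) : w'.Ref t a :=
  ⟨h.knows ha.2.choose_spec ha.1, h.isSome ha.2.choose_spec⟩

theorem Resurrected.ext (h : Ext w w') {a a' : Addr} (ha : Resurrected w a a') :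
    Resurrected w' a a' := by
  rcases ha with ha | ⟨s, k, v, tb, ha, hs, ha'⟩
  · exact .inl ha
  · exact .inr ⟨s, k, v, tb, h.holds ha hs, h.snode hs, h.snode ha'⟩

theorem Compresses.ext (h : Ext w w') {f g : ℕ → Option Addr} (hc : Compresses w f g) :
    Compresses w' f g := fun r =>
  (hc r).imp (fun ⟨a, a', h1, h2, h3⟩ => ⟨a, a', h1, h2, h3.ext h⟩)
    fun ⟨h1, h2⟩ => ⟨h1, fun a ha => h.null (h2 a ha)⟩

theorem Inv.main_cases {W : ℕ} {hash : K → ℕ} {w : World K V T} (hw : Inv W hash w) {i b : Addr}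
    (h : w.mem.heap i = some (.inode (some b))) :
    (∃ bmp arr, w.mem.heap b = some (.cnode bmp arr) ∧ w.pre b = w.pre i) ∨
      ∃ k v, w.mem.heap b = some (.snode k v true) ∧ IsHashPrefix W (hash k) (w.pre i) :=
  (hw.wf.node i _ h).main_cases

theorem Compression.ext {W : ℕ} {hash : K → ℕ} (h : Ext w w') {t : T} {q : List ℕ} {bmp : ℕ}
    {arr : List Addr} {m' : Option Addr} (hc : Compression W hash w t q bmp arr m') :
    Compression W hash w' t q bmp arr m' := by
  obtain ⟨h1, h2, h3⟩ := hc
  refine ⟨fun b hb => ?_, h2.ext h, ?_⟩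
  · obtain ⟨n', hn'⟩ := h2.child_alloc (b := b) hb
    exact h.knows hn' (h1 b hb)
  · rcases h3 with ⟨h3, h4⟩ | ⟨b, bmp', arr', h3, h4, h5⟩ |
      ⟨b, k, v, tb, r, a, h3, h4, h5, h6, h7, h8⟩
    · exact .inl ⟨h3, fun r a ha => h.null (h4 r a ha)⟩
    · exact .inr (.inl ⟨b, bmp', arr', h3, h.cnode h4, h5.ext h⟩)
    · exact .inr (.inr ⟨b, k, v, tb, r, a, h3, h.snode h4, h5, h6, h7.ext h,
        fun r' a' ha hr => h.null (h8 r' a' ha hr)⟩)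

theorem Single.hasBelow {W : ℕ} {hash : K → ℕ} {a : Addr} {k k' : K} {l : ℕ} (h : Single w a k) :
    HasBelow W hash w.mem k' l a ↔ k = k' := by
  rcases h with ⟨v, tb, h⟩ | ⟨s, v, tb, h, hs⟩
  · exact hasBelow_snode h
  · rw [hasBelow_inode h, hasMain_snode hs]

theorem not_hasBelow_null {W : ℕ} {hash : K → ℕ} {a : Addr} {k' : K} {l : ℕ}
    (h : w.mem.heap a = some (.inode none)) : ¬ HasBelow W hash w.mem k' l a := by
  rw [hasBelow_inode h]; exact hasMain_none

theorem Resurrected.hasBelow {W : ℕ} {hash : K → ℕ} {a a' : Addr} {k : K} {l : ℕ}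
    (h : Resurrected w a a') :
    HasBelow W hash w.mem k l a' ↔ HasBelow W hash w.mem k l a := by
  rcases h with rfl | ⟨s, k', v, tb, h, hs, h'⟩
  · rfl
  · rw [hasBelow_snode h', hasBelow_inode h, hasMain_snode hs]

/-- Compression does not change the keys. -/
theorem Compression.hasMain_iff {W : ℕ} {hash : K → ℕ} {t : T} {q : List ℕ} {c bmp : ℕ}
    {arr : List Addr} {m' : Option Addr} (h : Compression W hash w t q bmp arr m')
    (hc : w.mem.heap c = some (.cnode bmp arr)) (k : K) :
    HasMain W hash w.mem k (W * q.length) (some c) ↔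
      HasMain W hash w.mem k (W * q.length) m' := by
  rw [hasMain_cnode hc]
  rcases h.2.2 with ⟨rfl, h₁⟩ | ⟨b, bmp', arr', rfl, hb, h₁⟩ |
    ⟨b, k', v, tb, r, a, rfl, hb, h₁, hr, hs, h'⟩
  · simp only [hasMain_none, iff_false, not_exists, not_and]
    exact fun a ha => not_hasBelow_null (h₁ _ a ha)
  · rw [hasMain_cnode hb]
    rcases h₁ (chunk W (W * q.length) (hash k)) with ⟨a, a', h1, h2, h3⟩ | ⟨h1, h2⟩
    · simp [h1, h2, h3.hasBelow]
    · simp only [h1, reduceCtorEq, false_and, exists_false, iff_false, not_exists, not_and]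
      exact fun a ha => not_hasBelow_null (h2 a ha)
  · rw [hasMain_snode hb]
    constructor
    · rintro ⟨a', ha', hk⟩
      by_cases e : chunk W (W * q.length) (hash k) = r
      · rw [e, h₁] at ha'; cases ha'
        exact hs.hasBelow.1 hk
      · exact absurd hk (not_hasBelow_null (h' _ _ ha' e))
    · rintro rfl
      exact ⟨a, hr ▸ h₁, hs.hasBelow.2 rfl⟩

/-- Compression keeps the inodes that hold a cnode. -/
theorem Compression.canSet {W : ℕ} {hash : K → ℕ} {t : T} {i c bmp : ℕ}
    {arr : List Addr} {m' : Option Addr} (h : Compression W hash w t (w.pre i) bmp arr m')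
    (hi : i ∈ w.pub) (hm : w.mem.heap i = some (.inode (some c)))
    (hc : w.mem.heap c = some (.cnode bmp arr)) : CanSet W hash w t i c bmp arr m' := by
  refine ⟨hi, hm, hc, h.2.1, h.1, fun r j d bmp₁ arr₁ hr hj hd => ?_⟩
  rcases h.2.2 with ⟨rfl, h₁⟩ | ⟨b, bmp', arr', rfl, hb, h₁⟩ |
    ⟨b, k', v, tb, r', a, rfl, hb, h₁, hr', hs, h'⟩
  · rw [h₁ r j hr] at hj; cases hj
  · refine ⟨b, bmp', arr', rfl, hb, ?_⟩
    rcases h₁ r with ⟨a, a', h1, h2, rfl | ⟨s, _, _, _, ha, hs, _⟩⟩ | ⟨h1, h2⟩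
    · rw [← hr, h1, h2]
    · rw [hr] at h1; cases h1
      rw [hj] at ha; cases ha
      rw [hd] at hs; cases hs
    · rw [h2 j hr] at hj; cases hj
  · by_cases e : r = r'
    · subst e
      rw [hr] at h₁; cases h₁
      rcases hs with ⟨_, _, hs⟩ | ⟨_, _, _, hs, hs'⟩
      · rw [hj] at hs; cases hs
      · rw [hj] at hs; cases hs
        rw [hd] at hs'; cases hs'
    · rw [h' r j hr e] at hj; cases hj

/-- The key of a singleton branch starts with the prefix of the branch. -/
theorem Single.isHashPrefix {W : ℕ} {hash : K → ℕ} (hw : Inv W hash w) {a : Addr} {k : K}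
    {q : List ℕ} (hs : Single w a k) (hb : BranchOk W hash w.mem w.pre q a) :
    IsHashPrefix W (hash k) q := by
  rcases hs with ⟨v, tb, hs⟩ | ⟨s, v, tb, ha, hs⟩
  · rcases hb with ⟨m, hm, -⟩ | ⟨k', v', hk, hq⟩
    · rw [hs] at hm; cases hm
    · rw [hs] at hk; cases hk; exact hq
  · rcases hb with ⟨m, hm, rfl⟩ | ⟨k', v', hk, hq⟩
    · rcases hw.main_cases ha with ⟨_, _, hs', -⟩ | ⟨k', v', hs', hq⟩
      · rw [hs] at hs'; cases hs'
      · rw [hs] at hs'; cases hs'; exact hq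
    · rw [ha] at hk; cases hk

theorem Resurrected.branchOk {W : ℕ} {hash : K → ℕ} (hw : Inv W hash w) {a b : Addr} {q : List ℕ}
    (hs : Resurrected w a b) (hb : BranchOk W hash w.mem w.pre q a) :
    BranchOk W hash w.mem w.pre q b := by
  rcases hs with rfl | ⟨s, k, v, tb, ha, hs, hb'⟩
  · exact hb
  · exact .inr ⟨k, v, hb', Single.isHashPrefix hw (.inr ⟨s, v, tb, ha, hs⟩) hb⟩

/-- The cnode made from the branches `l`, which are the branches `L` that are left after null-inodes
have been dropped, or resurrected copies of them, may be allocated, and compresses the old cnode. -/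
theorem Compression.of_filtered {t : T} {W : ℕ} {hash : K → ℕ} (hw : Inv W hash w) {c bmp : ℕ}
    {arr : List Addr} (hc : w.mem.heap c = some (.cnode bmp arr))
    {L : List (ℕ × Addr)} (hL : L.Sublist (bmp.bitIndices.zip arr))
    (hd : ∀ x ∈ bmp.bitIndices.zip arr, x ∉ L → w.mem.heap x.2 = some (.inode none))
    {l : List Addr}
    (hl : List.Forall₂ (fun a b => w.Ref t b ∧ Resurrected w a b) (L.map Prod.snd) l) :
    NodeOk W hash w.mem w.pre (w.pre c) (.cnode (bitmapOf L) l) ∧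
    (∀ b, (Node.cnode (bitmapOf L) l : Node K V).Child b → w.Knows t b) ∧
    Compresses w (branch bmp arr) (branch (bitmapOf L) l) := by
  obtain ⟨h1, h2, h3⟩ := hw.wf.node c _ hc
  have hs := sorted_zip_bitIndices h2
  have hs' : (L.map Prod.fst).SortedLT :=
    (hs.pairwise.sublist (hL.map _)).sortedLT
  obtain ⟨e1, e2, e3⟩ := branch_bitmapOf_forall₂ hs' hl
  have mem {r a} (h : (r, a) ∈ L) : branch bmp arr r = some a :=
    (branch_iff_mem_zip h2 r a).2 (hL.subset h)
  refine ⟨⟨fun r hr => ?_, e1, fun r b hr => ?_⟩, ?_, fun r => ?_⟩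
  · rw [flagged_bitmapOf hs'] at hr
    obtain ⟨⟨r, a⟩, hm, rfl⟩ := List.mem_map.1 hr
    exact h1 _ (flagged_of_branch (mem hm))
  · obtain ⟨a, ha, -, hab⟩ := e2 r b hr
    exact hab.branchOk hw (h3 r a (mem ha))
  · rintro b ⟨r, hr⟩
    obtain ⟨a, ha, hk, -⟩ := e2 r b hr
    exact hk.1
  · cases hb : branch (bitmapOf L) l r with
    | some b =>
      obtain ⟨a, ha, -, hab⟩ := e2 r b hb
      exact .inl ⟨a, b, mem ha, rfl, hab⟩
    | none =>
      refine .inr ⟨rfl, fun a ha => hd (r, a) ((branch_iff_mem_zip h2 r a).1 ha) fun hm => ?_⟩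
      obtain ⟨b, hb'⟩ := e3 r a hm
      rw [hb] at hb'; cases hb'

theorem Compression.of_empty {t : T} {W : ℕ} {hash : K → ℕ} (hw : Inv W hash w) {c bmp : ℕ}
    {arr : List Addr} (hc : w.mem.heap c = some (.cnode bmp arr))
    (hd : ∀ x ∈ bmp.bitIndices.zip arr, w.mem.heap x.2 = some (.inode none)) (q : List ℕ) :
    Compression W hash w t q bmp arr none := by
  refine ⟨by simp, fun b hb => (by cases hb), .inl ⟨rfl, fun r a hr => ?_⟩⟩
  exact hd (r, a) ((branch_iff_mem_zip (hw.wf.node c _ hc).2.1 r a).1 hr)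

theorem Compression.of_single {t : T} {W : ℕ} {hash : K → ℕ} (hw : Inv W hash w) {c bmp : ℕ}
    {arr : List Addr} (hc : w.mem.heap c = some (.cnode bmp arr)) {r a b : ℕ} {k : K} {v : V}
    (hr : (r, a) ∈ bmp.bitIndices.zip arr) (ha : Single w a k)
    (hb : w.mem.heap b = some (.snode k v true)) (hk : w.Knows t b)
    (hd : ∀ x ∈ bmp.bitIndices.zip arr, x ≠ (r, a) → w.mem.heap x.2 = some (.inode none)) :
    Compression W hash w t (w.pre c) bmp arr (some b) := by
  obtain ⟨h1, h2, h3⟩ := hw.wf.node c _ hc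
  have hbr := (branch_iff_mem_zip h2 r a).2 hr
  have hq := isHashPrefix_append.1 (ha.isHashPrefix hw (h3 r a hbr))
  refine ⟨?_, ?_, .inr (.inr
    ⟨b, k, v, true, r, a, rfl, hb, hbr, hq.2, ha, fun r' a' hr' hne => ?_⟩)⟩
  · rintro _ ⟨⟩; exact hk
  · rintro _ ⟨⟩; exact .inr ⟨k, v, hb, hq.1⟩
  · exact hd (r', a') ((branch_iff_mem_zip h2 r' a').1 hr') fun e => hne (Prod.ext_iff.1 e).1

/-- What `clean`, `tombCompress` and `contractParent` require from the inodes that they are called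
with. -/
def World.PubInode (w : World K V T) (i : Addr) : Prop :=
  i ∈ w.pub ∧ ∃ m, w.mem.heap i = some (.inode m)

theorem World.PubInode.ext {w w' : World K V T} {i : Addr} (hi : w.PubInode i) (h : Ext w w') :
    w'.PubInode i := ⟨h.pub hi.1, h.inode hi.2⟩

end

section

variable [DecidableEq K] {W : ℕ} {hash : K → ℕ} {t : T} {op : Op K V} {α β : Type} {n : ℕ}
  {ph : Option Bool} {w : World K V T} {Q : α → Option Bool → World K V T → Prop}

/-- A CAS that compresses a cnode does not change the abstract set. -/
theorem Safe.cas_compression {i c bmp : ℕ} {arr : List Addr} {m' : Option Addr}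
    {f : Bool → Prog K V α} (h : Compression W hash w t (w.pre i) bmp arr m')
    (hi : i ∈ w.pub) (hI : ∃ m, w.mem.heap i = some (.inode m))
    (hc : w.mem.heap c = some (.cnode bmp arr))
    (ht : ∀ w', Ext w w' → Inv W hash w' → Safe W hash t op n (f true) ph w' Q)
    (hf : Safe W hash t op n (f false) ph w Q) :
    Safe W hash t op n (.cas i (some c) m' f) ph w Q := by
  refine .cas (bmp := bmp) (arr := arr) (fun w' hr hinv hm => ?_) hf
  obtain ⟨m, hI⟩ := hI
  have h' := h.ext hr.toExt
  rw [← hr.pre hI] at h'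
  have hcs := h'.canSet (hr.pub hi) hm (hr.cnode hc)
  exact ⟨hcs, ph, .inl ⟨rfl, hcs.absSet_eq hinv (h'.hasMain_iff (hr.cnode hc))⟩,
    fun w'' hx hi' => ht w'' (hr.toExt.trans hx) hi'⟩

theorem safe_isTombInode (a : Addr) :
    Safe W hash t op n (isTombInode a) ph w fun b ph' w' => ph' = ph ∧
      (b = true → ∃ s k v, w'.mem.heap a = some (.inode (some s)) ∧
        w'.mem.heap s = some (.snode k v true)) := by
  simp only [isTombInode, bind_eq, pure_eq, Ctrie.load, rd, Prog.bind]
  refine .load fun w1 nd _ _ ha => ?_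
  cases nd with
  | inode m =>
    refine .read fun w2 m _ hi2 hm => ?_
    cases m with
    | none => exact .ret fun w3 _ _ => ⟨rfl, by simp⟩
    | some s =>
      rcases hi2.main_cases hm with ⟨bmp, arr, hs, -⟩ | ⟨k, v, hs, -⟩
      · exact .load_cnode hs (.ret fun w3 _ _ => ⟨rfl, by simp⟩)
      · exact .load_snode hs (.ret fun w3 hr3 _ => ⟨rfl, fun _ =>
          ⟨s, k, v, hr3.holds hm hs, hr3.snode hs⟩⟩)
  | cnode => exact .ret fun w3 _ _ => ⟨rfl, by simp⟩
  | snode => exact .ret fun w3 _ _ => ⟨rfl, by simp⟩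

theorem safe_isSingleton (a : Addr) :
    Safe W hash t op n (isSingleton a) ph w fun b ph' w' => ph' = ph ∧
      (b = true → ∃ k, Single w' a k) := by
  simp only [isSingleton, bind_eq, pure_eq, Ctrie.load, Prog.bind]
  refine .load fun w1 nd _ _ ha => ?_
  have : Safe W hash t op n (isTombInode a) ph w1 fun b ph' w' => ph' = ph ∧
      (b = true → ∃ k, Single w' a k) :=
    (safe_isTombInode a).conseq fun b ph' w' _ _ h =>
      ⟨h.1, fun hb => by obtain ⟨s, k, v, h1, h2⟩ := h.2 hb; exact ⟨k, .inr ⟨s, v, _, h1, h2⟩⟩⟩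
  cases nd with
  | inode m => exact this
  | cnode => exact this
  | snode k v tb => exact .ret fun w3 hr3 _ => ⟨rfl, fun _ => ⟨k, .inl ⟨v, tb, hr3.snode ha⟩⟩⟩

/-- The inode of a singleton that holds an snode does not change, hence the copy has the same key.
-/
theorem safe_tombed {a : Addr} {k : K} (ha : Single w a k) :
    Safe W hash t op n (tombed a) ph w fun b ph' w' => ph' = ph ∧ w'.Knows t b ∧
      ∃ v, w'.mem.heap b = some (.snode k v true) := by
  have al {v : V} {w : World K V T} :
      Safe W hash t op n (.alloc (.snode k v true) .ret) ph w fun b ph' w' => ph' = ph ∧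
      w'.Knows t b ∧ ∃ v, w'.mem.heap b = some (.snode k v true) := by
    refine .alloc [] trivial (fun _ => False.elim) fun w1 b _ _ hb _ ho _ => ?_
    exact .ret fun w2 hr2 _ => ⟨rfl, hr2.knows hb (.inr ho), v, hr2.snode hb⟩
  simp only [tombed, bind_eq, Ctrie.load, rd, Ctrie.alloc, Prog.bind]
  rcases ha with ⟨v, tb, ha⟩ | ⟨s, v, tb, ha, hs⟩
  · exact .load_snode ha al
  · refine .load_inode ⟨_, ha⟩ fun m => .read fun w1 m' hr _ hm => ?_
    rw [hr.holds ha hs] at hm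
    cases hm
    exact .load_snode (hr.snode hs) al

theorem safe_resurrect (a : Addr) (ha : w.Ref t a) :
    Safe W hash t op n (resurrect a) ph w fun b ph' w' => ph' = ph ∧ w'.Ref t b ∧
      Resurrected w' a b := by
  have same {w' : World K V T} (h : Ext w w') :
      Safe W hash t op n (.ret a) ph w' fun b ph' w' => ph' = ph ∧ w'.Ref t b ∧
      Resurrected w' a b :=
    .ret fun w'' hr _ => ⟨rfl, ha.ext (h.trans hr.toExt), .inl rfl⟩
  simp only [resurrect, bind_eq, pure_eq, Ctrie.load, rd, Ctrie.alloc, Prog.bind]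
  refine .load fun w1 nd hr1 _ _ => ?_
  cases nd with
  | inode m =>
    refine .read fun w2 m hr2 hi2 hm => ?_
    cases m with
    | none => exact same (hr1.trans hr2).toExt
    | some s =>
      rcases hi2.main_cases hm with ⟨bmp, arr, hs, -⟩ | ⟨k, v, hs, -⟩
      · exact .load_cnode hs (same (hr1.trans hr2).toExt)
      · refine .load_snode hs
          (.alloc [] trivial (fun _ => False.elim) fun w3 b hr3 _ hb _ ho _ => ?_)
        exact .ret fun w4 hr4 _ => ⟨rfl, ⟨hr4.knows hb (.inr ho), _, hr4.snode hb⟩,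
          .inr ⟨s, k, v, true, (hr3.trans hr4).holds hm hs, (hr3.trans hr4).snode hs, hr4.snode hb⟩⟩
  | cnode => exact same hr1.toExt
  | snode => exact same hr1.toExt

theorem safe_notNullInode (a : Addr) :
    Safe W hash t op n (notNullInode a) ph w fun b ph' w' => ph' = ph ∧
      (b = false → w'.mem.heap a = some (.inode none)) := by
  simp only [notNullInode, bind_eq, pure_eq, Ctrie.load, rd, Prog.bind]
  refine .load fun w1 nd hr1 _ _ => ?_
  cases nd with
  | inode m =>
    refine .read fun w2 m hr2 hi2 hm => .ret fun w3 hr3 _ => ⟨rfl, fun h => ?_⟩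
    cases m with
    | none => exact hr3.null hm
    | some => cases h
  | cnode => exact .ret fun w3 hr3 _ => ⟨rfl, by simp⟩
  | snode => exact .ret fun w3 hr3 _ => ⟨rfl, by simp⟩

theorem safe_filtered (L : List (ℕ × Addr)) :
    Safe W hash t op n (filtered L) ph w fun L' ph' w' => ph' = ph ∧ L'.Sublist L ∧
      ∀ x ∈ L, x ∉ L' → w'.mem.heap x.2 = some (.inode none) := by
  induction L generalizing w with
  | nil => exact .ret fun w3 hr3 _ => ⟨rfl, List.Sublist.slnil, by simp⟩
  | cons x L ih =>
    obtain ⟨r, a⟩ := x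
    simp only [filtered, bind_eq, pure_eq]
    refine (safe_notNullInode a).bind fun b ph' w1 _ _ h1 => ?_
    obtain ⟨rfl, h1⟩ := h1
    refine ih.bind fun L' ph' w2 hx2 _ h2 => ?_
    obtain ⟨rfl, h2, h3⟩ := h2
    refine .ret fun w3 hr3 _ => ⟨rfl, ?_⟩
    cases b with
    | false =>
      refine ⟨h2.cons _, fun x hx hx' => ?_⟩
      rcases List.mem_cons.1 hx with rfl | hx
      · exact hr3.null (hx2.null (h1 rfl))
      · exact hr3.null (h3 x hx hx')
    | true =>
      refine ⟨h2.cons_cons _, fun x hx hx' => ?_⟩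
      simp only [if_true, List.mem_cons, not_or] at hx hx'
      exact hr3.null (h3 x (hx.resolve_left hx'.1) hx'.2)

theorem safe_resurrectAll (l : List Addr) (hl : ∀ a ∈ l, w.Ref t a) :
    Safe W hash t op n (resurrectAll l) ph w fun l' ph' w' => ph' = ph ∧
      List.Forall₂ (fun a b => w'.Ref t b ∧ Resurrected w' a b) l l' := by
  induction l generalizing w with
  | nil => exact .ret fun w3 hr3 _ => ⟨rfl, .nil⟩
  | cons a l ih =>
    simp only [resurrectAll, bind_eq, pure_eq]
    refine (safe_resurrect a (hl a (by simp))).bind fun b ph' w1 hx1 _ h1 => ?_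
    obtain ⟨rfl, h1, h2⟩ := h1
    refine (ih fun a ha => (hl a (by simp [ha])).ext hx1).bind fun l' ph' w2 hx2 _ h3 => ?_
    obtain ⟨rfl, h3⟩ := h3
    refine .ret fun w3 hr3 _ => ⟨rfl, ?_⟩
    have hx3 := hx2.trans hr3.toExt
    exact .cons ⟨h1.ext hx3, h2.ext hx3⟩
      (h3.imp fun _ _ h => ⟨h.1.ext hr3.toExt, h.2.ext hr3.toExt⟩)

theorem Safe.fetch {arr : List Addr} {j : ℕ} {f : Addr → Prog K V α}
    (h : ∀ a, arr[j]? = some a → Safe W hash t op n (f a) ph w Q) :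
    Safe W hash t op n ((fetch arr j).bind f) ph w Q := by
  unfold Ctrie.fetch
  cases e : arr[j]? with
  | none => exact .crash
  | some a => exact h a e

/-- Allocation of the compressed cnode. -/
theorem Safe.alloc_compressed {c bmp : ℕ} {arr : List Addr}
    {bmp' : ℕ} {arr' : List Addr}
    (hn : NodeOk W hash w.mem w.pre (w.pre c) (.cnode bmp' arr'))
    (hk : ∀ b, (Node.cnode bmp' arr' : Node K V).Child b → w.Knows t b)
    (h : Compresses w (branch bmp arr) (branch bmp' arr')) {f : Addr → Prog K V α}
    (H : ∀ w' b, Ext w w' → Inv W hash w' →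
      Compression W hash w' t (w.pre c) bmp arr (some b) → Safe W hash t op n (f b) ph w' Q) :
    Safe W hash t op n (.alloc (.cnode bmp' arr') f) ph w Q := by
  refine .alloc (w.pre c) hn hk fun w' b hr hi hb hp ho _ => H w' b hr.toExt hi ?_
  refine ⟨?_, ?_, .inr (.inl ⟨b, bmp', arr', rfl, hb, h.ext hr.toExt⟩)⟩
  · rintro _ ⟨⟩; exact .inr ho
  · rintro _ ⟨⟩; exact .inl ⟨_, _, hb, hp⟩

/-- The branches are scanned one after the other, while other threads make steps, but the
null-inodes and the tomb-inodes that have been seen remain as they are, so that the result is still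
a compression when the scan is over. -/
theorem safe_toCompressed (hw : Inv W hash w) {c bmp : ℕ} {arr : List Addr} (hp : c ∈ w.pub)
    (hc : w.mem.heap c = some (.cnode bmp arr)) :
    Safe W hash t op n (toCompressed bmp arr) ph w fun m' ph' w' => ph' = ph ∧
      Compression W hash w' t (w.pre c) bmp arr m' := by
  have h2 := (hw.wf.node c _ hc).2.1
  have e : (toCompressed bmp arr : Prog K V (Option Addr)) =
      (if bitcount bmp = 1 then (fetch arr 0).bind isTombInode else .ret false).bind fun lone =>
        if lone = true then (fetch arr 0).bind rd
        else (filtered (bmp.bitIndices.zip arr)).bind fun kept =>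
          (resurrectAll (kept.map Prod.snd)).bind fun rarr =>
            if bitcount (bitmapOf kept) > 0 then
              .alloc (.cnode (bitmapOf kept) rarr) fun a => .ret (some a)
            else .ret none := by
    simp only [toCompressed, bind_eq, pure_eq]
    split_ifs
    · rw [Prog.bind_assoc]; rfl
    · rfl
  rw [e]
  -- If the only branch is found to be a tomb-inode, it remains one.
  have lone : Safe W hash t op n (if bitcount bmp = 1 then (fetch arr 0).bind isTombInode
      else .ret false : Prog K V Bool) ph w fun b ph' w' => ph' = ph ∧ (b = true →
        bitcount bmp = 1 ∧ ∀ a, arr[0]? = some a → ∃ s k v, w'.mem.heap a = some (.inode (some s)) ∧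
        w'.mem.heap s = some (.snode k v true)) := by
    split_ifs with h
    · refine .fetch fun a ha => (safe_isTombInode a).conseq fun b ph' w' _ _ hb =>
        ⟨hb.1, fun e => ⟨h, fun a' ha' => ?_⟩⟩
      rw [ha] at ha'; cases ha'
      exact hb.2 e
    · exact .ret fun w' _ _ => ⟨rfl, by simp⟩
  refine lone.bind fun b ph' w1 hx1 hi1 h => ?_
  obtain ⟨rfl, h⟩ := h
  cases b with
  | true =>
    obtain ⟨hone, h⟩ := h rfl
    refine .fetch fun a ha => ?_
    obtain ⟨s, k, v, has, hs⟩ := h a ha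
    refine .read fun w2 m hr2 hi2 hm => .ret fun w3 hr3 hi3 => ⟨rfl, ?_⟩
    have hx := hr2.toExt.trans hr3.toExt
    rw [hr2.holds has hs] at hm; cases hm
    have hL : ∃ r, bmp.bitIndices.zip arr = [(r, a)] := by
      have hb : bmp.bitIndices.length = 1 := hone
      obtain ⟨r, hr⟩ := List.length_eq_one_iff.1 hb
      obtain ⟨a', ha'⟩ := List.length_eq_one_iff.1 (h2.symm.trans hone)
      subst ha'
      simp only [List.getElem?_cons_zero, Option.some.injEq] at ha
      exact ⟨r, by simp [hr, ha]⟩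
    obtain ⟨r, hL⟩ := hL
    have hc3 := (hx1.trans hx).cnode hc
    rw [← (hx1.trans hx).pre hc]
    have hap : a ∈ w3.pub := by
      refine hi3.child_pub c _ a hc3 ⟨r, (branch_iff_mem_zip h2 r a).2 (by simp [hL])⟩ ?_
      exact (hx1.trans hx).pub hp
    have has3 := hx.holds has hs
    refine .of_single hi3 hc3 (r := r) (a := a) (by simp [hL])
      (.inr ⟨s, v, true, has3, hx.snode hs⟩) (hx.snode hs)
      (.inl (hi3.child_pub a _ s has3 rfl hap)) ?_
    simp [hL]
  | false =>
    refine (safe_filtered _).bind fun L ph' w2 hx2 hi2 h => ?_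
    obtain ⟨rfl, hL, hd⟩ := h
    have href : ∀ a ∈ L.map Prod.snd, w2.Ref t a := by
      intro a ha
      obtain ⟨⟨r, a⟩, hm, rfl⟩ := List.mem_map.1 ha
      have hr := (branch_iff_mem_zip h2 r a).2 (hL.subset hm)
      have hx := hx1.trans hx2
      exact ⟨.inl (hi2.child_pub c _ a (hx.cnode hc) ⟨r, hr⟩ (hx.pub hp)),
        hi2.child_alloc (hx.cnode hc) ⟨r, hr⟩⟩
    refine (safe_resurrectAll _ href).bind fun l ph' w3 hx3 hi3 h => ?_
    obtain ⟨rfl, hl⟩ := h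
    have hx := (hx1.trans hx2).trans hx3
    have hc3 := hx.cnode hc
    have hd3 := fun x hx hx' => hx3.null (hd x hx hx')
    obtain ⟨e1, e2, e3⟩ := Compression.of_filtered hi3 hc3 hL hd3 hl
    rw [← hx.pre hc]
    split_ifs with hpos
    · exact .alloc_compressed e1 e2 e3 fun w4 b _ _ h4 =>
        .ret fun w5 hr5 _ => ⟨rfl, h4.ext hr5.toExt⟩
    · refine .ret fun w4 hr4 hi4 => ⟨rfl, .of_empty hi4 (hr4.cnode hc3) (fun x hx => ?_) _⟩
      refine hr4.null (hd3 x hx ?_)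
      have : L.length = 0 := by
        rw [← bitcount_bitmapOf ((sorted_zip_bitIndices h2).pairwise.sublist (hL.map _)).sortedLT]
        omega
      simp [List.length_eq_zero_iff.1 this]

/-- The result `some c` stands for a cnode that is left as it is, having more than one proper
branch. -/
theorem safe_toWeakTombed (hw : Inv W hash w) {c bmp : ℕ} {arr : List Addr} (hp : c ∈ w.pub)
    (hc : w.mem.heap c = some (.cnode bmp arr)) :
    Safe W hash t op n (toWeakTombed c bmp arr) ph w fun m' ph' w' => ph' = ph ∧
      (m' = some c ∨ Compression W hash w' t (w.pre c) bmp arr m') := by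
  have h2 := (hw.wf.node c _ hc).2.1
  simp only [toWeakTombed, bind_eq, pure_eq]
  refine (safe_filtered _).bind fun L ph' w2 hx2 hi2 h => ?_
  obtain ⟨rfl, hL, hd⟩ := h
  have hc2 := hx2.cnode hc
  rw [← hx2.pre hc]
  split_ifs with h1 h1'
  · exact .ret fun w' _ _ => ⟨rfl, .inl rfl⟩
  · rw [List.length_map] at h1'
    obtain ⟨⟨r, a⟩, rfl⟩ := List.length_eq_one_iff.1 h1'
    refine .fetch fun a' ha' => ?_
    simp only [List.map_cons, List.map_nil, List.getElem?_cons_zero, Option.some.injEq] at ha'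
    subst ha'
    have hm := hL.subset (List.mem_singleton_self (r, a))
    refine (safe_isSingleton a).bind fun b ph' w3 hx3 hi3 h => ?_
    obtain ⟨rfl, hb⟩ := h
    split_ifs with hb'
    · obtain ⟨k, hk⟩ := hb hb'
      refine (safe_tombed hk).bind fun b ph' w4 hx4 hi4 h => ?_
      obtain ⟨rfl, hkn, v, hv⟩ := h
      refine .ret fun w5 hr5 hi5 => ⟨rfl, .inr ?_⟩
      have hx := hx4.trans hr5.toExt
      have hc5 := (hx3.trans hx).cnode hc2
      rw [← (hx3.trans hx).pre hc2]
      refine .of_single hi5 hc5 hm (hk.ext hx) (hr5.snode hv) (hr5.knows hv hkn) fun x hx' hne => ?_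
      exact (hx3.trans hx).null (hd x hx' (by simpa using hne))
    · have hr := (branch_iff_mem_zip h2 r a).2 hm
      have href : w3.Ref t a := ⟨.inl (hi3.child_pub c _ a (hx3.cnode hc2) ⟨r, hr⟩
        ((hx2.trans hx3).pub hp)), hi3.child_alloc (hx3.cnode hc2) ⟨r, hr⟩⟩
      obtain ⟨e1, e2, e3⟩ := Compression.of_filtered (t := t) (l := [a]) hi3 (hx3.cnode hc2) hL
        (fun x hx hx' => hx3.null (hd x hx hx')) (.cons ⟨href, .inl rfl⟩ .nil)
      rw [← hx3.pre hc2]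
      exact .alloc_compressed e1 e2 e3 fun w4 b _ _ h4 =>
        .ret fun w5 hr5 _ => ⟨rfl, .inr (h4.ext hr5.toExt)⟩
  · refine .ret fun w4 hr4 hi4 => ⟨rfl, .inr (.of_empty hi4 (hr4.cnode hc2) (fun x hx => ?_) _)⟩
    refine hr4.null (hd x hx ?_)
    rw [List.length_map] at h1 h1'
    have : L.length = 0 := by omega
    simp [List.length_eq_zero_iff.1 this]

theorem safe_clean {i : Addr} (hi : w.PubInode i) :
    Safe W hash t op n (body W hash (.clean i)) ph w fun _ ph' _ => ph' = ph := by
  simp only [body, cleanBody, bind_eq, pure_eq, rd, Ctrie.load, Ctrie.cas, Prog.bind]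
  refine .read fun w1 m hr1 hi1 hm => ?_
  have hp1 := hi.ext hr1.toExt
  cases m with
  | none => exact .ret fun _ _ _ => rfl
  | some c =>
    rcases hi1.main_cases hm with ⟨bmp, arr, hc, hpre⟩ | ⟨k, v, hs, -⟩
    · refine .load_cnode hc ?_
      refine (safe_toCompressed hi1 (hi1.child_pub i _ c hm rfl hp1.1) hc).bind
        fun m' ph' w2 hx2 hi2 h => ?_
      obtain ⟨rfl, h⟩ := h
      rw [hpre, ← hx2.pre hm] at h
      exact .cas_compression h (hp1.ext hx2).1 (hp1.ext hx2).2 (hx2.cnode hc)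
        (fun _ _ _ => .ret fun _ _ _ => rfl) (.ret fun _ _ _ => rfl)
    · exact .load_snode hs (.ret fun _ _ _ => rfl)

theorem safe_tombCompress {i : Addr} (hi : w.PubInode i) :
    Safe W hash t op n (body W hash (.tombCompress i)) ph w fun _ ph' _ => ph' = ph := by
  induction n using Nat.strong_induction_on generalizing w with
  | _ n ih =>
  simp only [body, tombCompressBody, bind_eq, pure_eq, rd, Ctrie.load, Ctrie.cas, Ctrie.call,
    Prog.bind]
  refine .read fun w1 m hr1 hi1 hm => ?_
  have hp1 := hi.ext hr1.toExt
  cases m with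
  | none => exact .ret fun _ _ _ => rfl
  | some c =>
    rcases hi1.main_cases hm with ⟨bmp, arr, hc, hpre⟩ | ⟨k, v, hs, -⟩
    · refine .load_cnode hc ?_
      refine (safe_toWeakTombed hi1 (hi1.child_pub i _ c hm rfl hp1.1) hc).bind
        fun m' ph' w2 hx2 hi2 h => ?_
      obtain ⟨rfl, h⟩ := h
      split_ifs with e
      · exact .ret fun _ _ _ => rfl
      · have h := h.resolve_left (Ne.symm e)
        rw [hpre, ← hx2.pre hm] at h
        refine .cas_compression h (hp1.ext hx2).1 (hp1.ext hx2).2 (hx2.cnode hc)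
          (fun w3 _ _ => ?_) ?_
        · simp only [if_true]
          cases m' with
          | none => exact .ret fun _ _ _ => rfl
          | some b =>
            refine .load fun w4 nd _ _ _ => ?_
            split <;> exact .ret fun _ _ _ => rfl
        · refine .call (fun m hm w' hr _ => ih m hm (hp1.ext (hx2.trans hr.toExt)))
            fun _ ph' w' _ _ h => .ret fun _ _ _ => h
    · exact .load_snode hs (.ret fun _ _ _ => rfl)

end

/-! ### Updates of a cnode -/

section

variable {W : ℕ} {hash : K → ℕ} {w : World K V T} {t : T}

theorem nodeOk_insertIdx {q : List ℕ} {bmp r x : ℕ} {arr : List Addr}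
    (h : NodeOk W hash w.mem w.pre q (.cnode bmp arr)) (hr : ¬ Flagged bmp r) (hlt : r < 2 ^ W)
    (hx : BranchOk W hash w.mem w.pre (q ++ [r]) x) :
    NodeOk W hash w.mem w.pre q (.cnode (bmp ||| flag r) (arr.insertIdx (pos bmp r) x)) := by
  refine ⟨fun j hj => ?_, ?_, fun j b hb => ?_⟩
  · rcases flagged_or_flag.1 hj with rfl | hj
    · exact hlt
    · exact h.1 j hj
  · have hle : pos bmp r ≤ arr.length := by
      rw [← h.2.1, pos_eq_card, bitcount_eq_card bmp.bitIndices.toFinset (by simp)]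
      exact Finset.card_le_card fun j => by simp
    rw [bitcount_or_flag hr, h.2.1, List.length_insertIdx_of_le_length hle]
  · rw [branch_insertIdx h.2.1 hr] at hb
    split_ifs at hb with e
    · cases hb; subst e; exact hx
    · exact h.2.2 j b hb

theorem nodeOk_set {q : List ℕ} {bmp r x : ℕ} {arr : List Addr}
    (h : NodeOk W hash w.mem w.pre q (.cnode bmp arr)) (hr : Flagged bmp r)
    (hx : BranchOk W hash w.mem w.pre (q ++ [r]) x) :
    NodeOk W hash w.mem w.pre q (.cnode bmp (arr.set (pos bmp r) x)) := by
  refine ⟨h.1, by rw [List.length_set, h.2.1], fun j b hb => ?_⟩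
  rw [branch_set h.2.1 hr] at hb
  split_ifs at hb with e
  · cases hb; subst e; exact hx
  · exact h.2.2 j b hb

theorem nodeOk_eraseIdx {q : List ℕ} {bmp r : ℕ} {arr : List Addr}
    (h : NodeOk W hash w.mem w.pre q (.cnode bmp arr)) (hr : Flagged bmp r) :
    NodeOk W hash w.mem w.pre q (.cnode (bmp ^^^ flag r) (arr.eraseIdx (pos bmp r))) := by
  refine ⟨fun j hj => h.1 j ((flagged_xor_flag hr).1 hj).2, ?_, fun j b hb => ?_⟩
  · rw [bitcount_xor_flag hr, h.2.1, List.length_eraseIdx_of_lt (h.2.1 ▸ pos_lt_bitcount hr)]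
  · rw [branch_eraseIdx hr] at hb
    split_ifs at hb with e
    exact h.2.2 j b hb

theorem nodeOk_flag {q : List ℕ} {r x : ℕ} (hlt : r < 2 ^ W)
    (hx : BranchOk W hash w.mem w.pre (q ++ [r]) x) :
    NodeOk W hash w.mem w.pre q (.cnode (flag r) [x]) := by
  refine ⟨fun j hj => ?_, bitcount_flag r, fun j b hb => ?_⟩
  · rw [flagged_flag.1 hj]; exact hlt
  · rw [branch_flag] at hb
    split_ifs at hb with e
    cases hb; subst e; exact hx

theorem Inv.knows_branch (hw : Inv W hash w) {c bmp r b : ℕ} {arr : List Addr} (hp : c ∈ w.pub)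
    (hc : w.mem.heap c = some (.cnode bmp arr)) (hb : branch bmp arr r = some b) : b ∈ w.pub :=
  hw.child_pub c _ b hc ⟨r, hb⟩ hp

/-- If branch `r` is replaced by `x`, and no inode is lost thereby, the inodes that hold a cnode are
kept. -/
theorem keepsLive_update {bmp r c' bmp' : ℕ} {arr arr' : List Addr} {x : Option Addr}
    (hc' : w.mem.heap c' = some (.cnode bmp' arr'))
    (hbr : ∀ j, branch bmp' arr' j = if j = r then x else branch bmp arr j)
    (hr : ∀ b m, branch bmp arr r = some b → w.mem.heap b ≠ some (.inode m)) :
    KeepsLive w bmp arr (some c') := by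
  intro r' j d bmp₁ arr₁ hj hd _
  refine ⟨c', bmp', arr', rfl, hc', ?_⟩
  rw [hbr, if_neg, hj]
  rintro rfl
  exact hr j _ hj hd

/-- The keys of a cnode whose branch `r` has been replaced. -/
theorem hasMain_update {c bmp r c' bmp' l : ℕ} {arr arr' : List Addr} {x : Option Addr}
    (hc : w.mem.heap c = some (.cnode bmp arr))
    (hc' : w.mem.heap c' = some (.cnode bmp' arr'))
    (hbr : ∀ j, branch bmp' arr' j = if j = r then x else branch bmp arr j) {k : K} :
    HasMain W hash w.mem k l (some c') ↔
      if chunk W l (hash k) = r then ∃ b, x = some b ∧ HasBelow W hash w.mem k (l + W) b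
      else HasMain W hash w.mem k l (some c) := by
  rw [hasMain_cnode hc', hasMain_cnode hc, hbr]
  split_ifs <;> rfl

/-- If the branch of `k` is replaced by `x`, which adds the key `k` to this branch, then `k` is
added to the cnode. -/
theorem hasMain_insert {c bmp r c' bmp' l x : ℕ} {arr arr' : List Addr}
    (hc : w.mem.heap c = some (.cnode bmp arr))
    (hc' : w.mem.heap c' = some (.cnode bmp' arr'))
    (hbr : ∀ j, branch bmp' arr' j = if j = r then some x else branch bmp arr j) {k : K}
    (hk : r = chunk W l (hash k))
    (hx : ∀ k', HasBelow W hash w.mem k' (l + W) x ↔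
      (∃ b, branch bmp arr r = some b ∧ HasBelow W hash w.mem k' (l + W) b) ∨ k' = k) (k' : K) :
    HasMain W hash w.mem k' l (some c') ↔ HasMain W hash w.mem k' l (some c) ∨ k' = k := by
  rw [hasMain_update hc hc' hbr]
  split_ifs with h
  · simp only [Option.some.injEq, exists_eq_left', hx, hasMain_cnode hc, h]
  · have : k' ≠ k := by rintro rfl; exact h hk.symm
    simp [this]

/-- Thread `t` knows a cnode with prefix `q` at address `c` that holds exactly the keys `kx` and
`ky`, in all worlds that `t` may rely on. -/
structure IsPair (W : ℕ) (hash : K → ℕ) (w : World K V T) (t : T) (q : List ℕ) (kx ky : K)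
    (c : Addr) : Prop where
  cnode : ∃ bmp arr, w.mem.heap c = some (.cnode bmp arr)
  pre : w.pre c = q
  knows : w.Knows t c
  keys : ∀ w', Rely t w w' → ∀ k,
    HasMain W hash w'.mem k (W * q.length) (some c) ↔ k = kx ∨ k = ky

theorem IsPair.rely {q : List ℕ} {kx ky : K} {c : Addr} (h : IsPair W hash w t q kx ky c)
    {w' : World K V T} (hr : Rely t w w') : IsPair W hash w' t q kx ky c := by
  obtain ⟨⟨bmp, arr, hc⟩, h2, h3, h4⟩ := h
  exact ⟨⟨bmp, arr, hr.cnode hc⟩, (hr.pre hc).trans h2, hr.knows hc h3,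
    fun w'' hr' => h4 w'' (hr.trans hr')⟩

end

/-! ### Effects -/

section

variable {W : ℕ} {hash : K → ℕ} {w : World K V T} {t : T} {i c bmp : ℕ} {arr : List Addr}
  {m' : Option Addr}

open Classical in
/-- Adding `k` below an inode on its path makes `insert` take effect. -/
theorem CanSet.effect_insert (h : CanSet W hash w t i c bmp arr m') (hw : Inv W hash w) {k : K}
    {v : V} (hk : IsHashPrefix W (hash k) (w.pre i))
    (H : ∀ k', HasMain W hash w.mem k' (W * (w.pre i).length) m' ↔
      HasMain W hash w.mem k' (W * (w.pre i).length) (some c) ∨ k' = k) :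
    Effect (.insert k v) none (absSet W hash w.mem) (absSet W hash (w.mem.setMain i m'))
      (some (decide (k ∈ absSet W hash w.mem))) := by
  refine .inr ⟨rfl, _, rfl, ?_, by simp [Op.key]⟩
  ext k'
  by_cases e : k' = k
  · subst e
    rw [h.mem_absSet_of_prefix hw hk, H]
    simp [Op.apply]
  · rw [h.mem_absSet_iff hw]
    · simp [Op.apply, e]
    · simp [H, e]

/-- Removing `k` from below an inode on its path makes `remove` take effect. -/
theorem CanSet.effect_remove (h : CanSet W hash w t i c bmp arr m') (hw : Inv W hash w) {k : K}
    (hk : IsHashPrefix W (hash k) (w.pre i))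
    (hin : HasMain W hash w.mem k (W * (w.pre i).length) (some c))
    (H : ∀ k', HasMain W hash w.mem k' (W * (w.pre i).length) m' ↔
      HasMain W hash w.mem k' (W * (w.pre i).length) (some c) ∧ k' ≠ k) :
    Effect (.remove k : Op K V) none (absSet W hash w.mem) (absSet W hash (w.mem.setMain i m'))
      (some true) := by
  refine .inr ⟨rfl, _, rfl, ?_, ?_⟩
  · ext k'
    by_cases e : k' = k
    · subst e
      rw [h.mem_absSet_of_prefix hw hk, H]
      simp [Op.apply]
    · rw [h.mem_absSet_iff hw]
      · simp [Op.apply, e]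
      · simp [H, e]
  · simp only [Op.key, true_iff]
    exact (hw.hasMain_iff_mem h.pub h.main h.cnode hk).1 hin

/-- A step that only reads is the one in which an operation takes effect that does not change the
abstract set. -/
theorem effect_read {op : Op K V} {A : Set K} (b : Bool) (ha : op.apply A = A)
    (hb : b = true ↔ op.key ∈ A) : Effect op none A A (some b) :=
  .inr ⟨rfl, b, rfl, ha.symm, hb⟩

end

section

variable [DecidableEq K] {W : ℕ} {hash : K → ℕ} {t : T} {op : Op K V} {α β : Type} {n : ℕ}
  {ph : Option Bool} {w : World K V T} {Q : α → Option Bool → World K V T → Prop}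

/-! ### Contraction and construction -/

/-- Contraction replaces a branch that is a null-inode or a tomb-inode, and these do not change: it
is a compression of the parent. -/
theorem safe_contractParent {p i : Addr} {k : K} {lev : ℕ} (hp : w.PubInode p)
    (hi : w.PubInode i) :
    Safe W hash t op n (body W hash (.contractParent p i k lev)) ph w fun _ ph' _ => ph' = ph := by
  induction n using Nat.strong_induction_on generalizing w with
  | _ n ih =>
  simp only [body, contractParentBody, bind_eq, pure_eq, rd, Ctrie.load, Ctrie.cas, Ctrie.call,
    Ctrie.alloc, Prog.bind]
  refine .read fun w1 m hr1 hi1 hm => .read fun w2 c hr2 hi2 hm2 => ?_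
  have hp2 := hp.ext (hr1.trans hr2).toExt
  have retry {w' : World K V T} (hx : Ext w2 w') :
      Safe W hash t op n (.call (.contractParent p i k lev) .ret) ph w' fun _ ph' _ => ph' = ph :=
    .call (fun m hm w3 hr3 _ => ih m hm ((hp2.ext hx).ext hr3.toExt)
      (hi.ext (((hr1.trans hr2).toExt.trans hx).trans hr3.toExt)))
      fun _ ph' w' _ _ h => .ret fun _ _ _ => h
  cases c with
  | none => exact .ret fun _ _ _ => rfl
  | some c =>
  rcases hi2.main_cases hm2 with ⟨bmp, arr, hc, hpre⟩ | ⟨k, v, hs, -⟩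
  swap
  · exact .load_snode hs (.ret fun _ _ _ => rfl)
  refine .load_cnode hc ?_
  have hok := hi2.wf.node c _ hc
  have hcp := hi2.child_pub p _ c hm2 rfl hp2.1
  dsimp only
  split_ifs with hf
  · exact .ret fun _ _ _ => rfl
  refine .fetch fun a ha => ?_
  rw [← branch_of_flagged hf] at ha
  split_ifs with hai
  · exact .ret fun _ _ _ => rfl
  · rw [not_not] at hai
    subst hai
    cases m with
    | none =>
      have hnull := hr2.null hm
      refine .alloc_compressed (c := c) (bmp := bmp) (arr := arr) (nodeOk_eraseIdx hok hf) ?_ ?_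
        fun w3 b hx3 hi3 hcomp => ?_
      · rintro b ⟨j, hj⟩
        rw [branch_eraseIdx hf] at hj
        split_ifs at hj with e
        exact .inl (hi2.knows_branch hcp hc hj)
      · intro j
        rw [branch_eraseIdx hf]
        split_ifs with e
        · subst e
          refine .inr ⟨rfl, fun a' ha' => ?_⟩
          rw [ha] at ha'; cases ha'; exact hnull
        · cases hb : branch bmp arr j with
          | none => exact .inr ⟨rfl, by simp⟩
          | some b => exact .inl ⟨b, b, rfl, rfl, .inl rfl⟩
      · rw [hpre, ← hx3.pre hm2] at hcomp
        refine .cas_compression hcomp (hp2.ext hx3).1 (hp2.ext hx3).2 (hx3.cnode hc)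
          (fun _ _ _ => .ret fun _ _ _ => rfl) (retry hx3)
    | some s =>
      rcases hi1.main_cases hm with ⟨_, _, hs, -⟩ | ⟨k', v', hs, -⟩
      · exact .load_cnode (hr2.cnode hs) (.ret fun _ _ _ => rfl)
      have hm' := hr2.holds hm hs
      refine .load_snode (hr2.snode hs) ?_
      refine .alloc [] trivial (fun _ => False.elim) fun w3 u hr3 hi3 hu _ ho _ => ?_
      have hres : Resurrected w3 a u :=
        .inr ⟨s, k', v', true, hr3.holds hm' (hr2.snode hs), hr3.snode (hr2.snode hs), hu⟩
      have hok3 := hok.ext hr3.toExt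
      rw [← hr3.pre hc] at hok3
      refine .alloc_compressed (c := c) (bmp := bmp) (arr := arr)
        (nodeOk_set hok3 hf (hres.branchOk hi3 (hok3.2.2 _ _ ha))) ?_ ?_
        fun w4 b hx4 hi4 hcomp => ?_
      · rintro b ⟨j, hj⟩
        rw [branch_set hok.2.1 hf] at hj
        split_ifs at hj with e
        · cases hj; exact .inr ho
        · exact .inl (hi3.knows_branch (hr3.pub hcp) (hr3.cnode hc) hj)
      · intro j
        rw [branch_set hok.2.1 hf]
        split_ifs with e
        · subst e; exact .inl ⟨a, u, ha, rfl, hres⟩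
        · cases hb : branch bmp arr j with
          | none => exact .inr ⟨rfl, by simp⟩
          | some b => exact .inl ⟨b, b, rfl, rfl, .inl rfl⟩
      · have hx := hr3.toExt.trans hx4
        rw [hr3.pre hc, hpre, ← hx.pre hm2] at hcomp
        refine .cas_compression hcomp (hp2.ext hx).1 (hp2.ext hx).2 (hx.cnode hc)
          (fun _ _ _ => .ret fun _ _ _ => rfl) (retry hx)

/-- The procedure need not return, but if it does, it has built a cnode with the two keys. -/
theorem safe_newPair {x y : Addr} {kx ky : K} {vx vy : V} {lev : ℕ} {q : List ℕ}
    (hx : w.mem.heap x = some (.snode kx vx false)) (hxk : w.Knows t x)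
    (hy : w.mem.heap y = some (.snode ky vy false)) (hyk : w.Knows t y)
    (hqx : IsHashPrefix W (hash kx) q) (hqy : IsHashPrefix W (hash ky) q)
    (hlev : lev = W * q.length) :
    Safe W hash t op n (body W hash (.newPair x kx y ky lev)) ph w fun c ph' w' => ph' = ph ∧
      Rely t w w' ∧ IsPair W hash w' t q kx ky c := by
  induction n using Nat.strong_induction_on generalizing w lev q with
  | _ n ih =>
  simp only [body, newPairBody, bind_eq, Ctrie.call, Ctrie.alloc, Prog.bind]
  subst hlev
  have hpx : IsHashPrefix W (hash kx) (q ++ [chunk W (W * q.length) (hash kx)]) :=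
    isHashPrefix_append.2 ⟨hqx, rfl⟩
  have hpy : IsHashPrefix W (hash ky) (q ++ [chunk W (W * q.length) (hash ky)]) :=
    isHashPrefix_append.2 ⟨hqy, rfl⟩
  by_cases e : chunk W (W * q.length) (hash kx) = chunk W (W * q.length) (hash ky)
  · rw [if_pos e]
    rw [← e] at hpy
    refine .call (Q₁ := fun c ph' w' => ph' = ph ∧ Rely t w w' ∧
        IsPair W hash w' t (q ++ [chunk W (W * q.length) (hash kx)]) kx ky c)
      (fun m hm w1 hr1 hi1 => ?_) fun c ph' w1 _ hi1 h => ?_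
    · refine (ih m hm (hr1.snode hx) (hr1.knows hx hxk) (hr1.snode hy) (hr1.knows hy hyk) hpx hpy
        ?_).conseq fun c ph' w2 _ _ h => ⟨h.1, hr1.trans h.2.1, h.2.2⟩
      simp [Nat.mul_add]
    · obtain ⟨rfl, hr1, hpair⟩ := h
      obtain ⟨bmp, arr, hc⟩ := hpair.cnode
      refine .alloc (q ++ [chunk W (W * q.length) (hash kx)]) ?_ ?_
        fun w2 i hr2 hi2 hi hpi hoi hni => ?_
      · rintro _ ⟨⟩; exact .inl ⟨bmp, arr, hc, hpair.pre⟩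
      · rintro _ ⟨⟩; exact hpair.knows
      refine .alloc q (nodeOk_flag (chunk_lt _ _ _) (.inl ⟨_, hi, hpi⟩)) ?_
        fun w3 c' hr3 hi3 hc' hpc hoc _ => ?_
      · rintro b ⟨j, hj⟩
        rw [branch_flag] at hj
        split_ifs at hj
        cases hj; exact .inr hoi
      refine .ret fun w4 hr4 hi4 => ⟨rfl, ((hr1.trans hr2).trans hr3).trans hr4, .rely ?_ hr4⟩
      refine ⟨⟨_, _, hc'⟩, hpc, .inr hoc, fun w5 hr5 k => ?_⟩
      -- The new inode is mutable, but as it is not published, no other thread changes it.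
      have hi5 := ((hr3.trans hr5).priv i _ hni hoi hi).2
      rw [hasMain_cnode (hr5.cnode hc'), branch_flag]
      have hkeys := hpair.keys w5 ((hr2.trans hr3).trans hr5) k
      rw [List.length_append, List.length_singleton, Nat.mul_add, Nat.mul_one] at hkeys
      constructor
      · rintro ⟨b, hb, hk⟩
        split_ifs at hb
        cases hb
        rwa [hasBelow_inode hi5, hkeys] at hk
      · intro hk
        refine ⟨i, ?_, by rwa [hasBelow_inode hi5, hkeys]⟩
        rcases hk with rfl | rfl
        · simp
        · simp [e]
  · rw [if_neg e]
    have hok : NodeOk W hash w.mem w.pre q (.cnode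
        (flag (chunk W (W * q.length) (hash kx)) ||| flag (chunk W (W * q.length) (hash ky)))
        (if chunk W (W * q.length) (hash kx) < chunk W (W * q.length) (hash ky) then [x, y]
          else [y, x])) := by
      rw [pair_eq_insertIdx]
      exact nodeOk_insertIdx (nodeOk_flag (chunk_lt _ _ _) (.inr ⟨kx, vx, hx, hpx⟩))
        (fun h => e (flagged_flag.1 h).symm) (chunk_lt _ _ _) (.inr ⟨ky, vy, hy, hpy⟩)
    refine .alloc q hok ?_ fun w1 c hr1 hi1 hc hpc hoc _ => ?_
    · rintro b ⟨j, hj⟩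
      rw [branch_pair _ _ e] at hj
      split_ifs at hj
      · cases hj; exact hyk
      · cases hj; exact hxk
    refine .ret fun w2 hr2 hi2 => ⟨rfl, hr1.trans hr2, .rely ?_ hr2⟩
    refine ⟨⟨_, _, hc⟩, hpc, .inr hoc, fun w5 hr5 k => ?_⟩
    have hx5 := (hr1.trans hr5).snode hx
    have hy5 := (hr1.trans hr5).snode hy
    rw [hasMain_cnode (hr5.cnode hc), branch_pair _ _ e]
    constructor
    · rintro ⟨b, hb, hk⟩
      split_ifs at hb
      · cases hb; exact .inr ((hasBelow_snode hy5).1 hk).symm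
      · cases hb; exact .inl ((hasBelow_snode hx5).1 hk).symm
    · rintro (rfl | rfl)
      · exact ⟨x, by simp [e], (hasBelow_snode hx5).2 rfl⟩
      · exact ⟨y, by simp, (hasBelow_snode hy5).2 rfl⟩

end

/-! ### Traversal of the path of a key -/

/-- The inode `i` has been published, it is on the path of the key `k`, and its level is `lev`. -/
structure OnPath (W : ℕ) (hash : K → ℕ) (w : World K V T) (k : K) (i : Addr) (lev : ℕ) : Prop where
  pub : w.PubInode i
  isHashPrefix : IsHashPrefix W (hash k) (w.pre i)
  level : lev = W * (w.pre i).length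

/-- The status of the operation that belongs to the result of `ilookup` or `iremove`. -/
def Res.status : Res V → Option Bool
  | .found _ => some true
  | .notFound => some false
  | .restart => none

section

variable {W : ℕ} {hash : K → ℕ} {w : World K V T} {k : K} {i lev : ℕ}

theorem OnPath.ext {w' : World K V T} (h : OnPath W hash w k i lev) (hx : Ext w w') :
    OnPath W hash w' k i lev := by
  have e := hx.pre h.pub.2.choose_spec
  exact ⟨h.pub.ext hx, e ▸ h.isHashPrefix, e ▸ h.level⟩

variable {c bmp : ℕ} {arr : List Addr}

theorem OnPath.child (h : OnPath W hash w k i lev) (hw : Inv W hash w)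
    (hm : w.mem.heap i = some (.inode (some c))) (hc : w.mem.heap c = some (.cnode bmp arr))
    (hp : w.pre c = w.pre i) {a : Addr} (ha : branch bmp arr (chunk W lev (hash k)) = some a)
    (hI : ∃ m, w.mem.heap a = some (.inode m)) : OnPath W hash w k a (lev + W) := by
  obtain ⟨m, hI⟩ := hI
  have hcp := hw.child_pub i _ c hm rfl h.pub.1
  rcases (hw.wf.node c _ hc).2.2 _ _ ha with ⟨_, _, e⟩ | ⟨_, _, e, _⟩
  · refine ⟨⟨hw.knows_branch hcp hc ha, m, hI⟩, ?_, ?_⟩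
    · rw [e, hp, isHashPrefix_append, ← h.level]
      exact ⟨h.isHashPrefix, rfl⟩
    · rw [e, hp, List.length_append, List.length_singleton, Nat.mul_add, ← h.level, Nat.mul_one]
  · rw [hI] at e; cases e

/-- At an inode on the path of `k` that holds a cnode, the branch of `k` decides the membership. -/
theorem OnPath.mem_iff (h : OnPath W hash w k i lev) (hw : Inv W hash w)
    (hm : w.mem.heap i = some (.inode (some c))) (hc : w.mem.heap c = some (.cnode bmp arr)) :
    k ∈ absSet W hash w.mem ↔ ∃ b, branch bmp arr (chunk W lev (hash k)) = some b ∧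
      HasBelow W hash w.mem k (lev + W) b := by
  rw [← hw.hasMain_iff_mem h.pub.1 hm hc h.isHashPrefix, hasMain_cnode hc, ← h.level]

end

section

variable [DecidableEq K] {W : ℕ} {hash : K → ℕ} {t : T} {op : Op K V} {n : ℕ}
  {ph : Option Bool} {w : World K V T}

theorem safe_cleanParent {parent : Option Addr} (hp : ∀ p, parent = some p → w.PubInode p) :
    Safe W hash t op n (cleanParent parent) ph w fun _ ph' _ => ph' = ph := by
  cases parent with
  | none => exact .ret fun _ _ _ => rfl
  | some p =>
    exact .call (f := .ret) (fun m _ w' hr _ => safe_clean ((hp p rfl).ext hr.toExt))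
      fun _ ph' w' _ _ h => .ret fun _ _ _ => h

/-- The step that reads the `main` of the inode is the one in which `lookup` takes effect, unless
the search continues below or has to be restarted. -/
theorem safe_ilookup {i : Addr} {k : K} {lev : ℕ} {parent : Option Addr}
    (hi : OnPath W hash w k i lev) (hp : ∀ p, parent = some p → w.PubInode p) :
    Safe W hash t (.lookup k : Op K V) n (body W hash (.ilookup i k lev parent)) none w
      fun r ph' _ => ph' = r.status := by
  induction n using Nat.strong_induction_on generalizing w i lev parent with
  | _ n ih =>
  simp only [body, ilookupBody, bind_eq, pure_eq, rd, Ctrie.load, Ctrie.call, Prog.bind]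
  refine .read_effect fun w1 m hr1 hi1 hm => ?_
  have hp1 := hi.ext hr1.toExt
  have clean : Safe W hash t (.lookup k : Op K V) n
      ((cleanParent parent).bind fun _ => .ret (.restart : Res V)) none w1
        fun r ph' _ => ph' = r.status :=
    (safe_cleanParent fun p hq => (hp p hq).ext hr1.toExt).bind
      fun _ ph' w' _ _ h => .ret fun _ _ _ => h
  cases m with
  | none => exact ⟨none, .inl ⟨rfl, rfl⟩, clean⟩
  | some c =>
  rcases hi1.main_cases hm with ⟨bmp, arr, hc, hpre⟩ | ⟨k', v, hs, -⟩
  swap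
  · exact ⟨none, .inl ⟨rfl, rfl⟩, .load_snode hs clean⟩
  have hmem := hp1.mem_iff hi1 hm hc
  by_cases hf : Flagged bmp (chunk W lev (hash k))
  swap
  · refine ⟨some false, effect_read false rfl ?_, .load_cnode hc ?_⟩
    · simp [Op.key, hmem, branch_of_not_flagged hf]
    · dsimp only
      rw [if_pos (not_not.1 hf)]
      exact .ret fun _ _ _ => rfl
  have hok := hi1.wf.node c _ hc
  obtain ⟨a, ha⟩ := exists_branch hok.2.1 hf
  have hmem' : k ∈ absSet W hash w1.mem ↔ HasBelow W hash w1.mem k (lev + W) a := by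
    simp [hmem, ha]
  rcases hok.2.2 _ _ ha with ⟨m, hI, -⟩ | ⟨k', v', hs, -⟩
  · refine ⟨none, .inl ⟨rfl, rfl⟩, .load_cnode hc ?_⟩
    dsimp only
    rw [if_neg hf]
    refine .fetch fun a' ha' => ?_
    rw [← branch_of_flagged hf, ha] at ha'; cases ha'
    refine .load_inode ⟨m, hI⟩ fun _ => .call (fun m' hm' w2 hr2 _ => ih m' hm'
      ((hp1.child hi1 hm hc hpre ha ⟨m, hI⟩).ext hr2.toExt) ?_) fun _ ph' w' _ _ h =>
      .ret fun _ _ _ => h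
    rintro _ ⟨⟩
    exact hp1.pub.ext hr2.toExt
  · refine ⟨some (decide (k' = k)), effect_read _ rfl ?_, .load_cnode hc ?_⟩
    · simp [Op.key, hmem', hasBelow_snode hs]
    dsimp only
    rw [if_neg hf]
    refine .fetch fun a' ha' => ?_
    rw [← branch_of_flagged hf, ha] at ha'; cases ha'
    refine .load_snode hs ?_
    dsimp only
    split_ifs with e
    · exact .ret fun _ _ _ => by simp [Res.status, e]
    · exact .ret fun _ _ _ => by simp [Res.status, e]

/-- A CAS that puts `x` on the branch of `k`, where the keys below `x` are those of the old branch
and `k`, makes `insert` take effect. -/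
theorem Safe.cas_insert {i c bmp c' bmp' x lev : ℕ} {k : K} {v : V} {arr arr' : List Addr}
    (hi : OnPath W hash w k i lev) (hc : w.mem.heap c = some (.cnode bmp arr))
    (hc' : w.mem.heap c' = some (.cnode bmp' arr')) (hp : w.pre c' = w.pre i)
    (hk : w.Knows t c')
    (hbr : ∀ j, branch bmp' arr' j = if j = chunk W lev (hash k) then some x else branch bmp arr j)
    (hold : ∀ b, branch bmp arr (chunk W lev (hash k)) = some b →
      ∃ k' v', w.mem.heap b = some (.snode k' v' false))
    (hx : ∀ w', Rely t w w' → ∀ k', HasBelow W hash w'.mem k' (lev + W) x ↔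
      (∃ b, branch bmp arr (chunk W lev (hash k)) = some b ∧
        HasBelow W hash w'.mem k' (lev + W) b) ∨ k' = k) :
    Safe W hash t (.insert k v) n (.cas i (some c) (some c') .ret) none w
      fun b ph' _ => if b = true then ∃ s, ph' = some s else ph' = none := by
  refine .cas (bmp := bmp) (arr := arr) (fun w1 hr1 hi1 hm => ?_)
    (.ret fun _ _ _ => by simp)
  have hp1 := hi.ext hr1.toExt
  have hc1 := hr1.cnode hc
  have hc1' := hr1.cnode hc'
  have hcs : CanSet W hash w1 t i c bmp arr (some c') := by
    refine ⟨hp1.pub.1, hm, hc1, ?_, ?_, keepsLive_update hc1' hbr ?_⟩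
    · rintro _ ⟨⟩
      refine .inl ⟨_, _, hc1', ?_⟩
      rw [hr1.pre hc', hp, hr1.pre hi.pub.2.choose_spec]
    · rintro _ ⟨⟩; exact hr1.knows hc' hk
    · intro b m hb h
      obtain ⟨k', v', h'⟩ := hold b hb
      rw [hr1.snode h'] at h; cases h
  refine ⟨hcs, _, hcs.effect_insert hi1 hp1.isHashPrefix fun k' => ?_,
    fun w2 _ _ => .ret fun _ _ _ => by simp⟩
  rw [← hp1.level]
  exact hasMain_insert hc1 hc1' hbr rfl (hx w1 hr1) k'

/-- `insert` takes effect in its successful CAS. -/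
theorem safe_iinsert {i : Addr} {k : K} {v : V} {lev : ℕ} {parent : Option Addr}
    (hi : OnPath W hash w k i lev) (hp : ∀ p, parent = some p → w.PubInode p) :
    Safe W hash t (.insert k v) n (body W hash (.iinsert i k v lev parent)) none w
      fun b ph' _ => if b = true then ∃ s, ph' = some s else ph' = none := by
  induction n using Nat.strong_induction_on generalizing w i lev parent with
  | _ n ih =>
  simp only [body, iinsertBody, bind_eq, pure_eq, rd, Ctrie.load, Ctrie.cas, Ctrie.call,
    Ctrie.alloc, Prog.bind]
  refine .read fun w1 m hr1 hi1 hm => ?_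
  have hp1 := hi.ext hr1.toExt
  have clean : Safe W hash t (.insert k v) n
      ((cleanParent parent).bind fun _ => .ret false) none w1
      fun b ph' _ => if b = true then ∃ s, ph' = some s else ph' = none :=
    (safe_cleanParent fun p hq => (hp p hq).ext hr1.toExt).bind
      fun _ ph' w' _ _ h => .ret fun _ _ _ => by simpa using h
  cases m with
  | none => exact clean
  | some c =>
  rcases hi1.main_cases hm with ⟨bmp, arr, hc, hpre⟩ | ⟨k', v, hs, -⟩
  swap
  · exact .load_snode hs clean
  refine .load_cnode hc ?_
  dsimp only
  have hcp := hi1.child_pub i _ c hm rfl hp1.pub.1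
  have hok := hi1.wf.node c _ hc
  have hq : IsHashPrefix W (hash k) (w1.pre c ++ [chunk W lev (hash k)]) := by
    rw [hpre, isHashPrefix_append, ← hp1.level]
    exact ⟨hp1.isHashPrefix, rfl⟩
  by_cases hf : Flagged bmp (chunk W lev (hash k))
  swap
  · rw [if_pos (not_not.1 hf)]
    refine .alloc [] trivial (fun _ => False.elim) fun w2 s hr2 hi2 hs _ ho _ => ?_
    refine .alloc (w1.pre c) (nodeOk_insertIdx (hok.ext hr2.toExt) hf (chunk_lt _ _ _)
      (.inr ⟨k, v, hs, hq⟩)) ?_ fun w3 c' hr3 hi3 hc' hpc hoc _ => ?_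
    · rintro b ⟨j, hj⟩
      rw [branch_insertIdx hok.2.1 hf] at hj
      split_ifs at hj with e
      · cases hj; exact .inr ho
      · exact .inl (hr2.pub (hi1.knows_branch hcp hc hj))
    have hr := hr2.trans hr3
    refine .cas_insert (x := s) (hp1.ext hr.toExt) (hr.cnode hc) hc' ?_ (.inr hoc)
      (branch_insertIdx hok.2.1 hf s) ?_ fun w4 hr4 k' => ?_
    · rw [hpc, hpre, hr.pre hm]
    · simp [branch_of_not_flagged hf]
    · rw [hasBelow_snode ((hr3.trans hr4).snode hs)]
      simp [branch_of_not_flagged hf, eq_comm]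
  rw [if_neg hf]
  refine .fetch fun a ha => ?_
  rw [← branch_of_flagged hf] at ha
  rcases hok.2.2 _ _ ha with ⟨m, hI, -⟩ | ⟨k', v', hs, hqa⟩
  · refine .load_inode ⟨m, hI⟩ fun _ => .call (fun m' hm' w2 hr2 _ => ih m' hm'
      ((hp1.child hi1 hm hc hpre ha ⟨m, hI⟩).ext hr2.toExt) ?_) fun _ ph' w' _ _ h =>
      .ret fun _ _ _ => h
    rintro _ ⟨⟩
    exact hp1.pub.ext hr2.toExt
  refine .load_snode hs (.alloc [] trivial (fun _ => False.elim) fun w2 s hr2 hi2 hns _ ho _ => ?_)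
  by_cases e : k' = k
  · rw [if_pos e]
    subst e
    refine .alloc (w1.pre c) (nodeOk_set (hok.ext hr2.toExt) hf (.inr ⟨k', v, hns, hq⟩)) ?_
      fun w3 c' hr3 hi3 hc' hpc hoc _ => ?_
    · rintro b ⟨j, hj⟩
      rw [branch_set hok.2.1 hf] at hj
      split_ifs at hj with e
      · cases hj; exact .inr ho
      · exact .inl (hr2.pub (hi1.knows_branch hcp hc hj))
    have hr := hr2.trans hr3
    refine .cas_insert (x := s) (hp1.ext hr.toExt) (hr.cnode hc) hc' ?_ (.inr hoc)
      (branch_set hok.2.1 hf s) ?_ fun w4 hr4 k'' => ?_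
    · rw [hpc, hpre, hr.pre hm]
    · intro b hb
      rw [ha] at hb; cases hb
      exact ⟨k', v', hr.snode hs⟩
    · simp only [ha, Option.some.injEq, exists_eq_left',
        hasBelow_snode ((hr3.trans hr4).snode hns), hasBelow_snode ((hr.trans hr4).snode hs),
        eq_comm, or_self]
  · rw [if_neg e]
    refine .call (Q₁ := fun p ph' w' => ph' = none ∧ Rely t w2 w' ∧
        IsPair W hash w' t (w1.pre c ++ [chunk W lev (hash k)]) k' k p)
      (fun m hm' w3 hr3 hi3 => ?_) fun p ph' w3 _ hi3 h => ?_
    · refine (safe_newPair ((hr2.trans hr3).snode hs) (.inl ((hr2.trans hr3).pub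
        (hi1.knows_branch hcp hc ha))) (hr3.snode hns) (hr3.knows hns (.inr ho)) hqa hq ?_).conseq
        fun p ph' w' _ _ h => ⟨h.1, hr3.trans h.2.1, h.2.2⟩
      rw [hpre, List.length_append, List.length_singleton, Nat.mul_add, ← hp1.level, Nat.mul_one]
    obtain ⟨rfl, hr3, hpair⟩ := h
    obtain ⟨bmp₂, arr₂, hpc⟩ := hpair.cnode
    refine .alloc (w1.pre c ++ [chunk W lev (hash k)]) ?_ ?_
      fun w4 j hr4 hi4 hj hpj hoj hnj => ?_
    · rintro _ ⟨⟩; exact .inl ⟨_, _, hpc, hpair.pre⟩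
    · rintro _ ⟨⟩; exact hpair.knows
    have hr14 := (hr2.trans hr3).trans hr4
    refine .alloc (w1.pre c) (nodeOk_set (hok.ext hr14.toExt) hf (.inl ⟨_, hj, hpj⟩)) ?_
      fun w5 c' hr5 hi5 hc' hpc hoc _ => ?_
    · rintro b ⟨j', hj'⟩
      rw [branch_set hok.2.1 hf] at hj'
      split_ifs at hj' with e
      · cases hj'; exact .inr hoj
      · exact .inl (hr14.pub (hi1.knows_branch hcp hc hj'))
    have hr := hr14.trans hr5
    refine .cas_insert (x := j) (hp1.ext hr.toExt) (hr.cnode hc) hc' ?_ (.inr hoc)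
      (branch_set hok.2.1 hf j) ?_ fun w6 hr6 k'' => ?_
    · rw [hpc, hpre, hr.pre hm]
    · intro b hb
      rw [ha] at hb; cases hb
      exact ⟨k', v', hr.snode hs⟩
    · -- Until the CAS, the new inode is known to this thread only.
      have hj6 := ((hr5.trans hr6).priv j _ hnj hoj hj).2
      have hkeys := hpair.keys w6 ((hr4.trans hr5).trans hr6) k''
      rw [hpre, List.length_append, List.length_singleton, Nat.mul_add, ← hp1.level,
        Nat.mul_one] at hkeys
      simp only [ha, Option.some.injEq, exists_eq_left', hasBelow_inode hj6, hkeys,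
        hasBelow_snode ((hr.trans hr6).snode hs)]
      rw [eq_comm (a := k')]

end

theorem Inv.onPath_root {W : ℕ} {hash : K → ℕ} {w : World K V T} (hw : Inv W hash w) (k : K)
    {i : Addr} (hi : w.mem.root = some i) : OnPath W hash w k i 0 := by
  obtain ⟨h1, h2⟩ := hw.wf.root i hi
  exact ⟨⟨hw.root_pub i hi, h2⟩, h1 ▸ isHashPrefix_nil _ _, by rw [h1]; rfl⟩

section

variable [DecidableEq K] {W : ℕ} {hash : K → ℕ} {t : T} {op : Op K V} {n : ℕ}
  {ph : Option Bool} {w : World K V T}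

/-- The contraction that follows a successful removal. -/
theorem safe_contract {i : Addr} {k : K} {lev : ℕ} {parent : Option Addr} {res : Res V}
    (hi : w.PubInode i) (hp : ∀ p, parent = some p → w.PubInode p) (hres : ph = res.status) :
    Safe W hash t op n (match res, parent with
      | .found v', some p => .call (.tombCompress i) fun b =>
          if b = true then
            .call (.contractParent p i k lev) fun _ => .ret (.found v')
          else .ret (.found v')
      | _, _ => .ret res) ph w fun r ph' _ => ph' = r.status := by
  cases res with
  | found v =>
    cases parent with
    | none => exact .ret fun _ _ _ => hres
    | some p =>
      refine .call (fun m _ w1 hr1 _ => safe_tombCompress (hi.ext hr1.toExt))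
        fun b ph' w1 hx1 _ h => ?_
      subst h
      split_ifs
      · exact .call (fun m _ w2 hr2 _ => safe_contractParent
          ((hp p rfl).ext (hx1.trans hr2.toExt)) (hi.ext (hx1.trans hr2.toExt)))
          fun _ ph' w2 _ _ h => .ret fun _ _ _ => h.trans hres
      · exact .ret fun _ _ _ => hres
  | notFound => exact .ret fun _ _ _ => hres
  | restart => exact .ret fun _ _ _ => hres

/-- A CAS that removes the branch of `k`, an snode with key `k`, makes `remove` take effect. -/
theorem Safe.cas_remove {i c a lev bmp : ℕ} {k : K} {v : V} {arr : List Addr} {m' : Option Addr}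
    (hi : OnPath W hash w k i lev) (hc : w.mem.heap c = some (.cnode bmp arr))
    (ha : branch bmp arr (chunk W lev (hash k)) = some a)
    (hs : w.mem.heap a = some (.snode k v false))
    (hm' : (m' = none ∧ ∀ j, j ≠ chunk W lev (hash k) → branch bmp arr j = none) ∨
      ∃ c' bmp' arr', m' = some c' ∧ w.mem.heap c' = some (.cnode bmp' arr') ∧ w.pre c' = w.pre i ∧
        w.Knows t c' ∧
        ∀ j, branch bmp' arr' j = if j = chunk W lev (hash k) then none else branch bmp arr j) :
    Safe W hash t (.remove k) n (.cas i (some c) m' fun b =>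
      if b = true then .ret (Res.found v) else .ret Res.restart) none w
      fun r ph' _ => ph' = r.status := by
  refine .cas (bmp := bmp) (arr := arr) (fun w1 hr1 hi1 hm => ?_) (.ret fun _ _ _ => rfl)
  have hp1 := hi.ext hr1.toExt
  have hc1 := hr1.cnode hc
  have hs1 := hr1.snode hs
  have hcs : CanSet W hash w1 t i c bmp arr m' := by
    rcases hm' with ⟨rfl, h⟩ | ⟨c', bmp', arr', rfl, hc', hpre, hk, hbr⟩
    · refine ⟨hp1.pub.1, hm, hc1, fun b hb => (by cases hb), by simp, fun r j d _ _ hj hd _ => ?_⟩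
      by_cases e : r = chunk W lev (hash k)
      · subst e
        rw [ha] at hj; cases hj
        rw [hs1] at hd; cases hd
      · rw [h r e] at hj; cases hj
    · refine ⟨hp1.pub.1, hm, hc1, ?_, ?_, keepsLive_update (hr1.cnode hc') hbr ?_⟩
      · rintro _ ⟨⟩
        refine .inl ⟨_, _, hr1.cnode hc', ?_⟩
        rw [hr1.pre hc', hpre, hr1.pre hi.pub.2.choose_spec]
      · rintro _ ⟨⟩; exact hr1.knows hc' hk
      · intro b m hb h
        rw [ha] at hb; cases hb
        rw [hs1] at h; cases h
  refine ⟨hcs, _, hcs.effect_remove hi1 hp1.isHashPrefix ?_ fun k' => ?_,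
    fun w2 _ _ => .ret fun _ _ _ => rfl⟩
  · rw [← hp1.level, hasMain_cnode hc1]
    exact ⟨a, ha, (hasBelow_snode hs1).2 rfl⟩
  · rw [← hp1.level]
    have hrest : chunk W lev (hash k') = chunk W lev (hash k) →
        (HasMain W hash w1.mem k' lev (some c) ↔ k = k') := by
      intro e
      rw [hasMain_cnode hc1, e]
      simp [ha, hasBelow_snode hs1]
    rcases hm' with ⟨rfl, h⟩ | ⟨c', bmp', arr', rfl, hc', -, -, hbr⟩
    · simp only [hasMain_none, false_iff, not_and, not_not]
      intro hk'
      by_cases e : chunk W lev (hash k') = chunk W lev (hash k)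
      · exact ((hrest e).1 hk').symm
      · rw [hasMain_cnode hc1, h _ e] at hk'
        simp at hk'
    · rw [hasMain_update hc1 (hr1.cnode hc') hbr]
      split_ifs with e
      · simp [hrest e, eq_comm]
      · have : k' ≠ k := by rintro rfl; exact e rfl
        simp [this]

/-- An unsuccessful `remove` takes effect when it reads the `main` of the last inode, a successful
one in its CAS. -/
theorem safe_iremove {i : Addr} {k : K} {lev : ℕ} {parent : Option Addr}
    (hi : OnPath W hash w k i lev) (hp : ∀ p, parent = some p → w.PubInode p) :
    Safe W hash t (.remove k : Op K V) n (body W hash (.iremove i k lev parent)) none w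
      fun r ph' _ => ph' = r.status := by
  induction n using Nat.strong_induction_on generalizing w i lev parent with
  | _ n ih =>
  simp only [body, iremoveBody, bind_eq, pure_eq, rd, Ctrie.load, Ctrie.cas, Ctrie.call,
    Ctrie.alloc, Prog.bind]
  refine .read_effect fun w1 m hr1 hi1 hm => ?_
  have hp1 := hi.ext hr1.toExt
  have hpar1 := fun p hq => (hp p hq).ext hr1.toExt
  have clean : Safe W hash t (.remove k : Op K V) n
      ((cleanParent parent).bind fun _ => .ret (.restart : Res V)) none w1
        fun r ph' _ => ph' = r.status :=
    (safe_cleanParent hpar1).bind fun _ ph' w' _ _ h => .ret fun _ _ _ => h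
  cases m with
  | none => exact ⟨none, .inl ⟨rfl, rfl⟩, clean⟩
  | some c =>
  rcases hi1.main_cases hm with ⟨bmp, arr, hc, hpre⟩ | ⟨k', v, hs, -⟩
  swap
  · exact ⟨none, .inl ⟨rfl, rfl⟩, .load_snode hs clean⟩
  have hmem := hp1.mem_iff hi1 hm hc
  by_cases hf : Flagged bmp (chunk W lev (hash k))
  swap
  · have hnot : k ∉ absSet W hash w1.mem := by simp [hmem, branch_of_not_flagged hf]
    refine ⟨some false, effect_read false ?_ ?_, .load_cnode hc ?_⟩
    · simp [Op.apply, hnot]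
    · simp [Op.key, hnot]
    · dsimp only
      rw [if_pos (not_not.1 hf)]
      exact .ret fun _ _ _ => rfl
  have hok := hi1.wf.node c _ hc
  obtain ⟨a, ha⟩ := exists_branch hok.2.1 hf
  have hmem' : k ∈ absSet W hash w1.mem ↔ HasBelow W hash w1.mem k (lev + W) a := by
    simp [hmem, ha]
  rcases hok.2.2 _ _ ha with ⟨m, hI, -⟩ | ⟨k', v', hs, -⟩
  · refine ⟨none, .inl ⟨rfl, rfl⟩, .load_cnode hc ?_⟩
    dsimp only
    rw [if_neg hf]
    refine .fetch fun a' ha' => ?_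
    rw [← branch_of_flagged hf, ha] at ha'; cases ha'
    refine .load_inode ⟨m, hI⟩ fun _ => .bind (Q₁ := fun r ph' _ => ph' = r.status)
      (.call (fun m' hm' w2 hr2 _ => ih m' hm'
      ((hp1.child hi1 hm hc hpre ha ⟨m, hI⟩).ext hr2.toExt) ?_) fun _ ph' w' _ _ h =>
      .ret fun _ _ _ => h) fun res ph' w2 hx2 _ h => ?_
    · rintro _ ⟨⟩
      exact hp1.pub.ext hr2.toExt
    · exact safe_contract (hp1.pub.ext hx2) (fun p hq => (hpar1 p hq).ext hx2) h
  · by_cases e : k' = k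
    · subst e
      refine ⟨none, .inl ⟨rfl, rfl⟩, .load_cnode hc ?_⟩
      dsimp only
      rw [if_neg hf]
      refine .fetch fun a' ha' => ?_
      rw [← branch_of_flagged hf, ha] at ha'; cases ha'
      refine .load_snode hs (.bind (Q₁ := fun r ph' _ => ph' = r.status) ?_
        fun res ph' w2 hx2 _ h =>
          safe_contract (hp1.pub.ext hx2) (fun p hq => (hpar1 p hq).ext hx2) h)
      dsimp only
      rw [if_pos rfl]
      split_ifs with hlen
      · -- In an array of length 1 any two flagged indices have the same position.
        refine .cas_remove hp1 hc ha hs (.inl ⟨rfl, fun j hj => ?_⟩)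
        by_contra hne
        have hfj : Flagged bmp j := by
          by_contra hfj; exact hne (branch_of_not_flagged fun h => h hfj)
        have h1 := pos_lt_bitcount hf
        have h2 := pos_lt_bitcount hfj
        rw [hok.2.1, hlen] at h1 h2
        rcases Nat.lt_or_gt_of_ne hj with h | h
        · have := pos_lt_pos hfj h; omega
        · have := pos_lt_pos hf h; omega
      · refine .alloc (w1.pre c) (nodeOk_eraseIdx hok hf) ?_
          fun w2 c' hr2 _ hc' hpc hoc _ => ?_
        · rintro b ⟨j, hj⟩
          rw [branch_eraseIdx hf] at hj
          split_ifs at hj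
          exact .inl (hi1.knows_branch (hi1.child_pub i _ c hm rfl hp1.pub.1) hc hj)
        · refine .cas_remove (hp1.ext hr2.toExt) (hr2.cnode hc) ha (hr2.snode hs)
            (.inr ⟨c', _, _, rfl, hc', ?_, .inr hoc, branch_eraseIdx hf⟩)
          rw [hpc, hpre, hr2.pre hm]
    · have hnot : k ∉ absSet W hash w1.mem := by simp [hmem', hasBelow_snode hs, e]
      refine ⟨some false, effect_read false ?_ ?_, .load_cnode hc ?_⟩
      · simp [Op.apply, hnot]
      · simp [Op.key, hnot]
      dsimp only
      rw [if_neg hf]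
      refine .fetch fun a' ha' => ?_
      rw [← branch_of_flagged hf, ha] at ha'; cases ha'
      refine .load_snode hs (.bind (Q₁ := fun r ph' _ => ph' = r.status) ?_
        fun res ph' w2 hx2 _ h =>
          safe_contract (hp1.pub.ext hx2) (fun p hq => (hpar1 p hq).ext hx2) h)
      dsimp only
      rw [if_neg e]
      exact .ret fun _ _ _ => rfl

/-! ### The operations -/

theorem safe_isNullInode {r : Option Addr} :
    Safe W hash t op n (isNullInode r) ph w fun b ph' w' => ph' = ph ∧
      (b = true → ∀ a, r = some a → w'.mem.heap a = some (.inode none)) := by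
  cases r with
  | none => exact .ret fun _ _ _ => ⟨rfl, by simp⟩
  | some a =>
    simp only [isNullInode, bind_eq, pure_eq, rd, Prog.bind]
    refine .read fun w1 m hr1 hi1 hm => .ret fun w2 hr2 _ => ⟨rfl, fun h => ?_⟩
    rintro _ ⟨⟩
    cases m with
    | none => exact hr2.null hm
    | some => cases h

/-- Removing a null-inode from the root does not change the abstract set, which is empty. -/
theorem Safe.casRoot_none {α : Type} {i : Addr} {f : Bool → Prog K V α}
    {Q : α → Option Bool → World K V T → Prop} (hi : w.mem.heap i = some (.inode none))
    (h : ∀ b w', Ext w w' → Inv W hash w' → Safe W hash t op n (f b) ph w' Q)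
    (hw : Inv W hash w) :
    Safe W hash t op n (.casRoot (some i) none f) ph w Q := by
  refine .casRoot (fun w1 hr1 hi1 hroot => ?_) (h false w (Ext.refl w) hw)
  have hdead : ∀ a, w1.mem.root = some a → w1.mem.heap a = some (.inode none) := by
    intro a ha
    rw [hroot] at ha; cases ha
    exact hr1.null hi
  refine ⟨⟨hdead, by simp⟩, ph, .inl ⟨rfl, ?_⟩,
    fun w2 hx2 hi2 => h true w2 (hr1.toExt.trans hx2) hi2⟩
  rw [absSet_of_dead hdead, absSet_of_dead]
  rintro a ⟨⟩

theorem safe_lookup {k : K} :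
    Safe W hash t (.lookup k : Op K V) n (body W hash (.lookup k)) none w
      fun r ph' _ => ph' = some r.isSome := by
  induction n using Nat.strong_induction_on generalizing w with
  | _ n ih =>
  simp only [body, lookupBody, bind_eq, pure_eq, rdRoot, Ctrie.casRoot, Ctrie.call, Prog.bind]
  have again {w : World K V T} : Safe W hash t (.lookup k : Op K V) n
      (.call (.lookup k) .ret) none w fun r ph' _ => ph' = some r.isSome :=
    .call (c := .lookup k) (f := .ret) (fun m hm w' _ _ => ih m hm)
      fun _ ph' w' _ _ h => .ret fun _ _ _ => h
  refine .readRoot fun w1 hr1 hi1 => ?_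
  cases hroot : w1.mem.root with
  | none =>
    refine ⟨some false, effect_read false rfl ?_, .ret fun _ _ _ => rfl⟩
    simp [absSet, hroot]
  | some i =>
    refine ⟨none, .inl ⟨rfl, rfl⟩, safe_isNullInode.bind fun b ph' w2 hx2 hi2 h => ?_⟩
    obtain ⟨rfl, h⟩ := h
    split_ifs with hb
    · exact .casRoot_none (h hb i rfl) (fun _ _ _ _ => again) hi2
    · refine .call (fun m _ w3 hr3 _ => safe_ilookup
        ((hi1.onPath_root k hroot).ext (hx2.trans hr3.toExt)) (by simp)) fun r ph' w3 _ _ h => ?_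
      subst h
      cases r with
      | found v => exact .ret fun _ _ _ => rfl
      | notFound => exact .ret fun _ _ _ => rfl
      | restart => exact again

theorem safe_remove {k : K} :
    Safe W hash t (.remove k : Op K V) n (body W hash (.remove k)) none w
      fun r ph' _ => ph' = some r.isSome := by
  induction n using Nat.strong_induction_on generalizing w with
  | _ n ih =>
  simp only [body, removeBody, bind_eq, pure_eq, rdRoot, Ctrie.casRoot, Ctrie.call, Prog.bind]
  have again {w : World K V T} : Safe W hash t (.remove k : Op K V) n
      (.call (.remove k) .ret) none w fun r ph' _ => ph' = some r.isSome :=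
    .call (c := .remove k) (f := .ret) (fun m hm w' _ _ => ih m hm)
      fun _ ph' w' _ _ h => .ret fun _ _ _ => h
  refine .readRoot fun w1 hr1 hi1 => ?_
  cases hroot : w1.mem.root with
  | none =>
    have : absSet W hash w1.mem = ∅ := absSet_of_dead (by simp [hroot])
    refine ⟨some false, effect_read false ?_ ?_, .ret fun _ _ _ => rfl⟩
    · simp [Op.apply, this]
    · simp [this]
  | some i =>
    refine ⟨none, .inl ⟨rfl, rfl⟩, safe_isNullInode.bind fun b ph' w2 hx2 hi2 h => ?_⟩
    obtain ⟨rfl, h⟩ := h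
    split_ifs with hb
    · exact .casRoot_none (h hb i rfl) (fun _ _ _ _ => again) hi2
    · refine .call (fun m _ w3 hr3 _ => safe_iremove
        ((hi1.onPath_root k hroot).ext (hx2.trans hr3.toExt)) (by simp)) fun r ph' w3 _ _ h => ?_
      subst h
      cases r with
      | found v => exact .ret fun _ _ _ => rfl
      | notFound => exact .ret fun _ _ _ => rfl
      | restart => exact again

theorem safe_insert {k : K} {v : V} :
    Safe W hash t (.insert k v) n (body W hash (.insert k v)) none w
      fun _ ph' _ => ∃ s, ph' = some s := by
  induction n using Nat.strong_induction_on generalizing w with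
  | _ n ih =>
  simp only [body, insertBody, bind_eq, pure_eq, rdRoot, Ctrie.casRoot, Ctrie.call,
    Ctrie.alloc, Prog.bind]
  have again {w : World K V T} : Safe W hash t (.insert k v) n
      (.call (.insert k v) .ret) none w fun _ ph' _ => ∃ s, ph' = some s :=
    .call (c := .insert k v) (f := .ret) (fun m hm w' _ _ => ih m hm)
      fun _ ph' w' _ _ h => .ret fun _ _ _ => h
  refine .readRoot fun w1 hr1 hi1 => ⟨none, .inl ⟨rfl, rfl⟩, ?_⟩
  refine safe_isNullInode.bind fun b ph' w2 hx2 hi2 h => ?_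
  obtain ⟨rfl, h⟩ := h
  split_ifs with hb
  · have hnull := h hb
    have hq : IsHashPrefix W (hash k) ([] ++ [chunk W 0 (hash k)]) :=
      isHashPrefix_append.2 ⟨isHashPrefix_nil _ _, rfl⟩
    refine .alloc [] trivial (fun _ => False.elim) fun w3 s hr3 _ hs _ hos _ => ?_
    refine .alloc [] (nodeOk_flag (chunk_lt _ _ _) (.inr ⟨k, v, hs, hq⟩)) ?_
      fun w4 c hr4 _ hc hpc hoc _ => ?_
    · rintro b ⟨j, hj⟩
      rw [branch_flag] at hj
      split_ifs at hj
      cases hj; exact .inr hos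
    refine .alloc [] ?_ ?_ fun w5 i hr5 hi5 hi hpi hoi hni => ?_
    · rintro _ ⟨⟩; exact .inl ⟨_, _, hc, hpc⟩
    · rintro _ ⟨⟩; exact .inr hoc
    refine .casRoot (fun w6 hr6 hi6 hroot => ?_) again
    have hr := ((hr3.trans hr4).trans hr5).trans hr6
    have hdead : ∀ a, w6.mem.root = some a → w6.mem.heap a = some (.inode none) :=
      fun a ha => hr.null (hnull a (hroot.symm.trans ha))
    have hi6 := (hr6.priv i _ hni hoi hi).2
    have hcs : CanSetRoot w6 t (some i) := by
      refine ⟨hdead, ?_⟩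
      rintro _ ⟨⟩
      exact ⟨hr6.knows hi (.inr hoi), (hr6.pre hi).trans hpi, _, hi6⟩
    -- The abstract set is empty as long as the old root is null or a null-inode.
    refine ⟨hcs, some false, .inr ⟨rfl, false, rfl, ?_, ?_⟩,
      fun _ _ _ => .ret fun _ _ _ => ⟨_, rfl⟩⟩
    · rw [absSet_of_dead hdead]
      ext k'
      have : k' ∈ absSet W hash (w6.mem.setRoot (some i)) ↔
          HasKey W hash w6.mem k' 0 i := by
        rw [← hasKey_setRoot (b := some i)]
        simp [absSet, Mem.setRoot]
      rw [this, hasKey_inode hi6, hasMain_cnode ((hr5.trans hr6).cnode hc), branch_flag]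
      simp only [Op.apply, Set.empty_union, Set.mem_singleton_iff]
      constructor
      · rintro ⟨b, hb, hk⟩
        split_ifs at hb
        cases hb
        exact ((hasBelow_snode (((hr4.trans hr5).trans hr6).snode hs)).1 hk).symm
      · rintro rfl
        exact ⟨s, by simp, (hasBelow_snode (((hr4.trans hr5).trans hr6).snode hs)).2 rfl⟩
    · simp [absSet_of_dead hdead]
  · cases hroot : w1.mem.root with
    | none => exact .crash
    | some i =>
      refine .call (fun m _ w3 hr3 _ => safe_iinsert
        ((hi1.onPath_root k hroot).ext (hx2.trans hr3.toExt)) (by simp)) fun r ph' w3 _ _ h => ?_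
      split_ifs at h ⊢
      · exact .ret fun _ _ _ => h
      · subst h; exact again

/-- Every operation is safe, and has taken effect, with the right result, when it returns. -/
theorem safe_code (op : Op K V) :
    Safe W hash t op n op.code none w fun r ph' _ =>
      ∃ s : Bool, ph' = some s ∧ ∀ A : Set K, (s = true ↔ op.key ∈ A) → op.ResultOk A r := by
  cases op with
  | insert k v =>
    exact .call (fun m _ w' _ _ => safe_insert) fun _ ph' w' _ _ ⟨s, h⟩ =>
      .ret fun _ _ _ => ⟨s, h, fun _ _ => trivial⟩
  | remove k =>
    exact .call (c := .remove k) (f := .ret) (fun m _ w' _ _ => safe_remove)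
      fun r ph' w' _ _ h => .ret fun _ _ _ => ⟨_, h, fun _ h => h⟩
  | lookup k =>
    exact .call (c := .lookup k) (f := .ret) (fun m _ w' _ _ => safe_lookup)
      fun r ph' w' _ _ h => .ret fun _ _ _ => ⟨_, h, fun _ h => h⟩

end

/-! ### Executions -/

/-- The steps that thread `th` has made from time `i + 1` until time `n` fit the status `ph` of the
operation `op`, which was invoked at time `i`. -/
def History (A : ℕ → Set K) (t : ℕ → T) (th : T) (op : Op K V) (i n : ℕ) : Option Bool → Prop
  | none => ∀ m, i < m → m < n → t m = th → A (m + 1) = A m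
  | some s => ∃ m₀, i < m₀ ∧ m₀ < n ∧ t m₀ = th ∧ A (m₀ + 1) = op.apply (A m₀) ∧
      (s = true ↔ op.key ∈ A m₀) ∧ ∀ m, i < m → m < n → t m = th → m ≠ m₀ → A (m + 1) = A m

section

variable {A : ℕ → Set K} {t : ℕ → T} {th : T} {op : Op K V} {i n : ℕ} {ph ph' : Option Bool}

theorem History.step_self (h : History A t th op i n ph) (hi : i < n) (ht : t n = th)
    (he : Effect op ph (A n) (A (n + 1)) ph') : History A t th op i (n + 1) ph' := by
  rcases he with ⟨rfl, he⟩ | ⟨rfl, s, rfl, h1, h2⟩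
  · cases ph' with
    | none =>
      intro m h1 h2 h3
      rcases Nat.lt_succ_iff_lt_or_eq.1 h2 with h2 | rfl
      · exact h m h1 h2 h3
      · exact he
    | some s =>
      obtain ⟨m₀, h1, h2, h3, h4, h5, h6⟩ := h
      refine ⟨m₀, h1, by omega, h3, h4, h5, fun m g1 g2 g3 g4 => ?_⟩
      rcases Nat.lt_succ_iff_lt_or_eq.1 g2 with g2 | rfl
      · exact h6 m g1 g2 g3 g4
      · exact he
  · refine ⟨n, hi, by omega, ht, h1, h2, fun m g1 g2 g3 g4 => ?_⟩
    exact h m g1 (by omega) g3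

theorem History.step_other (h : History A t th op i n ph) (ht : t n ≠ th) :
    History A t th op i (n + 1) ph := by
  have lt {m} (h2 : m < n + 1) (h3 : t m = th) : m < n := by
    rcases Nat.lt_succ_iff_lt_or_eq.1 h2 with h2 | rfl
    · exact h2
    · exact absurd h3 ht
  cases ph with
  | none => exact fun m h1 h2 h3 => h m h1 (lt h2 h3) h3
  | some s =>
    obtain ⟨m₀, h1, h2, h3, h4, h5, h6⟩ := h
    exact ⟨m₀, h1, by omega, h3, h4, h5, fun m g1 g2 g3 g4 => h6 m g1 (lt g2 g3) g3 g4⟩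

end

section

variable {t : ℕ → T} {e : ℕ → Event K V} {th : T} {op : Op K V} {i n : ℕ}

theorem Runs.step_self (h : Runs t e th op i n) (he : e n = .internal) :
    Runs t e th op i (n + 1) := by
  obtain ⟨h1, h2, h3, h4⟩ := h
  refine ⟨by omega, h2, h3, fun m g1 g2 g3 => ?_⟩
  rcases Nat.lt_succ_iff_lt_or_eq.1 g2 with g2 | rfl
  · exact h4 m g1 g2 g3
  · exact he

theorem Runs.step_other (h : Runs t e th op i n) (ht : t n ≠ th) :
    Runs t e th op i (n + 1) := by
  obtain ⟨h1, h2, h3, h4⟩ := h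
  refine ⟨by omega, h2, h3, fun m g1 g2 g3 => ?_⟩
  rcases Nat.lt_succ_iff_lt_or_eq.1 g2 with g2 | rfl
  · exact h4 m g1 g2 g3
  · exact absurd g3 ht

theorem Runs.of_succ (h : Runs t e th op i (n + 1)) :
    Runs t e th op i n ∨ i = n ∧ t n = th ∧ e n = .invoke op := by
  obtain ⟨h1, h2, h3, h4⟩ := h
  rcases Nat.lt_succ_iff_lt_or_eq.1 h1 with h1 | rfl
  · exact .inl ⟨h1, h2, h3, fun m g1 g2 g3 => h4 m g1 (by omega) g3⟩
  · exact .inr ⟨rfl, h2, h3⟩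

/-- A thread runs at most one operation at a time. -/
theorem Runs.unique {op' : Op K V} {i' : ℕ} (h : Runs t e th op i n)
    (h' : Runs t e th op' i' n) : i = i' ∧ op = op' := by
  obtain ⟨h1, h2, h3, h4⟩ := h
  obtain ⟨g1, g2, g3, g4⟩ := h'
  rcases Nat.lt_trichotomy i i' with hlt | rfl | hlt
  · have := h4 i' hlt g1 g2
    rw [g3] at this; cases this
  · rw [h3] at g3; cases g3
    exact ⟨rfl, rfl⟩
  · have := g4 i hlt h1 h2
    rw [h3] at this; cases this

end

/-- The world of the empty Ctrie. -/
def World.init (K V T : Type) : World K V T where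
  mem := Mem.init K V
  pre := fun _ => []
  pub := ∅
  own := fun _ => none

theorem inv_init (W : ℕ) (hash : K → ℕ) : Inv W hash (World.init K V T) where
  wf := ⟨fun _ _ => rfl, fun a h => (by cases h), fun a n h => (by cases h)⟩
  pub_alloc _ h := h.elim
  root_pub _ h := by cases h
  child_pub _ _ _ h := by cases h
  child_own _ _ _ h := by cases h
  live _ _ _ _ h := h.elim

section

variable [DecidableEq K] [DecidableEq T]

/-- The state of an execution at time `n`: the invariant holds with some ghost state, and each
running thread has a history that fits the status of its operation, and is safe for its next `fuel`
steps. -/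
def Good (W : ℕ) (hash : K → ℕ) (c : ℕ → Config K V T) (t : ℕ → T) (e : ℕ → Event K V)
    (fuel n : ℕ) : Prop :=
  ∃ w : World K V T, w.mem = (c n).mem ∧ Inv W hash w ∧ ∀ th,
    ((c n).thr th = .idle → ∀ op i, ¬ Runs t e th op i n) ∧
    ∀ p, (c n).thr th = .running p → ∃ op i ph, Runs t e th op i n ∧
      History (fun m => absSet W hash (c m).mem) t th op i n ph ∧
      Safe W hash th op fuel p ph w fun r ph' _ =>
        ∃ s : Bool, ph' = some s ∧ ∀ A : Set K, (s = true ↔ op.key ∈ A) → op.ResultOk A r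

variable {W : ℕ} {hash : K → ℕ} {N : ℕ} {c : ℕ → Config K V T} {t : ℕ → T} {e : ℕ → Event K V}

/-- A step of the acting thread is admitted by its own safety, and is harmless to the others. -/
theorem good_succ {fuel n : ℕ} (h : Good W hash c t e (fuel + 1) n)
    (hs : Step W hash (c n) (t n) (e n) (c (n + 1))) : Good W hash c t e fuel (n + 1) := by
  obtain ⟨w, hmem, hinv, hth⟩ := h
  -- The threads that do not make the step only see a change of the world.
  have other {w' : World K V T} {x : ThreadState K V} {th : T} (hne : th ≠ t n)
      (hthr : (c (n + 1)).thr = Function.update (c n).thr (t n) x) (hr : Rely th w w') :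
      ((c (n + 1)).thr th = .idle → ∀ op i, ¬ Runs t e th op i (n + 1)) ∧
      ∀ p, (c (n + 1)).thr th = .running p → ∃ op i ph, Runs t e th op i (n + 1) ∧
        History (fun m => absSet W hash (c m).mem) t th op i (n + 1) ph ∧
        Safe W hash th op fuel p ph w' fun r ph' _ =>
          ∃ s : Bool, ph' = some s ∧ ∀ A : Set K, (s = true ↔ op.key ∈ A) → op.ResultOk A r := by
    rw [hthr, Function.update_of_ne hne]
    refine ⟨fun hid op i hr => ?_, fun p hp => ?_⟩
    · rcases hr.of_succ with hr | ⟨-, hr, -⟩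
      · exact (hth th).1 hid op i hr
      · exact hne hr.symm
    · obtain ⟨op, i, ph, h1, h2, h3⟩ := (hth th).2 p hp
      exact ⟨op, i, ph, h1.step_other hne.symm, h2.step_other hne.symm, (h3.rely hr).pred⟩
  generalize hc' : c (n + 1) = c' at hs
  generalize he : e n = ev at hs
  cases hs with
  | invoke op hid =>
    have hthr : (c (n + 1)).thr = Function.update (c n).thr (t n) (.running op.code) := by rw [hc']
    refine ⟨w, by rw [hc', hmem], hinv, fun th => ?_⟩
    by_cases hne : th = t n
    · subst hne
      rw [hthr, Function.update_self]
      refine ⟨by simp, fun p hp => ?_⟩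
      cases hp
      exact ⟨op, n, none, ⟨by omega, rfl, he, fun m _ _ _ => by omega⟩,
        fun m _ _ _ => by omega, safe_code op⟩
    · exact other hne hthr (Rely.refl _ _)
  | internal p p' σ' hrun hstep =>
    have hthr : (c (n + 1)).thr = Function.update (c n).thr (t n) (.running p') := by rw [hc']
    obtain ⟨op, i, ph, h1, h2, h3⟩ := (hth (t n)).2 p hrun
    rw [← hmem] at hstep
    obtain ⟨w', ph', g1, g2, g3, g4, g5, g6⟩ := (h3 w (Rely.refl _ _) hinv).2 σ' p' hstep
    refine ⟨w', by rw [hc', g1], g2, fun th => ?_⟩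
    by_cases hne : th = t n
    · subst hne
      rw [hthr, Function.update_self]
      refine ⟨by simp, fun p hp => ?_⟩
      cases hp
      refine ⟨op, i, ph', h1.step_self he, h2.step_self h1.1 rfl ?_, g6⟩
      show Effect op ph (absSet W hash (c n).mem) (absSet W hash (c (n + 1)).mem) ph'
      rw [hc', ← hmem]
      exact g5
    · exact other hne hthr (g4 th hne)
  | response r hrun =>
    have hthr : (c (n + 1)).thr = Function.update (c n).thr (t n) .idle := by rw [hc']
    refine ⟨w, by rw [hc', hmem], hinv, fun th => ?_⟩
    by_cases hne : th = t n
    · subst hne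
      rw [hthr, Function.update_self]
      refine ⟨fun _ op i hr => ?_, by simp⟩
      rcases hr.of_succ with hr' | ⟨-, -, hr'⟩
      · have := hr.2.2.2 n hr'.1 (by omega) rfl
        rw [he] at this; cases this
      · rw [he] at hr'; cases hr'
    · exact other hne hthr (Rely.refl _ _)

theorem IsExecution.good (h : IsExecution W hash N c t e) {n : ℕ} (hn : n ≤ N) (fuel : ℕ) :
    Good W hash c t e fuel n := by
  induction n generalizing fuel with
  | zero =>
    refine ⟨World.init K V T, by rw [h.init]; rfl, inv_init W hash, fun th => ?_⟩
    rw [h.init]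
    exact ⟨fun _ op i hr => Nat.not_lt_zero _ hr.1, fun p hp => by cases hp⟩
  | succ n ih => exact good_succ (ih (by omega) _) (h.step n (by omega))

/-- An operation that is running has a status that its history fits, and its result, if there is
one, agrees with this status. -/
theorem IsExecution.exists_history (h : IsExecution W hash N c t e) {th : T} {op : Op K V}
    {i n : ℕ} (hn : n ≤ N) (hr : Runs t e th op i n) :
    ∃ ph, History (fun m => absSet W hash (c m).mem) t th op i n ph ∧
      ∀ r, (c n).thr th = .running (.ret r) → ∃ s : Bool, ph = some s ∧
        ∀ A : Set K, (s = true ↔ op.key ∈ A) → op.ResultOk A r := by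
  obtain ⟨w, hmem, hinv, hth⟩ := h.good hn 1
  cases hx : (c n).thr th with
  | idle => exact absurd hr ((hth th).1 hx op i)
  | running p =>
    obtain ⟨op', i', ph, h1, h2, h3⟩ := (hth th).2 p hx
    obtain ⟨rfl, rfl⟩ := hr.unique h1
    refine ⟨ph, h2, fun r e => ?_⟩
    cases e
    exact (h3 w (Rely.refl _ _) hinv).1 r rfl

theorem IsExecution.followsSetSemantics (h : IsExecution W hash N c t e) :
    FollowsSetSemantics N t e fun n => absSet W hash (c n).mem where
  change n hn hne := by
    have hs := h.step n hn
    generalize hc' : c (n + 1) = c' at hs hne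
    generalize he : e n = ev at hs
    cases hs with
    | invoke op hid => exact absurd rfl hne
    | response r hrun => exact absurd rfl hne
    | internal p p' σ' hrun hstep =>
      obtain ⟨w, hmem, hinv, hth⟩ := h.good hn.le 1
      obtain ⟨op, i, ph, h1, h2, h3⟩ := (hth (t n)).2 p hrun
      rw [← hmem] at hstep
      obtain ⟨w', ph', g1, g2, g3, g4, g5, g6⟩ := (h3 w (Rely.refl _ _) hinv).2 σ' p' hstep
      rw [hmem] at g5
      refine ⟨op, i, h1.1, h1.step_self he, ?_⟩
      rcases g5 with ⟨-, g5⟩ | ⟨-, s, -, g5, -⟩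
      · exact absurd g5 hne
      · exact g5
  once th op i j hj hr m n him hmj hin hnj hm hn hAm hAn := by
    obtain ⟨ph, hh, -⟩ := h.exists_history hj hr
    cases ph with
    | none => exact absurd (hh m him hmj hm) hAm
    | some s =>
      obtain ⟨m₀, h1, h2, h3, h4, h5, h6⟩ := hh
      have em : m = m₀ := by
        by_contra hc; exact hAm (h6 m him hmj hm hc)
      have en : n = m₀ := by
        by_contra hc; exact hAn (h6 n hin hnj hn hc)
      rw [em, en]
  complete th op i j r hj hr ht he := by
    obtain ⟨ph, hh, hret⟩ := h.exists_history hj.le hr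
    have hrun : (c j).thr th = .running (.ret r) := by
      have hs := h.step j hj
      rw [he, ht] at hs
      generalize c (j + 1) = c' at hs
      cases hs with
      | response r hrun => exact hrun
    obtain ⟨s, rfl, hok⟩ := hret r hrun
    obtain ⟨m₀, h1, h2, h3, h4, h5, h6⟩ := hh
    exact ⟨m₀, h1, h2, h3, h4, hok _ h5, h6⟩

end

end Ctrie

theorem mainTheorem1 {K V T : Type} [DecidableEq K] [DecidableEq T] (W : ℕ) (hash : K → ℕ)
    (N : ℕ) (c : ℕ → Ctrie.Config K V T) (t : ℕ → T) (e : ℕ → Ctrie.Event K V)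
    (hexec : Ctrie.IsExecution W hash N c t e) :
    ∃ A : ℕ → Set K,
      (∀ n ≤ N, Ctrie.Valid W hash (c n).mem ∧ Ctrie.Consistent W hash (c n).mem (A n)) ∧
      Ctrie.FollowsSetSemantics N t e A := by
  refine ⟨fun n => Ctrie.absSet W hash (c n).mem, fun n hn => ?_, hexec.followsSetSemantics⟩
  obtain ⟨w, hmem, hinv, -⟩ := hexec.good hn 0
  exact ⟨hmem ▸ Ctrie.valid_of_inv hinv, fun k => Iff.rfl⟩
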